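/- Let $U\subset\mathbb R^N$ be open, with coordinates $u=(u^1,\dots,u^N)$. For smooth functions $g^{ij}, b^{ij}_k$ on $U$ and a constant $K$, consider the bracket of hydrodynamic type $$\{I,J\}=\int \frac{\delta I}{\delta u^i(x)}\Big(P^{ij}\frac{\delta J}{\delta u^j(x)}\Big)dx,\qquad P^{ij}=g^{ij}(u)\frac{d}{dx}+b^{ij}_k(u)\,u^k_x+K\,u^i_x\Big(\frac{d}{dx}\Big)^{-1}u^j_x ,$$ on smooth functionals of fields $u(x)$, $x\in\mathbb R$. Here fields are smooth, take values in $U$, and equal a constant outside a bounded interval (the same constant at both ends); variational derivatives are smooth and have the same behaviour at infinity; and $(d/dx)^{-1}$ is the skew-symmetric inverse of $d/dx$, with kernel $\tfrac12\operatorname{sgn}(x-y)$. The bracket is a Poisson bracket on $U$ if it is skew-symmetric and satisfies the Jacobi identity. Two Poisson brackets are compatible if all their linear combinations are Poisson brackets. Let $\{\cdot,\cdot\}_1$ be a Poisson bracket of this form on $U$, possibly degenerate, with an arbitrary constant $K_1$. Let $\{\cdot,\cdot\}_2$ be a Poisson bracket of this form on $U$ that is local ($K_2=0$) and nondegenerate,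 meaning that $\det(g_2^{ij})$ vanishes identically on no nonempty open subset of $U$. For an open convex $V\subset U$, a system of $N$ annihilators and a momentum of $\{\cdot,\cdot\}_2$ on $V$ consists of smooth functions $n^1,\dots,n^N,m$ on $V$ such that $dn^1,\dots,dn^N$ are linearly independent at every point of $V$, each $\int n^i(u)\,dx$ has zero bracket $\{\cdot,\cdot\}_2$ with every functional, and $\int m(u)\,dx$ generates the $x$-translations, i.e. $P_2^{ij}\,\partial m/\partial u^j=u^i_x$ (all for fields with values in $V$). Theorem. Every point of $U$ at which $\det(g_2^{ij})\neq0$ has an open convex neighbourhood $V\subset U$ on which such a system exists. Moreover, the following are equivalent: (a) $\{\cdot,\cdot\}_1$ and $\{\cdot,\cdot\}_2$ are compatible on $U$; (b) for every open convex $V\subset U$ and every system of $N$ annihilators and a momentum of $\{\cdot,\cdot\}_2$ on $V$, the $N+1$ functionals $\int n^1(u)\,dx,\dots,\int n^N(u)\,dx,\int m(u)\,dx$ are pairwise in involution with respect to $\{\cdot,\cdot\}_1$ on the fields with values in $V$; (c) every point of $U$ at which $\det(g_2^{ij})\ne 0$ has an open convex neighbourhood $V\subset U$ on which some system of $N$ annihilators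 and a momentum of $\{\cdot,\cdot\}_2$ is pairwise in involution with respect to $\{\cdot,\cdot\}_1$. -/

import Mathlib

open scoped ContDiff Topology

noncomputable section

/-- Coefficients of a bracket of hydrodynamic type on a coordinate domain of `ℝ^N`, with operator
`g^{ij}(u) d/dx + b^{ij}_k(u) u^k_x + K u^i_x (d/dx)⁻¹ u^j_x`; `b u i j k` is `b^{ij}_k(u)`.
The bracket is local (of Dubrovin–Novikov form) when `K = 0`. -/
structure HydroBracket (N : ℕ) where
  g : (Fin N → ℝ) → Fin N → Fin N → ℝ
  b : (Fin N → ℝ) → Fin N → Fin N → Fin N → ℝ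
  K : ℝ

/-- A field `u(x)` with values in `U`: smooth, and equal to a constant outside a bounded interval
(the same constant at both ends). -/
structure IsHydroField {N : ℕ} (U : Set (Fin N → ℝ)) (u : ℝ → Fin N → ℝ) : Prop where
  smooth : ContDiff ℝ ∞ u
  mem : ∀ x, u x ∈ U
  const_at_infinity : ∃ c : Fin N → ℝ, ∃ R : ℝ, ∀ x, R ≤ |x| → u x = c

/-- A smooth family of fields `w s`, `s ∈ S`, depending on `k` parameters, all equal to one
constant outside one bounded interval. -/
structure IsHydroFieldFamily {N : ℕ} (U : Set (Fin N → ℝ)) {k : ℕ} (S : Set (Fin k → ℝ))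
    (w : (Fin k → ℝ) → ℝ → Fin N → ℝ) : Prop where
  smooth : ContDiffOn ℝ ∞ (fun q : (Fin k → ℝ) × ℝ => w q.1 q.2) (S ×ˢ Set.univ)
  mem : ∀ s ∈ S, ∀ x, w s x ∈ U
  const_at_infinity : ∃ c : Fin N → ℝ, ∃ R : ℝ, ∀ s ∈ S, ∀ x, R ≤ |x| → w s x = c

/-- A smooth functional `I[u]` on the fields with values in `U`, with its variational derivative
`δI/δu^i(x) = varDeriv u x i`. The variational derivative is defined by
`d/dε I[u + ε v] = ∫ (δI/δu^i(x)) v^i(x) dx` for all compactly supported smooth `v`; along every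
smooth family of fields it is smooth in the parameters and in `x`, and it is constant in `x`
outside a bounded interval that is locally uniform in the parameters. -/
structure SmoothFunctional {N : ℕ} (U : Set (Fin N → ℝ)) where
  toFun : (ℝ → Fin N → ℝ) → ℝ
  varDeriv : (ℝ → Fin N → ℝ) → ℝ → Fin N → ℝ
  hasVarDeriv : ∀ u, IsHydroField U u → ∀ v : ℝ → Fin N → ℝ, ContDiff ℝ ∞ v → HasCompactSupport v →
    HasDerivAt (fun ε : ℝ => toFun (u + ε • v)) (∫ x, ∑ i, varDeriv u x i * v x i) 0
  smooth : ∀ (k : ℕ) (S : Set (Fin k → ℝ)) (w : (Fin k → ℝ) → ℝ → Fin N → ℝ), IsOpen S →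
    IsHydroFieldFamily U S w →
    ContDiffOn ℝ ∞ (fun q : (Fin k → ℝ) × ℝ => varDeriv (w q.1) q.2) (S ×ˢ Set.univ)
  const_at_infinity : ∀ (k : ℕ) (S : Set (Fin k → ℝ)) (w : (Fin k → ℝ) → ℝ → Fin N → ℝ),
    IsOpen S → IsHydroFieldFamily U S w → ∀ s₀ ∈ S, ∃ R : ℝ, ∀ᶠ s in 𝓝 s₀,
      ∃ c : Fin N → ℝ, ∀ x, R ≤ |x| → varDeriv (w s) x = c

/-- The skew-symmetric inverse of `d/dx`, with kernel `(1/2) sgn (x - y)`. -/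
def invD (f : ℝ → ℝ) (x : ℝ) : ℝ :=
  (1 / 2) * ((∫ y in Set.Iic x, f y) - ∫ y in Set.Ioi x, f y)

/-- The variational derivative `∂f/∂u^i (u(x))` of the functional `∫ f(u(x)) dx` of hydrodynamic
type with density `f`. -/
def densityDeriv {N : ℕ} (f : (Fin N → ℝ) → ℝ) (u : ℝ → Fin N → ℝ) : ℝ → Fin N → ℝ :=
  fun x i => fderiv ℝ f (u x) (Pi.single i 1)

namespace HydroBracket

variable {N : ℕ}

/-- The coefficients `g^{ij}` and `b^{ij}_k` are smooth functions on `U`. -/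
def SmoothOn (P : HydroBracket N) (U : Set (Fin N → ℝ)) : Prop :=
  (∀ i j, ContDiffOn ℝ ∞ (fun u => P.g u i j) U) ∧
    ∀ i j k, ContDiffOn ℝ ∞ (fun u => P.b u i j k) U

/-- The operator of the bracket at the field `u`, applied to a covector `ξ_j(x)`. -/
def op (P : HydroBracket N) (u ξ : ℝ → Fin N → ℝ) : ℝ → Fin N → ℝ := fun x i =>
  (∑ j, P.g (u x) i j * deriv ξ x j)
    + (∑ j, ∑ k, P.b (u x) i j k * deriv u x k * ξ x j)
    + P.K * deriv u x i * ∑ j, invD (fun y => deriv u y j * ξ y j) x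

/-- The value at the field `u` of the bracket of two functionals whose variational derivatives
at `u` are `ξ` and `ζ`. -/
def pairing (P : HydroBracket N) (u ξ ζ : ℝ → Fin N → ℝ) : ℝ :=
  ∫ x, ∑ i, ξ x i * P.op u ζ x i

/-- The functional `{I, J}`. -/
def bracket (P : HydroBracket N) {U : Set (Fin N → ℝ)} (I J : SmoothFunctional U) :
    (ℝ → Fin N → ℝ) → ℝ :=
  fun u => P.pairing u (I.varDeriv u) (J.varDeriv u)

/-- The Hamiltonian vector field `u^i_t = P^{ij} δL/δu^j(x)` of the functional `L`. -/
def hamVec (P : HydroBracket N) {U : Set (Fin N → ℝ)} (L : SmoothFunctional U)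
    (u : ℝ → Fin N → ℝ) : ℝ → Fin N → ℝ :=
  P.op u (L.varDeriv u)

/-- The bracket is a Poisson bracket on the functionals of fields with values in `U`: it is
skew-symmetric and satisfies the Jacobi identity
`{{I, J}, L} + {{J, L}, I} + {{L, I}, J} = 0`. Here `{F, L}[u]`, for the functional `F = {I, J}`,
is the derivative `∫ (δF/δu^i(x)) P^{ij} (δL/δu^j(x)) dx` of `F` along the Hamiltonian vector
field of `L`. -/
def IsPoisson (P : HydroBracket N) (U : Set (Fin N → ℝ)) : Prop :=
  (∀ I J : SmoothFunctional U, ∀ u, IsHydroField U u → P.bracket I J u = - P.bracket J I u) ∧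
  ∀ I J L : SmoothFunctional U, ∀ u, IsHydroField U u → ∃ a₁ a₂ a₃ : ℝ,
    HasDerivAt (fun ε : ℝ => P.bracket I J (u + ε • P.hamVec L u)) a₁ 0 ∧
    HasDerivAt (fun ε : ℝ => P.bracket J L (u + ε • P.hamVec I u)) a₂ 0 ∧
    HasDerivAt (fun ε : ℝ => P.bracket L I (u + ε • P.hamVec J u)) a₃ 0 ∧
    a₁ + a₂ + a₃ = 0

/-- The bracket `α {·,·}_P + β {·,·}_Q`. -/
def linComb (α : ℝ) (P : HydroBracket N) (β : ℝ) (Q : HydroBracket N) : HydroBracket N where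
  g := fun u i j => α * P.g u i j + β * Q.g u i j
  b := fun u i j k => α * P.b u i j k + β * Q.b u i j k
  K := α * P.K + β * Q.K

/-- Compatibility: every linear combination of the two brackets is a Poisson bracket. -/
def Compatible (P Q : HydroBracket N) (U : Set (Fin N → ℝ)) : Prop :=
  ∀ α β : ℝ, (linComb α P β Q).IsPoisson U

/-- Nondegeneracy: `det g^{ij}` vanishes identically on no nonempty open subset of `U`. -/
def Nondegenerate (P : HydroBracket N) (U : Set (Fin N → ℝ)) : Prop :=
  U ⊆ closure {a | a ∈ U ∧ Matrix.det (Matrix.of (P.g a)) ≠ 0}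

/-- `∫ f(u(x)) dx` is an annihilator of the bracket on `V`: its bracket with every functional
vanishes. -/
def IsAnnihilator (P : HydroBracket N) (V : Set (Fin N → ℝ)) (f : (Fin N → ℝ) → ℝ) : Prop :=
  ∀ J : SmoothFunctional V, ∀ u, IsHydroField V u →
    P.pairing u (densityDeriv f u) (J.varDeriv u) = 0

/-- `∫ m(u(x)) dx` is a momentum of the bracket on `V`: it generates the translations
`u^i_t = u^i_x`. -/
def IsMomentum (P : HydroBracket N) (V : Set (Fin N → ℝ)) (m : (Fin N → ℝ) → ℝ) : Prop :=
  ∀ u, IsHydroField V u → P.op u (densityDeriv m u) = deriv u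

/-- `n^1, …, n^N` are smooth, functionally independent densities of annihilators, and `m` is a
smooth density of a momentum, of the bracket on `V`. -/
structure IsAnnihilatorsAndMomentum (P : HydroBracket N) (V : Set (Fin N → ℝ))
    (n : Fin N → (Fin N → ℝ) → ℝ) (m : (Fin N → ℝ) → ℝ) : Prop where
  smooth_annihilator : ∀ i, ContDiffOn ℝ ∞ (n i) V
  smooth_momentum : ContDiffOn ℝ ∞ m V
  independent : ∀ a ∈ V, LinearIndependent ℝ (fun i => fderiv ℝ (n i) a)
  annihilator : ∀ i, P.IsAnnihilator V (n i)
  momentum : P.IsMomentum V m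

/-- The functionals `∫ h_α(u(x)) dx` are pairwise in involution on the fields with values
in `V`. -/
def InInvolution (P : HydroBracket N) (V : Set (Fin N → ℝ)) {ι : Type}
    (h : ι → (Fin N → ℝ) → ℝ) : Prop :=
  ∀ α β : ι, ∀ u, IsHydroField V u → P.pairing u (densityDeriv (h α) u) (densityDeriv (h β) u) = 0

/-- The `N` annihilators with densities `n^i` and the momentum with density `m` are in involution
(all `N + 1` functionals, pairwise). -/
def AnnihilatorsAndMomentumInInvolution (P : HydroBracket N) (V : Set (Fin N → ℝ))
    (n : Fin N → (Fin N → ℝ) → ℝ) (m : (Fin N → ℝ) → ℝ) : Prop :=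
  P.InInvolution V (fun α : Option (Fin N) => α.elim m n)

end HydroBracket

end
set_option maxSynthPendingDepth 3

/-!
Evaluating the skew-symmetry and Jacobi identities on fields and functionals concentrated near a
point shows that a bracket is Poisson exactly when a few algebraic conditions hold at every point
between `g`, `b`, `∂b` and `K`: symmetry of `g`, compatibility `∂g^{ij} = b^{ij} + b^{ji}` with the
connection, vanishing torsion, constant curvature `K`, and a cyclic condition which is vacuous where
`g` is nondegenerate. Polarizing them gives pointwise conditions for compatibility.

Two functionals with densities `f`, `h` are in involution on a convex set exactly when a pointwise
bilinear expression in `df`, `dh` and their derivatives is a closed 1-form. The differentials of the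
annihilators of a local nondegenerate bracket are a parallel coframe, and the differential of the
momentum is a covector whose covariant derivative is the inverse of `g₂`. Inserting these, the
involution of the annihilators with the momentum is, modulo their involution with one another, the
polarized torsion condition; the latter is, modulo the torsion condition, the polarized curvature
condition; the cyclic condition follows from these two. This settles the points where `det g₂ ≠ 0`; they are dense and the conditions are
continuous, so compatibility follows everywhere. The annihilators and the momentum themselves exist
because the linear system for a density and its differential is flat.
-/

/-! ### Pointwise algebra of the coefficients -/

/-- The pairing `Σ ξ_i v^i` of covectors and vectors in coordinates, as a bounded bilinear map. -/
noncomputable def coordPairing {N : ℕ} : (Fin N → ℝ) →L[ℝ] (Fin N → ℝ) →L[ℝ] ℝ :=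
  ∑ i, (ContinuousLinearMap.proj (R := ℝ) (φ := fun _ : Fin N => ℝ) i).smulRight
    (ContinuousLinearMap.proj (R := ℝ) (φ := fun _ : Fin N => ℝ) i)

local notation "⟪" ξ "," v "⟫" => coordPairing ξ v

theorem coordPairing_apply {N : ℕ} (ξ v : Fin N → ℝ) : ⟪ξ, v⟫ = ∑ i, ξ i * v i := by
  simp [coordPairing]

theorem coordPairing_single_left {N : ℕ} (i : Fin N) (v : Fin N → ℝ) :
    ⟪Pi.single i (1 : ℝ), v⟫ = v i := by
  simp [coordPairing_apply, Pi.single_apply]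

theorem eq_of_forall_coordPairing {N : ℕ} {v w : Fin N → ℝ}
    (h : ∀ ξ : Fin N → ℝ, ⟪ξ, v⟫ = ⟪ξ, w⟫) : v = w := by
  funext i
  simpa only [coordPairing_single_left] using h (Pi.single i 1)

/-- The values at a point of the coefficients `g`, `b`, of the derivative of `b`, and the
constant `K` of a bracket of hydrodynamic type: `G ξ` is `g^{ij} ξ_j`, `B v ξ` is
`b^{ij}_k v^k ξ_j`, and `D h v ξ` is `∂_l b^{ij}_k h^l v^k ξ_j`. -/
structure HydroJet (N : ℕ) where
  G : (Fin N → ℝ) →L[ℝ] (Fin N → ℝ)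
  B : (Fin N → ℝ) →L[ℝ] (Fin N → ℝ) →L[ℝ] (Fin N → ℝ)
  D : (Fin N → ℝ) →L[ℝ] (Fin N → ℝ) →L[ℝ] (Fin N → ℝ) →L[ℝ] (Fin N → ℝ)
  K : ℝ

namespace HydroJet

variable {N : ℕ}

/-- The data at a point of the bracket `α {·,·} + β {·,·}`. -/
noncomputable def linComb (α : ℝ) (X : HydroJet N) (β : ℝ) (Y : HydroJet N) : HydroJet N where
  G := α • X.G + β • Y.G
  B := α • X.B + β • Y.B
  D := α • X.D + β • Y.D
  K := α * X.K + β * Y.K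

/-- Symmetry of `g^{ij}` at a point. -/
def IsSymm (X : HydroJet N) : Prop :=
  ∀ ξ η, ⟪ξ, X.G η⟫ = ⟪η, X.G ξ⟫

/-- The curl of `b^{ij}_k` in its lower index, corrected by the constant curvature term. -/
noncomputable def curl (X : HydroJet N) (h v ξ η : Fin N → ℝ) : ℝ :=
  ⟪ξ, X.D h v η⟫ - ⟪ξ, X.D v h η⟫ - X.K * (⟪ξ, h⟫ * ⟪η, v⟫ - ⟪η, h⟫ * ⟪ξ, v⟫)

/-- The obstruction to the Jacobi identity which, for `X = Y` nondegenerate, is the torsion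
of the connection with coefficients `b^{ij}_k`; for `X ≠ Y` it is a polarization. -/
noncomputable def torsion (X Y : HydroJet N) (ξ η ζ : Fin N → ℝ) : ℝ :=
  ⟪η, X.B (Y.G ζ) ξ⟫ - ⟪ζ, X.B (Y.G η) ξ⟫

/-- The obstruction to the Jacobi identity which, for `X = Y` nondegenerate, is the deviation of
the connection with coefficients `b^{ij}_k` from constant curvature `K`; for `X ≠ Y` it is a
polarization. -/
noncomputable def curvature (X Y : HydroJet N) (v ξ η ζ : Fin N → ℝ) : ℝ :=
  X.curl (Y.G ζ) v ξ η + ⟪ζ, X.B (Y.B v ξ) η⟫ - ⟪ζ, X.B (Y.B v η) ξ⟫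

/-- The obstruction to the Jacobi identity of order zero in the derivatives of the covectors. For
nondegenerate brackets it follows from the other ones, see
`cyclicCurl_add_cyclicCurl_eq_zero`. -/
noncomputable def cyclicCurl (X Y : HydroJet N) (v ξ η ζ : Fin N → ℝ) : ℝ :=
  X.curl (Y.B v ζ) v ξ η + X.curl (Y.B v ξ) v η ζ + X.curl (Y.B v η) v ζ ξ

/-- The pointwise conditions for a bracket to be Poisson, other than
`∂_k g^{ij} = b^{ij}_k + b^{ji}_k`. -/
structure IsPoisson (X : HydroJet N) : Prop where
  symm : X.IsSymm
  torsion : ∀ ξ η ζ, X.torsion X ξ η ζ = 0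
  curvature : ∀ v ξ η ζ, X.curvature X v ξ η ζ = 0
  cyclicCurl : ∀ v ξ η ζ, X.cyclicCurl X v ξ η ζ = 0

/-- The pointwise conditions for two Poisson brackets to be compatible: the polarized obstructions
vanish. -/
structure Compatible (X Y : HydroJet N) : Prop where
  torsion : ∀ ξ η ζ, X.torsion Y ξ η ζ + Y.torsion X ξ η ζ = 0
  curvature : ∀ v ξ η ζ, X.curvature Y v ξ η ζ + Y.curvature X v ξ η ζ = 0
  cyclicCurl : ∀ v ξ η ζ, X.cyclicCurl Y v ξ η ζ + Y.cyclicCurl X v ξ η ζ = 0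

theorem torsion_linComb (α β : ℝ) (X Y : HydroJet N) (ξ η ζ : Fin N → ℝ) :
    (linComb α X β Y).torsion (linComb α X β Y) ξ η ζ = α ^ 2 * X.torsion X ξ η ζ
      + α * β * (X.torsion Y ξ η ζ + Y.torsion X ξ η ζ) + β ^ 2 * Y.torsion Y ξ η ζ := by
  simp only [torsion, linComb, add_apply, smul_apply, map_add, map_smul, smul_eq_mul]
  ring

theorem curvature_linComb (α β : ℝ) (X Y : HydroJet N) (v ξ η ζ : Fin N → ℝ) :
    (linComb α X β Y).curvature (linComb α X β Y) v ξ η ζ = α ^ 2 * X.curvature X v ξ η ζ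
      + α * β * (X.curvature Y v ξ η ζ + Y.curvature X v ξ η ζ)
      + β ^ 2 * Y.curvature Y v ξ η ζ := by
  simp only [curvature, curl, linComb, add_apply, smul_apply, map_add, map_smul, smul_eq_mul]
  ring

theorem cyclicCurl_linComb (α β : ℝ) (X Y : HydroJet N) (v ξ η ζ : Fin N → ℝ) :
    (linComb α X β Y).cyclicCurl (linComb α X β Y) v ξ η ζ = α ^ 2 * X.cyclicCurl X v ξ η ζ
      + α * β * (X.cyclicCurl Y v ξ η ζ + Y.cyclicCurl X v ξ η ζ)
      + β ^ 2 * Y.cyclicCurl Y v ξ η ζ := by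
  simp only [cyclicCurl, curl, linComb, add_apply, smul_apply, map_add, map_smul, smul_eq_mul]
  ring

theorem IsPoisson.compatible {X Y : HydroJet N} (hX : X.IsPoisson) (hY : Y.IsPoisson)
    (h : (linComb 1 X 1 Y).IsPoisson) : Compatible X Y where
  torsion ξ η ζ := by
    have := h.torsion ξ η ζ
    rw [torsion_linComb, hX.torsion, hY.torsion] at this
    linarith
  curvature v ξ η ζ := by
    have := h.curvature v ξ η ζ
    rw [curvature_linComb, hX.curvature, hY.curvature] at this
    linarith
  cyclicCurl v ξ η ζ := by
    have := h.cyclicCurl v ξ η ζ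
    rw [cyclicCurl_linComb, hX.cyclicCurl, hY.cyclicCurl] at this
    linarith

theorem Compatible.isPoisson_linComb {X Y : HydroJet N} (h : Compatible X Y) (hX : X.IsPoisson)
    (hY : Y.IsPoisson) (α β : ℝ) : (linComb α X β Y).IsPoisson where
  symm ξ η := by
    simp only [linComb, add_apply, smul_apply, map_add, map_smul, hX.symm ξ η, hY.symm ξ η]
  torsion ξ η ζ := by rw [torsion_linComb, hX.torsion, hY.torsion, h.torsion]; ring
  curvature v ξ η ζ := by
    rw [curvature_linComb, hX.curvature, hY.curvature, h.curvature]; ring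
  cyclicCurl v ξ η ζ := by
    rw [cyclicCurl_linComb, hX.cyclicCurl, hY.cyclicCurl, h.cyclicCurl]; ring

/-- The density of the variation along the vector `h` of the bracket of two functionals with fixed
variational derivatives, with 1-jets `(ξ, ξ')`, `(η, η')`, up to total derivatives; `x` and `y`
stand for the values of `(d/dx)⁻¹` of `u_x · ξ` and `u_x · η`. -/
noncomputable def variationDensity (X : HydroJet N) (v ξ ξ' : Fin N → ℝ) (x : ℝ)
    (η η' : Fin N → ℝ) (y : ℝ) (h : Fin N → ℝ) : ℝ :=
  ⟪η', X.B h ξ⟫ - ⟪ξ', X.B h η⟫ + X.curl h v ξ η - X.K * (⟪ξ', h⟫ * y - ⟪η', h⟫ * x)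

/-- The value of the operator of the bracket on a covector with the 1-jet `(ζ, ζ')`; `z` stands
for the value of `(d/dx)⁻¹` of `u_x · ζ`. -/
noncomputable def opAt (X : HydroJet N) (v ζ ζ' : Fin N → ℝ) (z : ℝ) : Fin N → ℝ :=
  X.G ζ' + X.B v ζ + (X.K * z) • v

/-- The density of the left-hand side of the Jacobi identity, up to total derivatives, for
functionals whose variational derivatives have the 1-jets `(ξ, ξ')`, `(η, η')`, `(ζ, ζ')`. -/
noncomputable def jacobiDensity (X : HydroJet N) (v ξ ξ' η η' ζ ζ' : Fin N → ℝ) : ℝ :=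
  X.torsion X ξ η' ζ' + X.torsion X η ζ' ξ' + X.torsion X ζ ξ' η'
    + X.curvature X v ξ η ζ' + X.curvature X v η ζ ξ' + X.curvature X v ζ ξ η'
    + X.cyclicCurl X v ξ η ζ

theorem sum_variationDensity {X : HydroJet N} (hX : X.IsSymm)
    (v ξ ξ' : Fin N → ℝ) (x : ℝ) (η η' : Fin N → ℝ) (y : ℝ) (ζ ζ' : Fin N → ℝ) (z : ℝ) :
    X.variationDensity v ξ ξ' x η η' y (X.opAt v ζ ζ' z)
      + X.variationDensity v η η' y ζ ζ' z (X.opAt v ξ ξ' x)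
      + X.variationDensity v ζ ζ' z ξ ξ' x (X.opAt v η η' y)
    = X.jacobiDensity v ξ ξ' η η' ζ ζ' := by
  simp only [jacobiDensity, variationDensity, opAt, torsion, curvature, cyclicCurl, curl, add_apply,
    smul_apply, map_add, map_smul, smul_eq_mul]
  rw [hX ξ' ζ', hX η' ζ', hX η' ξ']
  ring

theorem IsPoisson.jacobiDensity_eq_zero {X : HydroJet N} (hX : X.IsPoisson)
    (v ξ ξ' η η' ζ ζ' : Fin N → ℝ) : X.jacobiDensity v ξ ξ' η η' ζ ζ' = 0 := by
  simp only [jacobiDensity, hX.torsion, hX.curvature, hX.cyclicCurl, add_zero]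

theorem jacobiDensity_zero (X : HydroJet N) (ξ η η' ζ ζ' : Fin N → ℝ) :
    X.jacobiDensity 0 ξ 0 η η' ζ ζ' = X.torsion X ξ η' ζ' := by
  simp [jacobiDensity, torsion, curvature, cyclicCurl, curl]

theorem jacobiDensity_of_deriv_eq_zero (X : HydroJet N) (v ξ η ζ ζ' : Fin N → ℝ) :
    X.jacobiDensity v ξ 0 η 0 ζ ζ' = X.curvature X v ξ η ζ' + X.cyclicCurl X v ξ η ζ := by
  simp [jacobiDensity, torsion, curvature, curl]

theorem torsion_smul (X Y : HydroJet N) (a b : ℝ) (ξ η ζ : Fin N → ℝ) :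
    X.torsion Y ξ (a • η) (b • ζ) = a * b * X.torsion Y ξ η ζ := by
  simp only [torsion, map_smul, smul_apply, smul_eq_mul]
  ring

theorem curvature_smul (X Y : HydroJet N) (a b : ℝ) (v ξ η ζ : Fin N → ℝ) :
    X.curvature Y (a • v) ξ η (b • ζ) = a * b * X.curvature Y v ξ η ζ := by
  simp only [curvature, curl, map_smul, smul_apply, smul_eq_mul]
  ring

theorem cyclicCurl_smul (X Y : HydroJet N) (a : ℝ) (v ξ η ζ : Fin N → ℝ) :
    X.cyclicCurl Y (a • v) ξ η ζ = a ^ 2 * X.cyclicCurl Y v ξ η ζ := by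
  simp only [cyclicCurl, curl, map_smul, smul_apply, smul_eq_mul]
  ring

/-- The exterior derivative of the 1-form `⟪ξ, G (T ·) + B · η⟫ + K n ⟪ξ, ·⟫`, where `ξ` and
`η = dn` have the derivatives `S` and `T`. -/
noncomputable def involutionCurl (X : HydroJet N) (ξ : Fin N → ℝ)
    (S : (Fin N → ℝ) →L[ℝ] (Fin N → ℝ)) (η : Fin N → ℝ) (T : (Fin N → ℝ) →L[ℝ] (Fin N → ℝ))
    (w v : Fin N → ℝ) : ℝ :=
  (⟪S w, X.G (T v)⟫ + ⟪S w, X.B v η⟫ + ⟪T v, X.B w ξ⟫)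
    - (⟪S v, X.G (T w)⟫ + ⟪S v, X.B w η⟫ + ⟪T w, X.B v ξ⟫) + X.curl w v ξ η

section Nondegenerate

variable {X Y : HydroJet N} {H : (Fin N → ℝ) →L[ℝ] (Fin N → ℝ)}

/-- The derivatives `v ↦ -G⁻¹ (B v ξ)` of covectors that are parallel for the connection of a
nondegenerate bracket; `H` is the inverse of `G`. -/
noncomputable def parallel (Y : HydroJet N) (H : (Fin N → ℝ) →L[ℝ] (Fin N → ℝ)) :
    (Fin N → ℝ) →L[ℝ] (Fin N → ℝ) →L[ℝ] (Fin N → ℝ) :=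
  -((ContinuousLinearMap.compL ℝ (Fin N → ℝ) (Fin N → ℝ) (Fin N → ℝ) H).comp Y.B.flip)

theorem parallel_apply (ξ v : Fin N → ℝ) : Y.parallel H ξ v = -H (Y.B v ξ) := by
  simp [parallel]

theorem B_eq_neg_G_parallel (hGH : ∀ v, Y.G (H v) = v) (ξ v : Fin N → ℝ) :
    Y.B v ξ = -Y.G (Y.parallel H ξ v) := by
  simp [parallel_apply, hGH]

theorem coordPairing_inverse_comm (hGH : ∀ v, Y.G (H v) = v) (hY : Y.IsSymm)
    (v w : Fin N → ℝ) : ⟪H v, w⟫ = ⟪H w, v⟫ := by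
  simpa only [hGH] using hY (H w) (H v) |>.symm

theorem coordPairing_parallel_comm (hGH : ∀ v, Y.G (H v) = v) (hY : Y.IsPoisson)
    (ξ v w : Fin N → ℝ) : ⟪Y.parallel H ξ v, w⟫ = ⟪Y.parallel H ξ w, v⟫ := by
  have h := hY.torsion ξ (H v) (H w)
  simp only [HydroJet.torsion, hGH] at h
  simp only [parallel_apply, map_neg, neg_apply]
  rw [coordPairing_inverse_comm hGH hY.symm, coordPairing_inverse_comm hGH hY.symm (Y.B w ξ)]
  linarith

theorem coordPairing_G_parallel (hGH : ∀ v, Y.G (H v) = v) (hY : Y.IsPoisson)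
    (ξ p w : Fin N → ℝ) : ⟪p, Y.G (Y.parallel H ξ w)⟫ = ⟪Y.parallel H ξ (Y.G p), w⟫ := by
  rw [hY.symm, coordPairing_parallel_comm hGH hY]

theorem coordPairing_B (hGH : ∀ v, Y.G (H v) = v) (hY : Y.IsPoisson)
    (a b θ : Fin N → ℝ) : ⟪a, Y.B b θ⟫ = -⟪Y.parallel H θ (Y.G a), b⟫ := by
  rw [B_eq_neg_G_parallel hGH, map_neg, coordPairing_G_parallel hGH hY]

theorem curl_eq_parallel (hGH : ∀ v, Y.G (H v) = v) (hY : Y.IsPoisson)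
    (h v ξ η : Fin N → ℝ) :
    Y.curl h v ξ η = ⟪Y.parallel H ξ h, Y.G (Y.parallel H η v)⟫
      - ⟪Y.parallel H η h, Y.G (Y.parallel H ξ v)⟫ := by
  have hcurv := hY.curvature v ξ η (H h)
  simp only [HydroJet.curvature, hGH, coordPairing_B hGH hY] at hcurv
  simp only [coordPairing_G_parallel hGH hY]
  linarith

theorem torsion_add_torsion_eq (hGH : ∀ v, Y.G (H v) = v) (hHG : ∀ v, H (Y.G v) = v)
    (hY : Y.IsPoisson) (ξ p q : Fin N → ℝ) :
    X.torsion Y ξ p q + Y.torsion X ξ p q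
      = -X.involutionCurl ξ (Y.parallel H ξ) 0 H (Y.G p) (Y.G q) := by
  have hB := fun a b => coordPairing_B hGH hY a (X.G b) ξ
  simp only [HydroJet.torsion, involutionCurl, curl, hB, hHG, map_zero, zero_apply]
  ring

theorem curvature_add_curvature_eq (hGH : ∀ v, Y.G (H v) = v) (hY : Y.IsPoisson)
    (hX : X.IsSymm) (htor : ∀ ξ η ζ, X.torsion Y ξ η ζ + Y.torsion X ξ η ζ = 0)
    (v ξ η ζ : Fin N → ℝ) :
    X.curvature Y v ξ η ζ + Y.curvature X v ξ η ζ
      = X.involutionCurl ξ (Y.parallel H ξ) η (Y.parallel H η) (Y.G ζ) v := by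
  have hB := coordPairing_B hGH hY
  have torξ := htor ξ ζ (Y.parallel H η v)
  have torη := htor η ζ (Y.parallel H ξ v)
  simp only [HydroJet.torsion, hB] at torξ torη
  simp only [HydroJet.curvature, involutionCurl, curl_eq_parallel hGH hY (X.G ζ), hB]
  simp only [B_eq_neg_G_parallel hGH, map_neg, neg_apply]
  have commξ := coordPairing_parallel_comm hGH hY ξ (X.G ζ) (Y.G (Y.parallel H η v))
  have commη := coordPairing_parallel_comm hGH hY η (X.G ζ) (Y.G (Y.parallel H ξ v))
  have symm := hX (Y.parallel H ξ v) (Y.parallel H η (Y.G ζ))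
  linarith

theorem cyclicCurl_add_cyclicCurl_eq_zero (hGH : ∀ v, Y.G (H v) = v) (hY : Y.IsPoisson)
    (hX : X.IsSymm) (htor : ∀ ξ η ζ, X.torsion Y ξ η ζ + Y.torsion X ξ η ζ = 0)
    (hcurv : ∀ v ξ η ζ, X.curvature Y v ξ η ζ + Y.curvature X v ξ η ζ = 0)
    (v ξ η ζ : Fin N → ℝ) :
    X.cyclicCurl Y v ξ η ζ + Y.cyclicCurl X v ξ η ζ = 0 := by
  -- The claim is the cyclic sum of the curvature conditions at the parallel derivatives along `v`.
  have curv := fun ξ η ζ => hcurv v ξ η (Y.parallel H ζ v)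
  have tor := fun ξ η ζ => htor ξ (Y.parallel H ζ v) (Y.parallel H η v)
  have comm := fun θ a b => coordPairing_parallel_comm hGH hY θ (X.B v a) (Y.G (Y.parallel H b v))
  have symm := fun a b θ => hX (Y.parallel H θ (Y.G (Y.parallel H a v))) (Y.parallel H b v)
  have curl_neg : ∀ a ξ η, X.curl (-a) v ξ η = -X.curl a v ξ η := fun a ξ η => by
    simp only [curl, map_neg, neg_apply]; ring
  simp only [curvature_add_curvature_eq hGH hY hX htor, involutionCurl] at curv
  simp only [HydroJet.torsion, coordPairing_B hGH hY] at tor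
  simp only [HydroJet.cyclicCurl, curl_eq_parallel hGH hY, B_eq_neg_G_parallel hGH, curl_neg]
  linarith [curv ξ η ζ, curv η ζ ξ, curv ζ ξ η, tor ξ η ζ, tor η ζ ξ, tor ζ ξ η,
    comm ξ η ζ, comm ξ ζ η, comm η ξ ζ, comm η ζ ξ, comm ζ ξ η, comm ζ η ξ,
    symm ξ η ζ, symm η ζ ξ, symm ζ ξ η]

end Nondegenerate

end HydroJet

/-! ### The skew-symmetric inverse of `d/dx` -/

section InvD

open MeasureTheory

variable {f k : ℝ → ℝ}

theorem invD_eq_sub (hf : Integrable f) (x : ℝ) :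
    invD f x = (∫ y in Set.Iic x, f y) - (1 / 2) * ∫ y, f y := by
  rw [invD, ← intervalIntegral.integral_Iic_add_Ioi (b := x) hf.integrableOn hf.integrableOn]
  ring

theorem invD_add (hf : Integrable f) (hk : Integrable k) (x : ℝ) :
    invD (fun y => f y + k y) x = invD f x + invD k x := by
  simp only [invD, integral_add hf.restrict hk.restrict]
  ring

theorem invD_finsetSum {ι : Type*} (s : Finset ι) {f : ι → ℝ → ℝ}
    (hf : ∀ i ∈ s, Integrable (f i)) (x : ℝ) :
    invD (fun y => ∑ i ∈ s, f i y) x = ∑ i ∈ s, invD (f i) x := by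
  simp only [invD, integral_finsetSum s fun i hi => (hf i hi).restrict, ← Finset.sum_sub_distrib,
    Finset.mul_sum]

theorem hasDerivAt_invD (hf : Integrable f) (hc : Continuous f) (x : ℝ) :
    HasDerivAt (invD f) (f x) x := by
  have heq : invD f = fun x => (∫ y in (0 : ℝ)..x, f y) + invD f 0 := by
    funext x
    rw [invD_eq_sub hf, invD_eq_sub hf,
      ← intervalIntegral.integral_Iic_sub_Iic hf.integrableOn hf.integrableOn]
    ring
  rw [heq]
  exact (intervalIntegral.integral_hasDerivAt_right (hc.intervalIntegrable _ _)
    (hc.stronglyMeasurableAtFilter _ _) hc.continuousAt).add_const _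

theorem continuous_invD (hf : Integrable f) (hc : Continuous f) : Continuous (invD f) :=
  continuous_iff_continuousAt.2 fun x => (hasDerivAt_invD hf hc x).continuousAt

theorem contDiff_invD (hf : Integrable f) (hc : ContDiff ℝ ∞ f) : ContDiff ℝ ∞ (invD f) := by
  rw [contDiff_infty_iff_deriv]
  refine ⟨fun x => (hasDerivAt_invD hf hc.continuous x).differentiableAt, ?_⟩
  rwa [funext fun x => (hasDerivAt_invD hf hc.continuous x).deriv]

theorem tendsto_invD_atTop (hf : Integrable f) :
    Filter.Tendsto (invD f) Filter.atTop (𝓝 ((1 / 2) * ∫ y, f y)) := by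
  have h := (tendsto_setIntegral_of_monotone (μ := volume) (s := fun x : ℝ => Set.Iic x)
    (fun x => measurableSet_Iic) (fun _ _ h => Set.Iic_subset_Iic.2 h) hf.integrableOn).sub_const
      ((1 / 2) * ∫ y, f y)
  rw [Set.iUnion_Iic, setIntegral_univ] at h
  rw [funext (invD_eq_sub hf)]
  convert h using 2
  ring

theorem tendsto_invD_atBot (hf : Integrable f) :
    Filter.Tendsto (invD f) Filter.atBot (𝓝 (-((1 / 2) * ∫ y, f y))) := by
  have h := (intervalIntegral_tendsto_integral_Iic 0 hf.integrableOn Filter.tendsto_id).const_sub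
    (invD f 0)
  refine (h.congr fun x => ?_).trans_eq ?_
  · rw [id, ← intervalIntegral.integral_Iic_sub_Iic hf.integrableOn hf.integrableOn,
      invD_eq_sub hf, invD_eq_sub hf]
    ring
  · rw [invD_eq_sub hf]
    ring_nf

theorem integrable_mul_invD (hf : Integrable f) (hk : Integrable k) (hc : Continuous k) :
    Integrable fun x => f x * invD k x := by
  refine hf.mul_bdd (c := ∫ y, ‖k y‖) (continuous_invD hk hc).aestronglyMeasurable
    (Filter.Eventually.of_forall fun x => ?_)
  have hIic : ‖∫ y in Set.Iic x, k y‖ ≤ ∫ y, ‖k y‖ := (norm_integral_le_integral_norm _).trans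
    (setIntegral_le_integral hk.norm (Filter.Eventually.of_forall fun y => norm_nonneg _))
  have hIoi : ‖∫ y in Set.Ioi x, k y‖ ≤ ∫ y, ‖k y‖ := (norm_integral_le_integral_norm _).trans
    (setIntegral_le_integral hk.norm (Filter.Eventually.of_forall fun y => norm_nonneg _))
  rw [invD, norm_mul, Real.norm_of_nonneg (by norm_num : (0 : ℝ) ≤ 1 / 2)]
  linarith [norm_sub_le (∫ y in Set.Iic x, k y) (∫ y in Set.Ioi x, k y)]

theorem integral_mul_invD_add_eq_zero (hf : Integrable f) (hfc : Continuous f)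
    (hk : Integrable k) (hkc : Continuous k) : ∫ x, (f x * invD k x + k x * invD f x) = 0 := by
  have hderiv : ∀ x, HasDerivAt (fun x => invD f x * invD k x)
      (f x * invD k x + k x * invD f x) x := fun x =>
    ((hasDerivAt_invD hf hfc x).mul (hasDerivAt_invD hk hkc x)).congr_deriv (by ring)
  rw [integral_of_hasDerivAt_of_tendsto hderiv
    ((integrable_mul_invD hf hk hkc).add (integrable_mul_invD hk hf hfc))
    ((tendsto_invD_atBot hf).mul (tendsto_invD_atBot hk))
    ((tendsto_invD_atTop hf).mul (tendsto_invD_atTop hk))]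
  ring

end InvD

/-! ### One-parameter families of functions on the line -/

section Families

open MeasureTheory

variable {E : Type*} [NormedAddCommGroup E]

theorem hasCompactSupport_of_vanish {f : ℝ → E} {R : ℝ} (hR : ∀ x, R ≤ |x| → f x = 0) :
    HasCompactSupport f := by
  refine HasCompactSupport.intro (isCompact_Icc (a := -R) (b := R)) fun x hx => hR x ?_
  by_contra h
  exact hx (abs_le.1 (not_le.1 h).le)

theorem integrable_of_vanish {f : ℝ → E} {R : ℝ} (hf : Continuous f)
    (hR : ∀ x, R ≤ |x| → f x = 0) {μ : Measure ℝ} [IsFiniteMeasureOnCompacts μ] :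
    Integrable f μ :=
  hf.integrable_of_hasCompactSupport (hasCompactSupport_of_vanish hR)

variable [NormedSpace ℝ E]

theorem deriv_eq_zero_of_const {f : ℝ → E} {c : E} {R : ℝ} (h : ∀ x, R ≤ |x| → f x = c) (x : ℝ)
    (hx : R + 1 ≤ |x|) : deriv f x = 0 := by
  have : f =ᶠ[𝓝 x] fun _ => c := by
    filter_upwards [(isOpen_lt continuous_const continuous_abs).mem_nhds
      (show R < |x| by linarith)] with y hy using h y hy.le
  rw [this.deriv_eq, deriv_const]

variable {w : ℝ → ℝ → E}

theorem hasDerivAt_param_of_contDiff (hw : ContDiff ℝ ∞ fun q : ℝ × ℝ => w q.1 q.2) (s x : ℝ) :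
    HasDerivAt (fun s => w s x) (fderiv ℝ (fun q : ℝ × ℝ => w q.1 q.2) (s, x) (1, 0)) s :=
  (hw.differentiable (by simp) (s, x)).hasFDerivAt.comp_hasDerivAt (f := fun s => (s, x)) s
    ((hasDerivAt_id s).prodMk (hasDerivAt_const s x))

theorem hasDerivAt_section_of_contDiff (hw : ContDiff ℝ ∞ fun q : ℝ × ℝ => w q.1 q.2) (s x : ℝ) :
    HasDerivAt (w s) (fderiv ℝ (fun q : ℝ × ℝ => w q.1 q.2) (s, x) (0, 1)) x :=
  (hw.differentiable (by simp) (s, x)).hasFDerivAt.comp_hasDerivAt (f := fun x => (s, x)) x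
    ((hasDerivAt_const x s).prodMk (hasDerivAt_id x))

theorem contDiff_deriv_param (hw : ContDiff ℝ ∞ fun q : ℝ × ℝ => w q.1 q.2) :
    ContDiff ℝ ∞ fun q : ℝ × ℝ => deriv (fun s => w s q.2) q.1 := by
  simp only [fun q : ℝ × ℝ => (hasDerivAt_param_of_contDiff hw q.1 q.2).deriv]
  exact (hw.fderiv_right (m := ∞) (by simp)).clm_apply contDiff_const

theorem contDiff_deriv_section (hw : ContDiff ℝ ∞ fun q : ℝ × ℝ => w q.1 q.2) :
    ContDiff ℝ ∞ fun q : ℝ × ℝ => deriv (w q.1) q.2 := by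
  simp only [fun q : ℝ × ℝ => (hasDerivAt_section_of_contDiff hw q.1 q.2).deriv]
  exact (hw.fderiv_right (m := ∞) (by simp)).clm_apply contDiff_const

theorem contDiff_section (hw : ContDiff ℝ ∞ fun q : ℝ × ℝ => w q.1 q.2) (s : ℝ) :
    ContDiff ℝ ∞ (w s) :=
  hw.comp (contDiff_const.prodMk contDiff_id)

theorem hasDerivAt_param (hw : ContDiff ℝ ∞ fun q : ℝ × ℝ => w q.1 q.2) (s x : ℝ) :
    HasDerivAt (fun s => w s x) (deriv (fun s => w s x) s) s :=
  (hasDerivAt_param_of_contDiff hw s x).differentiableAt.hasDerivAt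

theorem hasDerivAt_param_deriv_section (hw : ContDiff ℝ ∞ fun q : ℝ × ℝ => w q.1 q.2) (s x : ℝ) :
    HasDerivAt (fun s => deriv (w s) x) (deriv (fun x => deriv (fun s => w s x) s) x) s := by
  set F : ℝ × ℝ → E := fun q => w q.1 q.2
  have hF' : ContDiff ℝ ∞ (fderiv ℝ F) := hw.fderiv_right (by simp)
  have hF'' := (hF'.differentiable (by simp) (s, x)).hasFDerivAt
  have hparam := ((ContinuousLinearMap.apply ℝ E ((0 : ℝ), (1 : ℝ))).hasFDerivAt.comp_hasDerivAt s
    (hasDerivAt_param_of_contDiff (w := fun s x => fderiv ℝ F (s, x)) hF' s x))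
  have hsection := ((ContinuousLinearMap.apply ℝ E ((1 : ℝ), (0 : ℝ))).hasFDerivAt.comp_hasDerivAt x
    (hasDerivAt_section_of_contDiff (w := fun s x => fderiv ℝ F (s, x)) hF' s x))
  simp only [fun s => (hasDerivAt_section_of_contDiff hw s x).deriv,
    fun x => (hasDerivAt_param_of_contDiff hw s x).deriv]
  refine hparam.congr_deriv (Eq.trans ?_ (HasDerivAt.deriv hsection).symm)
  exact second_derivative_symmetric (fun q => (hw.differentiable (by simp) q).hasFDerivAt) hF'' _ _

theorem hasDerivAt_integral_of_vanish {f : ℝ → ℝ → E} {R : ℝ}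
    (hf : ContDiff ℝ ∞ fun q : ℝ × ℝ => f q.1 q.2) (hR : ∀ s x, R ≤ |x| → f s x = 0)
    (μ : Measure ℝ) [IsFiniteMeasureOnCompacts μ] (s₀ : ℝ) :
    HasDerivAt (fun s => ∫ x, f s x ∂μ) (∫ x, deriv (fun s => f s x) s₀ ∂μ) s₀ := by
  set f' : ℝ → ℝ → E := fun s x => deriv (fun s => f s x) s
  have hf' : Continuous fun q : ℝ × ℝ => f' q.1 q.2 := (contDiff_deriv_param hf).continuous
  have hf'R : ∀ s x, R ≤ |x| → f' s x = 0 := fun s x hx => by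
    simp only [f', fun s => hR s x hx, deriv_const]
  obtain ⟨C, hC⟩ := ((isCompact_closedBall s₀ 1).prod
    (isCompact_Icc (a := -R) (b := R))).bddAbove_image hf'.norm.continuousOn
  refine (hasDerivAt_integral_of_dominated_loc_of_deriv_le (F' := f')
    (bound := (Set.Icc (-R) R).indicator fun _ => C)
    (Metric.closedBall_mem_nhds s₀ one_pos)
    (Filter.Eventually.of_forall fun s => (contDiff_section hf s).continuous.aestronglyMeasurable)
    (integrable_of_vanish (contDiff_section hf s₀).continuous (hR s₀))
    (hf'.comp (by fun_prop : Continuous fun x : ℝ => (s₀, x))).aestronglyMeasurable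
    (Filter.Eventually.of_forall fun x s hs => ?_) ?_
    (Filter.Eventually.of_forall fun x s _ => hasDerivAt_param hf s x)).2
  · by_cases hx : x ∈ Set.Icc (-R) R
    · rw [Set.indicator_of_mem hx]
      exact hC ⟨(s, x), ⟨hs, hx⟩, rfl⟩
    · rw [Set.indicator_of_notMem hx, hf'R s x (not_lt.1 fun h => hx (abs_le.1 h.le)), norm_zero]
  · exact (integrable_indicator_iff measurableSet_Icc).2
      (integrableOn_const isCompact_Icc.measure_lt_top.ne)

theorem hasDerivAt_param_invD {f : ℝ → ℝ → ℝ} {R : ℝ}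
    (hf : ContDiff ℝ ∞ fun q : ℝ × ℝ => f q.1 q.2) (hR : ∀ s x, R ≤ |x| → f s x = 0) (s x : ℝ) :
    HasDerivAt (fun s => invD (f s) x) (invD (fun y => deriv (fun s => f s y) s) x) s :=
  ((hasDerivAt_integral_of_vanish hf hR (volume.restrict (Set.Iic x)) s).sub
    (hasDerivAt_integral_of_vanish hf hR (volume.restrict (Set.Ioi x)) s)).const_mul (1 / 2)

open scoped Convolution in
theorem invD_eq_convolution {f : ℝ → ℝ} (hf : Integrable f) :
    invD f = (fun t : ℝ => if 0 ≤ t then (1 / 2 : ℝ) else -(1 / 2)) ⋆[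
      ContinuousLinearMap.lsmul ℝ ℝ] f := by
  set κ : ℝ → ℝ := fun t => if 0 ≤ t then 1 / 2 else -(1 / 2)
  funext x
  have hIic : Set.EqOn (fun y => κ (x - y) • f y) (fun y => 1 / 2 * f y) (Set.Iic x) :=
    fun y hy => by simp only [κ, if_pos (sub_nonneg.2 (Set.mem_Iic.1 hy)), smul_eq_mul]
  have hIoi : Set.EqOn (fun y => κ (x - y) • f y) (fun y => -(1 / 2) * f y) (Set.Ioi x) :=
    fun y hy => by simp only [κ, if_neg (not_le.2 (sub_neg.2 (Set.mem_Ioi.1 hy))), smul_eq_mul]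
  rw [MeasureTheory.convolution_lsmul_swap, ← intervalIntegral.integral_Iic_add_Ioi (b := x)
      ((hf.const_mul _).integrableOn.congr_fun hIic.symm measurableSet_Iic)
      ((hf.const_mul _).integrableOn.congr_fun hIoi.symm measurableSet_Ioi),
    setIntegral_congr_fun measurableSet_Iic hIic, setIntegral_congr_fun measurableSet_Ioi hIoi,
    integral_const_mul, integral_const_mul, invD]
  ring

open scoped Convolution in
theorem contDiff_param_invD {f : ℝ → ℝ → ℝ} {R : ℝ}
    (hf : ContDiff ℝ ∞ fun q : ℝ × ℝ => f q.1 q.2) (hR : ∀ s x, R ≤ |x| → f s x = 0) :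
    ContDiff ℝ ∞ fun q : ℝ × ℝ => invD (f q.1) q.2 := by
  have hint (s : ℝ) : Integrable (f s) :=
    integrable_of_vanish (contDiff_section hf s).continuous (hR s)
  have hkernel : LocallyIntegrable fun t : ℝ => if 0 ≤ t then (1 / 2 : ℝ) else -(1 / 2) :=
    (locallyIntegrable_const (1 / 2 : ℝ)).mono
      ((Measurable.ite measurableSet_Ici measurable_const measurable_const).aestronglyMeasurable)
      (Filter.Eventually.of_forall fun t => by split_ifs <;> simp)
  simp only [invD_eq_convolution (hint _)]
  have hconv := contDiffOn_convolution_right_with_param (n := ⊤) (ContinuousLinearMap.lsmul ℝ ℝ)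
    (g := f) (μ := volume) isOpen_univ (isCompact_Icc (a := -R) (b := R))
    (fun s x _ hx => hR s x (not_lt.1 fun h => hx (abs_le.1 h.le))) hkernel hf.contDiffOn
  rwa [Set.univ_prod_univ, contDiffOn_univ] at hconv

end Families

/-! ### The coefficients of a bracket as linear maps -/

namespace HydroBracket

variable {N : ℕ} (P : HydroBracket N) {U : Set (Fin N → ℝ)}

/-- The linear map `ξ ↦ g^{ij}(p) ξ_j`. -/
noncomputable def gL (p : Fin N → ℝ) : (Fin N → ℝ) →L[ℝ] (Fin N → ℝ) :=
  ∑ i, ∑ j, P.g p i j • (ContinuousLinearMap.proj (R := ℝ) (φ := fun _ : Fin N => ℝ) j).smulRight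
    (Pi.single i (1 : ℝ))

/-- The bilinear map `(v, ξ) ↦ b^{ij}_k(p) v^k ξ_j`. -/
noncomputable def bL (p : Fin N → ℝ) : (Fin N → ℝ) →L[ℝ] (Fin N → ℝ) →L[ℝ] (Fin N → ℝ) :=
  ∑ i, ∑ j, ∑ k, P.b p i j k •
    (ContinuousLinearMap.proj (R := ℝ) (φ := fun _ : Fin N => ℝ) k).smulRight
      ((ContinuousLinearMap.proj (R := ℝ) (φ := fun _ : Fin N => ℝ) j).smulRight
        (Pi.single i (1 : ℝ)))

/-- The coefficients of the bracket at the point `p`, with the derivative of `b`. -/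
noncomputable def jet (p : Fin N → ℝ) : HydroJet N := ⟨P.gL p, P.bL p, fderiv ℝ P.bL p, P.K⟩

theorem gL_apply (p ξ : Fin N → ℝ) (i : Fin N) : P.gL p ξ i = ∑ j, P.g p i j * ξ j := by
  simp only [gL, sum_apply, smul_apply, ContinuousLinearMap.smulRight_apply,
    ContinuousLinearMap.proj_apply, Finset.sum_apply, Pi.smul_apply, smul_eq_mul, Pi.single_apply]
  rw [Finset.sum_eq_single i] <;> simp +contextual [eq_comm]

theorem bL_apply (p v ξ : Fin N → ℝ) (i : Fin N) :
    P.bL p v ξ i = ∑ j, ∑ k, P.b p i j k * v k * ξ j := by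
  simp only [bL, sum_apply, smul_apply, ContinuousLinearMap.smulRight_apply,
    ContinuousLinearMap.proj_apply, Finset.sum_apply, Pi.smul_apply, smul_eq_mul, Pi.single_apply]
  rw [Finset.sum_eq_single i]
  · simp [mul_assoc]
  · simp +contextual [eq_comm]
  · simp

theorem gL_eq_mulVec (p ξ : Fin N → ℝ) : P.gL p ξ = (Matrix.of (P.g p)).mulVec ξ := by
  funext i
  rw [gL_apply]
  rfl

variable {P}

namespace SmoothOn

theorem mono {V : Set (Fin N → ℝ)} (hP : P.SmoothOn U) (h : V ⊆ U) : P.SmoothOn V :=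
  ⟨fun i j => (hP.1 i j).mono h, fun i j k => (hP.2 i j k).mono h⟩

theorem contDiffOn_gL (hP : P.SmoothOn U) : ContDiffOn ℝ ∞ P.gL U :=
  ContDiffOn.sum fun i _ => ContDiffOn.sum fun j _ => (hP.1 i j).smul contDiffOn_const

theorem contDiffOn_bL (hP : P.SmoothOn U) : ContDiffOn ℝ ∞ P.bL U :=
  ContDiffOn.sum fun i _ => ContDiffOn.sum fun j _ => ContDiffOn.sum fun k _ =>
    (hP.2 i j k).smul contDiffOn_const

theorem contDiffOn_fderiv_gL (hP : P.SmoothOn U) (hU : IsOpen U) :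
    ContDiffOn ℝ ∞ (fderiv ℝ P.gL) U :=
  hP.contDiffOn_gL.fderiv_of_isOpen hU (by simp)

theorem contDiffOn_fderiv_bL (hP : P.SmoothOn U) (hU : IsOpen U) :
    ContDiffOn ℝ ∞ (fderiv ℝ P.bL) U :=
  hP.contDiffOn_bL.fderiv_of_isOpen hU (by simp)

theorem hasFDerivAt_gL (hP : P.SmoothOn U) (hU : IsOpen U) {p : Fin N → ℝ} (hp : p ∈ U) :
    HasFDerivAt P.gL (fderiv ℝ P.gL p) p :=
  ((hP.contDiffOn_gL.contDiffAt (hU.mem_nhds hp)).differentiableAt (by simp)).hasFDerivAt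

theorem hasFDerivAt_bL (hP : P.SmoothOn U) (hU : IsOpen U) {p : Fin N → ℝ} (hp : p ∈ U) :
    HasFDerivAt P.bL (fderiv ℝ P.bL p) p :=
  ((hP.contDiffOn_bL.contDiffAt (hU.mem_nhds hp)).differentiableAt (by simp)).hasFDerivAt

end SmoothOn

end HydroBracket

/-! ### Fields -/

section Fields

variable {N : ℕ} {U : Set (Fin N → ℝ)} {u ξ η : ℝ → Fin N → ℝ}

namespace IsHydroField

theorem exists_radius (h : IsHydroField U u) :
    ∃ c R, 0 ≤ R ∧ ∀ x, R ≤ |x| → u x = c ∧ deriv u x = 0 := by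
  obtain ⟨c, R, hR⟩ := h.const_at_infinity
  refine ⟨c, |R| + 1, by positivity, fun x hx => ⟨hR x ?_, deriv_eq_zero_of_const hR x ?_⟩⟩ <;>
  linarith [le_abs_self R]

theorem of_vanish (hξ : ContDiff ℝ ∞ ξ) {R : ℝ} (hR : ∀ x, R ≤ |x| → ξ x = 0) :
    IsHydroField Set.univ ξ :=
  ⟨hξ, fun _ => Set.mem_univ _, 0, R, hR⟩

theorem const {c : Fin N → ℝ} (hc : c ∈ U) : IsHydroField U fun _ => c :=
  ⟨contDiff_const, fun _ => hc, c, 0, fun _ _ => rfl⟩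

theorem contDiff_deriv (h : IsHydroField U u) : ContDiff ℝ ∞ (deriv u) :=
  (contDiff_infty_iff_deriv.1 h.smooth).2

theorem integrable_coordPairing_deriv (h : IsHydroField U u) (hξ : Continuous ξ) :
    MeasureTheory.Integrable fun x => ⟪ξ x, deriv u x⟫ := by
  obtain ⟨c, R, -, hR⟩ := h.exists_radius
  have hu' := h.contDiff_deriv.continuous
  exact integrable_of_vanish (R := R) (by fun_prop) fun x hx => by rw [(hR x hx).2, map_zero]

end IsHydroField

theorem contDiff_coordPairing {E : Type*} [NormedAddCommGroup E] [NormedSpace ℝ E]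
    {f k : E → Fin N → ℝ} (hf : ContDiff ℝ ∞ f) (hk : ContDiff ℝ ∞ k) :
    ContDiff ℝ ∞ fun x => ⟪f x, k x⟫ :=
  (coordPairing.contDiff.comp hf).clm_apply hk

namespace HydroBracket

variable {P : HydroBracket N}

theorem op_eq (hu : IsHydroField U u) (hξ : Continuous ξ) (x : ℝ) :
    P.op u ξ x = (P.jet (u x)).opAt (deriv u x) (ξ x) (deriv ξ x)
      (invD (fun y => ⟪ξ y, deriv u y⟫) x) := by
  obtain ⟨c, R, -, hR⟩ := hu.exists_radius
  have hu' := hu.contDiff_deriv.continuous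
  have hinvD : ∑ j, invD (fun y => deriv u y j * ξ y j) x
      = invD (fun y => ⟪ξ y, deriv u y⟫) x := by
    rw [← invD_finsetSum _ fun j _ => integrable_of_vanish (R := R) (by fun_prop)
      fun y hy => by rw [(hR y hy).2, Pi.zero_apply, zero_mul]]
    simp only [coordPairing_apply, mul_comm]
  funext i
  simp only [op, HydroJet.opAt, jet, Pi.add_apply, Pi.smul_apply, smul_eq_mul, gL_apply, bL_apply,
    hinvD]
  ring

theorem pairing_eq_integral : P.pairing u ξ η = ∫ x, ⟪ξ x, P.op u η x⟫ := by
  simp only [pairing, coordPairing_apply]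

theorem op_eq_zero (hu : IsHydroField U u) (hξ : Continuous ξ) {x : ℝ} (hu' : deriv u x = 0)
    (hξ' : deriv ξ x = 0) : P.op u ξ x = 0 := by
  simp only [op_eq hu hξ, HydroJet.opAt, hu', hξ', map_zero, zero_apply, smul_zero, add_zero]

end HydroBracket

end Fields

/-! ### The derivative of a bracket along a family of fields -/

section FieldFamilies

variable {E : Type*} [NormedAddCommGroup E] [NormedSpace ℝ E]

/-- A smooth one-parameter family of functions on the line, each of them constant, with the same
value at both ends, outside the interval `(-R, R)`. -/
structure IsSmoothFamily (R : ℝ) (w : ℝ → ℝ → E) : Prop where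
  smooth : ContDiff ℝ ∞ fun q : ℝ × ℝ => w q.1 q.2
  const_at_infinity : ∀ s x, R ≤ |x| → w s x = w s R

/-- A smooth one-parameter family of fields with values in `U`, with a common value outside the
interval `(-R, R)`. -/
structure IsFieldFamily {N : ℕ} (U : Set (Fin N → ℝ)) (R : ℝ) (w : ℝ → ℝ → Fin N → ℝ) : Prop
    extends IsSmoothFamily R w where
  mem : ∀ s x, w s x ∈ U
  const_in_param : ∀ s, w s R = w 0 R

namespace IsSmoothFamily

variable {R : ℝ} {w : ℝ → ℝ → E}

theorem deriv_section_eq_zero (hw : IsSmoothFamily R w) (s : ℝ) {x : ℝ} (hx : R + 1 ≤ |x|) :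
    deriv (w s) x = 0 :=
  deriv_eq_zero_of_const (hw.const_at_infinity s) x hx

theorem deriv_param (hw : IsSmoothFamily R w) :
    IsSmoothFamily R fun s x => deriv (fun s => w s x) s where
  smooth := contDiff_deriv_param hw.smooth
  const_at_infinity s x hx := by simp only [fun s => hw.const_at_infinity s x hx]

theorem isHydroField {N : ℕ} {w : ℝ → ℝ → Fin N → ℝ} (hw : IsSmoothFamily R w) (s : ℝ) :
    IsHydroField Set.univ (w s) :=
  ⟨contDiff_section hw.smooth s, fun _ => Set.mem_univ _, w s R, R, hw.const_at_infinity s⟩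

end IsSmoothFamily

variable {N : ℕ} {U : Set (Fin N → ℝ)} {R : ℝ} {w ξ η : ℝ → ℝ → Fin N → ℝ}

namespace IsFieldFamily

theorem isHydroField (hw : IsFieldFamily U R w) (s : ℝ) : IsHydroField U (w s) :=
  ⟨contDiff_section hw.smooth s, hw.mem s, w s R, R, hw.const_at_infinity s⟩

theorem deriv_param_eq_zero (hw : IsFieldFamily U R w) (s : ℝ) {x : ℝ} (hx : R ≤ |x|) :
    deriv (fun s => w s x) s = 0 := by
  simp only [fun s => (hw.const_at_infinity s x hx).trans (hw.const_in_param s), deriv_const]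

theorem of_isHydroField {u : ℝ → Fin N → ℝ} (hu : IsHydroField U u) :
    ∃ R, IsFieldFamily U R fun _ => u := by
  obtain ⟨c, R, -, hconst⟩ := hu.exists_radius
  refine ⟨R, ⟨hu.smooth.comp contDiff_snd, fun _ x hx => ?_⟩, fun _ => hu.mem, fun _ => rfl⟩
  rw [(hconst x hx).1, (hconst R (le_abs_self R)).1]

theorem contDiff_coordPairing_deriv (hw : IsFieldFamily U R w)
    (hη : ContDiff ℝ ∞ fun q : ℝ × ℝ => η q.1 q.2) :
    ContDiff ℝ ∞ fun q : ℝ × ℝ => ⟪η q.1 q.2, deriv (w q.1) q.2⟫ :=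
  contDiff_coordPairing hη (contDiff_deriv_section hw.smooth)

theorem coordPairing_deriv_eq_zero (hw : IsFieldFamily U R w) (s x : ℝ) (hx : R + 1 ≤ |x|) :
    ⟪η s x, deriv (w s) x⟫ = 0 := by
  rw [hw.deriv_section_eq_zero s hx, map_zero]

end IsFieldFamily

namespace HydroBracket

variable {P : HydroBracket N}

theorem contDiff_family_op (hP : P.SmoothOn U) (hw : IsFieldFamily U R w)
    (hη : ContDiff ℝ ∞ fun q : ℝ × ℝ => η q.1 q.2) :
    ContDiff ℝ ∞ fun q : ℝ × ℝ => P.op (w q.1) (η q.1) q.2 := by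
  simp only [fun q : ℝ × ℝ =>
    op_eq (P := P) (hw.isHydroField q.1) (contDiff_section hη q.1).continuous q.2,
    HydroJet.opAt, jet]
  have hg : ContDiff ℝ ∞ fun q : ℝ × ℝ => P.gL (w q.1 q.2) :=
    hP.contDiffOn_gL.comp_contDiff hw.smooth fun q => hw.mem q.1 q.2
  have hb : ContDiff ℝ ∞ fun q : ℝ × ℝ => P.bL (w q.1 q.2) :=
    hP.contDiffOn_bL.comp_contDiff hw.smooth fun q => hw.mem q.1 q.2
  have hw' := contDiff_deriv_section hw.smooth
  have hinvD := contDiff_param_invD (hw.contDiff_coordPairing_deriv hη)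
    hw.coordPairing_deriv_eq_zero
  exact ((hg.clm_apply (contDiff_deriv_section hη)).add
    ((hb.clm_apply hw').clm_apply hη)).add ((contDiff_const.mul hinvD).smul hw')

theorem contDiff_op (hP : P.SmoothOn U) {u ξ : ℝ → Fin N → ℝ} (hu : IsHydroField U u)
    (hξ : ContDiff ℝ ∞ ξ) : ContDiff ℝ ∞ (P.op u ξ) := by
  obtain ⟨R, hR⟩ := IsFieldFamily.of_isHydroField hu
  exact contDiff_section (w := fun _ => P.op u ξ)
    (contDiff_family_op hP hR (η := fun _ => ξ) (hξ.comp contDiff_snd)) 0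

theorem op_vanish {u ξ : ℝ → Fin N → ℝ} (hu : IsHydroField U u) (hξ : IsHydroField Set.univ ξ) :
    ∃ R, ∀ x, R ≤ |x| → P.op u ξ x = 0 := by
  obtain ⟨c, R, -, hR⟩ := hu.exists_radius
  obtain ⟨c', R', -, hR'⟩ := hξ.exists_radius
  exact ⟨max R R', fun x hx => op_eq_zero hu hξ.smooth.continuous
    (hR x ((le_max_left _ _).trans hx)).2 (hR' x ((le_max_right _ _).trans hx)).2⟩

theorem integrable_pairing (hP : P.SmoothOn U) {u ξ η : ℝ → Fin N → ℝ} (hu : IsHydroField U u)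
    (hξ : Continuous ξ) (hη : IsHydroField Set.univ η) :
    MeasureTheory.Integrable fun x => ⟪ξ x, P.op u η x⟫ := by
  obtain ⟨R, hR⟩ := op_vanish (P := P) hu hη
  have hop := (contDiff_op hP hu hη.smooth).continuous
  exact integrable_of_vanish (R := R) (by fun_prop) fun x hx => by rw [hR x hx, map_zero]

/-- The derivative of the operator of the bracket at the field `u`, applied to the fixed covector
`η`, under the variation `h` of the field. -/
noncomputable def opDeriv (P : HydroBracket N) (u η h : ℝ → Fin N → ℝ) (x : ℝ) : Fin N → ℝ :=
  fderiv ℝ P.gL (u x) (h x) (deriv η x) + fderiv ℝ P.bL (u x) (h x) (deriv u x) (η x)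
    + P.bL (u x) (deriv h x) (η x)
    + P.K • (invD (fun y => ⟪η y, deriv u y⟫) x • deriv h x
      + invD (fun y => ⟪η y, deriv h y⟫) x • deriv u x)

theorem hasDerivAt_op (hU : IsOpen U) (hP : P.SmoothOn U) (hw : IsFieldFamily U R w)
    (hη : ContDiff ℝ ∞ fun q : ℝ × ℝ => η q.1 q.2) (s x : ℝ) :
    HasDerivAt (fun s => P.op (w s) (η s) x)
      (P.op (w s) (fun x => deriv (fun s => η s x) s) x
        + P.opDeriv (w s) (η s) (fun x => deriv (fun s => w s x) s) x) s := by
  set h : ℝ → Fin N → ℝ := fun x => deriv (fun s => w s x) s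
  set ηdot : ℝ → Fin N → ℝ := fun x => deriv (fun s => η s x) s
  have hηdot : Continuous ηdot := (contDiff_section
    (w := fun s x => deriv (fun s => η s x) s) (contDiff_deriv_param hη) s).continuous
  have hh' : Continuous (deriv h) := (hw.deriv_param.isHydroField s).contDiff_deriv.continuous
  have hηs : Continuous (η s) := (contDiff_section hη s).continuous
  have dw := hasDerivAt_param hw.smooth s
  have dw' := hasDerivAt_param_deriv_section hw.smooth s
  have dη := hasDerivAt_param hη s
  have dη' := hasDerivAt_param_deriv_section hη s
  have dg := (hP.hasFDerivAt_gL hU (hw.mem s x)).comp_hasDerivAt s (dw x)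
  have db := (hP.hasFDerivAt_bL hU (hw.mem s x)).comp_hasDerivAt s (dw x)
  have dpairing (y : ℝ) : HasDerivAt (fun s => ⟪η s y, deriv (w s) y⟫)
      (⟪ηdot y, deriv (w s) y⟫ + ⟪η s y, deriv h y⟫) s :=
    (coordPairing.hasFDerivAt.comp_hasDerivAt s (dη y)).clm_apply (dw' y)
  have dinvD := hasDerivAt_param_invD (hw.contDiff_coordPairing_deriv hη)
    hw.coordPairing_deriv_eq_zero s x
  have hint : MeasureTheory.Integrable fun y => ⟪η s y, deriv h y⟫ :=
    integrable_of_vanish (by fun_prop) fun y hy => by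
      rw [deriv_eq_zero_of_const (fun x hx => hw.deriv_param_eq_zero s hx) y hy, map_zero]
  rw [funext fun y => (dpairing y).deriv,
    invD_add ((hw.isHydroField s).integrable_coordPairing_deriv hηdot) hint] at dinvD
  simp only [fun s => op_eq (P := P) (hw.isHydroField s) (contDiff_section hη s).continuous x,
    op_eq (P := P) (hw.isHydroField s) hηdot]
  refine (((dg.clm_apply (dη' x)).add ((db.clm_apply (dw' x)).clm_apply (dη x))).add
    ((dinvD.const_mul P.K).smul (dw' x))).congr_deriv ?_
  simp only [HydroJet.opAt, jet, opDeriv, Function.comp_apply, add_apply, mul_add, add_smul,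
    smul_add, smul_smul]
  abel

end HydroBracket

end FieldFamilies

/-! ### The derivative of a pairing along a family of fields -/

section PairingDerivative

open MeasureTheory

variable {N : ℕ} {U : Set (Fin N → ℝ)}

theorem integral_deriv_eq_zero_of_const {F : ℝ → ℝ} (hF : ContDiff ℝ ∞ F) {c R : ℝ}
    (hR : ∀ x, R ≤ |x| → F x = c) : Integrable (deriv F) ∧ ∫ x, deriv F x = 0 := by
  have hint : Integrable (deriv F) :=
    integrable_of_vanish (contDiff_infty_iff_deriv.1 hF).2.continuous (deriv_eq_zero_of_const hR)
  exact ⟨hint, integral_eq_zero_of_hasDerivAt_of_integrable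
    (fun x => ((hF.differentiable (by simp) x).hasDerivAt.sub_const c)) hint
    (integrable_of_vanish (hF.continuous.sub continuous_const) fun x hx => sub_eq_zero.2 (hR x hx))⟩

namespace HydroBracket

variable {P : HydroBracket N}

/-- The condition `∂_k g^{ij} = b^{ij}_k + b^{ji}_k`. -/
def IsMetric (P : HydroBracket N) (U : Set (Fin N → ℝ)) : Prop :=
  ∀ p ∈ U, ∀ h ξ η, ⟪ξ, fderiv ℝ P.gL p h η⟫ = ⟪ξ, P.bL p h η⟫ + ⟪η, P.bL p h ξ⟫

theorem IsMetric.mono {U V : Set (Fin N → ℝ)} (hP : P.IsMetric U) (hVU : V ⊆ U) : P.IsMetric V :=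
  fun p hp => hP p (hVU hp)

/-- The variation of the bracket of two functionals, with variational derivatives fixed to be
`ξ` and `η`, under the variation `h` of the field. -/
noncomputable def fieldVariation (P : HydroBracket N) (u ξ η h : ℝ → Fin N → ℝ) : ℝ :=
  ∫ x, (P.jet (u x)).variationDensity (deriv u x)
    (ξ x) (deriv ξ x) (invD (fun y => ⟪ξ y, deriv u y⟫) x)
    (η x) (deriv η x) (invD (fun y => ⟪η y, deriv u y⟫) x) (h x)

/-- The expression whose derivative is the local part of the difference between the variation of
the density of a bracket and `HydroJet.variationDensity`. -/
noncomputable def boundaryTerm (P : HydroBracket N) (u ξ η h : ℝ → Fin N → ℝ) (x : ℝ) : ℝ :=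
  ⟪ξ x, P.bL (u x) (h x) (η x)⟫
    + P.K * (⟪ξ x, h x⟫ * invD (fun y => ⟪η y, deriv u y⟫) x
      - ⟪η x, h x⟫ * invD (fun y => ⟪ξ y, deriv u y⟫) x)

variable {u ξ η h : ℝ → Fin N → ℝ}

theorem contDiff_invD_coordPairing_deriv (hu : IsHydroField U u) (hξ : ContDiff ℝ ∞ ξ) :
    ContDiff ℝ ∞ (invD fun y => ⟪ξ y, deriv u y⟫) :=
  contDiff_invD (hu.integrable_coordPairing_deriv hξ.continuous)
    (contDiff_coordPairing hξ hu.contDiff_deriv)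

theorem contDiff_boundaryTerm (hP : P.SmoothOn U) (hu : IsHydroField U u) (hξ : ContDiff ℝ ∞ ξ)
    (hη : ContDiff ℝ ∞ η) (hh : ContDiff ℝ ∞ h) : ContDiff ℝ ∞ (P.boundaryTerm u ξ η h) := by
  have hb := hP.contDiffOn_bL.comp_contDiff hu.smooth hu.mem
  exact (contDiff_coordPairing hξ ((hb.clm_apply hh).clm_apply hη)).add (contDiff_const.mul
    (((contDiff_coordPairing hξ hh).mul (contDiff_invD_coordPairing_deriv hu hη)).sub
      ((contDiff_coordPairing hη hh).mul (contDiff_invD_coordPairing_deriv hu hξ))))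

theorem hasDerivAt_boundaryTerm (hU : IsOpen U) (hP : P.SmoothOn U) (hu : IsHydroField U u)
    (hξ : ContDiff ℝ ∞ ξ) (hη : ContDiff ℝ ∞ η) (hh : ContDiff ℝ ∞ h) (x : ℝ) :
    HasDerivAt (P.boundaryTerm u ξ η h)
      (⟪deriv ξ x, P.bL (u x) (h x) (η x)⟫
        + ⟪ξ x, fderiv ℝ P.bL (u x) (deriv u x) (h x) (η x)⟫
        + ⟪ξ x, P.bL (u x) (deriv h x) (η x)⟫ + ⟪ξ x, P.bL (u x) (h x) (deriv η x)⟫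
        + P.K * ((⟪deriv ξ x, h x⟫ + ⟪ξ x, deriv h x⟫) * invD (fun y => ⟪η y, deriv u y⟫) x
          + ⟪ξ x, h x⟫ * ⟪η x, deriv u x⟫
          - (⟪deriv η x, h x⟫ + ⟪η x, deriv h x⟫) * invD (fun y => ⟪ξ y, deriv u y⟫) x
          - ⟪η x, h x⟫ * ⟪ξ x, deriv u x⟫)) x := by
  have du := (hu.smooth.differentiable (by simp) x).hasDerivAt
  have dh := (hh.differentiable (by simp) x).hasDerivAt
  have dξ := (hξ.differentiable (by simp) x).hasDerivAt
  have dη := (hη.differentiable (by simp) x).hasDerivAt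
  have db := (hP.hasFDerivAt_bL hU (hu.mem x)).comp_hasDerivAt x du
  have dinvD {ζ : ℝ → Fin N → ℝ} (hζ : ContDiff ℝ ∞ ζ) :=
    hasDerivAt_invD (hu.integrable_coordPairing_deriv hζ.continuous)
      (contDiff_coordPairing hζ hu.contDiff_deriv).continuous x
  have dpair {ζ : ℝ → Fin N → ℝ} {a : Fin N → ℝ} (hζ : HasDerivAt ζ a x) :=
    coordPairing.hasFDerivAt.comp_hasDerivAt x hζ
  refine (((dpair dξ).clm_apply ((db.clm_apply dh).clm_apply dη)).add
    (((((dpair dξ).clm_apply dh).mul (dinvD hη)).sub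
      (((dpair dη).clm_apply dh).mul (dinvD hξ))).const_mul P.K)).congr_deriv ?_
  simp only [Function.comp_apply, add_apply, map_add]
  ring

/-- Integration by parts: this expresses the variation of the density through the variation `h`
of the field only, without its derivative, up to terms of integral zero. -/
theorem coordPairing_opDeriv_eq (hU : IsOpen U) (hP : P.SmoothOn U) (hPm : P.IsMetric U)
    (hu : IsHydroField U u) (hξ : ContDiff ℝ ∞ ξ) (hη : ContDiff ℝ ∞ η) (hh : ContDiff ℝ ∞ h)
    (x : ℝ) :
    ⟪ξ x, P.opDeriv u η h x⟫
      = (P.jet (u x)).variationDensity (deriv u x)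
          (ξ x) (deriv ξ x) (invD (fun y => ⟪ξ y, deriv u y⟫) x)
          (η x) (deriv η x) (invD (fun y => ⟪η y, deriv u y⟫) x) (h x)
        + deriv (P.boundaryTerm u ξ η h) x
        + P.K * (⟪ξ x, deriv u x⟫ * invD (fun y => ⟪η y, deriv h y⟫) x
          + ⟪η x, deriv h x⟫ * invD (fun y => ⟪ξ y, deriv u y⟫) x) := by
  rw [(hasDerivAt_boundaryTerm hU hP hu hξ hη hh x).deriv]
  simp only [opDeriv, map_add, map_smul, smul_eq_mul, hPm (u x) (hu.mem x),
    HydroJet.variationDensity, HydroJet.curl, jet]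
  ring

theorem integrable_variationDensity (hU : IsOpen U) (hP : P.SmoothOn U) (hu : IsHydroField U u)
    (hξ : ContDiff ℝ ∞ ξ) (hη : ContDiff ℝ ∞ η) (hh : Continuous h) {R : ℝ}
    (hhR : ∀ x, R ≤ |x| → h x = 0) :
    Integrable fun x => (P.jet (u x)).variationDensity (deriv u x)
      (ξ x) (deriv ξ x) (invD (fun y => ⟪ξ y, deriv u y⟫) x)
      (η x) (deriv η x) (invD (fun y => ⟪η y, deriv u y⟫) x) (h x) := by
  have := hu.smooth.continuous
  have := hu.contDiff_deriv.continuous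
  have := hξ.continuous
  have := hη.continuous
  have := (contDiff_infty_iff_deriv.1 hξ).2.continuous
  have := (contDiff_infty_iff_deriv.1 hη).2.continuous
  have := (hP.contDiffOn_bL.comp_contDiff hu.smooth hu.mem).continuous
  have := ((hP.contDiffOn_fderiv_bL hU).comp_contDiff hu.smooth hu.mem).continuous
  have := (contDiff_invD_coordPairing_deriv hu hξ).continuous
  have := (contDiff_invD_coordPairing_deriv hu hη).continuous
  simp only [HydroJet.variationDensity, HydroJet.curl, jet]
  exact integrable_of_vanish (R := R) (by fun_prop) fun x hx => by simp [hhR x hx]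

theorem integral_coordPairing_opDeriv (hU : IsOpen U) (hP : P.SmoothOn U) (hPm : P.IsMetric U)
    (hu : IsHydroField U u) (hξ : ContDiff ℝ ∞ ξ) (hη : ContDiff ℝ ∞ η) (hh : ContDiff ℝ ∞ h)
    {R : ℝ} (hhR : ∀ x, R ≤ |x| → h x = 0) :
    Integrable (fun x => ⟪ξ x, P.opDeriv u η h x⟫) ∧
      ∫ x, ⟪ξ x, P.opDeriv u η h x⟫ = P.fieldVariation u ξ η h := by
  have hvar := integrable_variationDensity hU hP hu hξ hη hh.continuous hhR
  obtain ⟨hbdry, hbdry_zero⟩ := integral_deriv_eq_zero_of_const (c := 0)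
    (contDiff_boundaryTerm hP hu hξ hη hh) (R := R) fun x hx => by simp [boundaryTerm, hhR x hx]
  have hf := hu.integrable_coordPairing_deriv hξ.continuous
  have hfc := (contDiff_coordPairing hξ hu.contDiff_deriv).continuous
  have hk := (IsHydroField.of_vanish hh hhR).integrable_coordPairing_deriv hη.continuous
  have hkc := (contDiff_coordPairing hη (contDiff_infty_iff_deriv.1 hh).2).continuous
  have hskew := ((integrable_mul_invD hf hk hkc).fun_add (integrable_mul_invD hk hf hfc)).const_mul
    P.K
  simp only [coordPairing_opDeriv_eq hU hP hPm hu hξ hη hh]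
  refine ⟨(hvar.fun_add hbdry).fun_add hskew, ?_⟩
  rw [integral_add (hvar.fun_add hbdry) hskew, integral_add hvar hbdry, hbdry_zero,
    integral_const_mul, integral_mul_invD_add_eq_zero hf hfc hk hkc, fieldVariation]
  ring

theorem hasDerivAt_pairing (hU : IsOpen U) (hP : P.SmoothOn U) (hPm : P.IsMetric U)
    {w ξ η : ℝ → ℝ → Fin N → ℝ} {R : ℝ} (hw : IsFieldFamily U R w)
    (hξ : ContDiff ℝ ∞ fun q : ℝ × ℝ => ξ q.1 q.2) (hη : IsSmoothFamily R η) (s : ℝ) :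
    HasDerivAt (fun s => P.pairing (w s) (ξ s) (η s))
      (P.pairing (w s) (fun x => deriv (fun s => ξ s x) s) (η s)
        + P.pairing (w s) (ξ s) (fun x => deriv (fun s => η s x) s)
        + P.fieldVariation (w s) (ξ s) (η s) (fun x => deriv (fun s => w s x) s)) s := by
  have hop_zero (s x : ℝ) (hx : R + 1 ≤ |x|) : P.op (w s) (η s) x = 0 :=
    op_eq_zero (hw.isHydroField s) (hη.isHydroField s).smooth.continuous
      (hw.deriv_section_eq_zero s hx) (hη.deriv_section_eq_zero s hx)
  have hderiv := hasDerivAt_integral_of_vanish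
    (f := fun s x => ⟪ξ s x, P.op (w s) (η s) x⟫)
    (contDiff_coordPairing hξ (contDiff_family_op hP hw hη.smooth))
    (fun s x hx => by rw [hop_zero s x hx, map_zero]) volume s
  have hξs := contDiff_section hξ s
  have hξdot : ContDiff ℝ ∞ fun x => deriv (fun s => ξ s x) s := contDiff_section
    (w := fun s x => deriv (fun s => ξ s x) s) (contDiff_deriv_param hξ) s
  have hint₁ := integrable_pairing hP (hw.isHydroField s) hξdot.continuous (hη.isHydroField s)
  have hint₂ := integrable_pairing hP (hw.isHydroField s) hξs.continuous
    (hη.deriv_param.isHydroField s)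
  obtain ⟨hint₃, hvar⟩ := integral_coordPairing_opDeriv hU hP hPm (hw.isHydroField s) hξs
    (hη.isHydroField s).smooth (hw.deriv_param.isHydroField s).smooth
    (fun x hx => hw.deriv_param_eq_zero s hx)
  simp only [pairing_eq_integral]
  rw [← hvar, ← integral_add hint₁ hint₂, ← integral_add (hint₁.fun_add hint₂) hint₃]
  refine hderiv.congr_deriv (congrArg (integral volume) (funext fun x => ?_))
  have dprod := (coordPairing.hasFDerivAt.comp_hasDerivAt s (hasDerivAt_param hξ s x)).clm_apply
    (hasDerivAt_op hU hP hw hη.smooth s x)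
  exact dprod.deriv.trans (by simp only [Function.comp_apply, map_add]; ring)

end HydroBracket

end PairingDerivative

section Functionals

/-- A smooth reparametrization of the line agreeing to first order with the identity at `0`. Lines
of fields `u + s • h` leave `U`; bounded reparametrizations `u + τ s • h` do not, and have the same
derivatives at `s = 0`. -/
structure IsTangentToId (τ : ℝ → ℝ) : Prop where
  contDiff : ContDiff ℝ ∞ τ
  map_zero : τ 0 = 0
  hasDerivAt_zero : HasDerivAt τ 1 0

namespace IsTangentToId

variable {τ σ : ℝ → ℝ}

theorem comp (hτ : IsTangentToId τ) (hσ : IsTangentToId σ) : IsTangentToId (τ ∘ σ) where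
  contDiff := hτ.contDiff.comp hσ.contDiff
  map_zero := by rw [Function.comp_apply, hσ.map_zero, hτ.map_zero]
  hasDerivAt_zero := by
    simpa only [one_mul] using hτ.hasDerivAt_zero.comp_of_eq 0 hσ.hasDerivAt_zero hσ.map_zero.symm

theorem hasDerivAt_of_comp {E : Type*} [NormedAddCommGroup E] [NormedSpace ℝ E] {F : ℝ → E}
    {a : E} (hτ : IsTangentToId τ) (h : HasDerivAt (fun s => F (τ s)) a 0) :
    HasDerivAt F a 0 := by
  have hstrict : HasStrictDerivAt τ 1 0 :=
    hτ.contDiff.contDiffAt.hasStrictDerivAt' hτ.hasDerivAt_zero (by simp)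
  set κ := hstrict.localInverse τ 1 0 one_ne_zero
  have hκ_zero : κ 0 = 0 := by
    simpa only [hτ.map_zero] using (hstrict.eventually_left_inverse one_ne_zero).self_of_nhds
  have hκ : HasDerivAt κ 1 0 := by
    simpa only [hτ.map_zero, inv_one] using (hstrict.to_localInverse one_ne_zero).hasDerivAt
  have hright : ∀ᶠ ε in 𝓝 (0 : ℝ), τ (κ ε) = ε := by
    simpa only [hτ.map_zero] using hstrict.eventually_right_inverse one_ne_zero
  have hcomp := h.scomp_of_eq (0 : ℝ) hκ hκ_zero.symm
  rw [one_smul] at hcomp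
  refine hcomp.congr_of_eventuallyEq ?_
  filter_upwards [hright] with ε hε
  rw [Function.comp_apply, hε]

end IsTangentToId

/-- The reparametrization `δ sin (s / δ)`, with values in `[-δ, δ]`. -/
noncomputable def sinScale (δ s : ℝ) : ℝ := δ * Real.sin (s / δ)

theorem abs_sinScale_le {δ : ℝ} (hδ : 0 < δ) (s : ℝ) : |sinScale δ s| ≤ δ := by
  rw [sinScale, abs_mul, abs_of_pos hδ]
  exact mul_le_of_le_one_right hδ.le (Real.abs_sin_le_one _)

theorem isTangentToId_sinScale {δ : ℝ} (hδ : 0 < δ) : IsTangentToId (sinScale δ) where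
  contDiff := contDiff_const.mul (Real.contDiff_sin.comp (contDiff_id.div_const δ))
  map_zero := by rw [sinScale, zero_div, Real.sin_zero, mul_zero]
  hasDerivAt_zero := by
    have := ((Real.hasDerivAt_sin (0 / δ)).comp 0 ((hasDerivAt_id (0 : ℝ)).div_const δ)).const_mul δ
    exact this.congr_deriv (by simp [hδ.ne'])

variable {N : ℕ} {U : Set (Fin N → ℝ)} {u h : ℝ → Fin N → ℝ}

theorem IsHydroField.eventually_add_sum_smul_mem (hU : IsOpen U) (hu : IsHydroField U u) {k : ℕ}
    {h : Fin k → ℝ → Fin N → ℝ} (hh : ∀ i, Continuous (h i)) {R : ℝ}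
    (hR : ∀ i x, R ≤ |x| → h i x = 0) :
    ∀ᶠ s in 𝓝 (0 : Fin k → ℝ), ∀ x, (u + ∑ i, s i • h i) x ∈ U := by
  have hcont : Continuous fun q : (Fin k → ℝ) × ℝ => (u + ∑ i, q.1 i • h i) q.2 := by
    have := hu.smooth.continuous
    simp only [Pi.add_apply, Finset.sum_apply, Pi.smul_apply]
    fun_prop
  have hcompact : ∀ᶠ s in 𝓝 (0 : Fin k → ℝ), ∀ x ∈ Set.Icc (-R) R,
      (u + ∑ i, s i • h i) x ∈ U :=
    isCompact_Icc.eventually_forall_of_forall_eventually fun x _ =>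
      hcont.continuousAt.eventually_mem (hU.mem_nhds (by simpa using hu.mem x))
  filter_upwards [hcompact] with s hs x
  rcases le_total |x| R with hx | hx
  · exact hs x (abs_le.1 hx)
  · simpa [fun i => hR i x hx] using hu.mem x

theorem IsHydroField.exists_isHydroFieldFamily (hU : IsOpen U) (hu : IsHydroField U u) {k : ℕ}
    {h : Fin k → ℝ → Fin N → ℝ} (hh : ∀ i, ContDiff ℝ ∞ (h i)) {R : ℝ}
    (hR : ∀ i x, R ≤ |x| → h i x = 0) :
    ∃ δ > 0, IsHydroFieldFamily U Set.univ fun s : Fin k → ℝ =>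
      u + ∑ i, sinScale δ (s i) • h i := by
  obtain ⟨ρ, hρ, hball⟩ := Metric.eventually_nhds_iff.1
    (hu.eventually_add_sum_smul_mem hU (fun i => (hh i).continuous) hR)
  have hδ : 0 < ρ / 2 := half_pos hρ
  refine ⟨ρ / 2, hδ, ContDiff.contDiffOn ?_,
    fun s _ => hball (y := fun i => sinScale _ (s i)) ?_, ?_⟩
  · simp only [Pi.add_apply, Finset.sum_apply, Pi.smul_apply]
    exact (hu.smooth.comp contDiff_snd).add (ContDiff.sum fun i _ =>
      ((isTangentToId_sinScale hδ).contDiff.comp ((contDiff_apply ℝ ℝ i).comp contDiff_fst)).smul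
        ((hh i).comp contDiff_snd))
  · refine ((dist_pi_le_iff hδ.le).2 fun i => ?_).trans_lt (half_lt_self hρ)
    simpa [Real.dist_eq] using abs_sinScale_le hδ (s i)
  · obtain ⟨c, r, hr⟩ := hu.const_at_infinity
    refine ⟨c, max r R, fun s _ x hx => ?_⟩
    simp [hr x ((le_max_left _ _).trans hx), fun i => hR i x ((le_max_right _ _).trans hx)]

theorem IsHydroField.exists_isFieldFamily (hU : IsOpen U) (hu : IsHydroField U u)
    (hh : ContDiff ℝ ∞ h) {R : ℝ} (hR : ∀ x, R ≤ |x| → h x = 0) :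
    ∃ τ R', IsTangentToId τ ∧ IsFieldFamily U R' fun s => u + τ s • h := by
  obtain ⟨δ, hδ, hfam⟩ := hu.exists_isHydroFieldFamily hU (k := 1) (fun _ => hh) (fun _ => hR)
  simp only [Finset.univ_unique, Fin.default_eq_zero, Finset.sum_singleton] at hfam
  obtain ⟨c, R', hc⟩ := hfam.const_at_infinity
  have hconst (s : ℝ) := hc (fun _ => s) (Set.mem_univ _)
  have hsmooth := contDiffOn_univ.1 (Set.univ_prod_univ ▸ hfam.smooth)
  refine ⟨sinScale δ, R', isTangentToId_sinScale hδ, ⟨?_, fun s x hx => ?_⟩,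
    fun s => hfam.mem (fun _ => s) (Set.mem_univ _), fun s => ?_⟩
  · exact hsmooth.comp (f := fun q : ℝ × ℝ => ((fun _ : Fin 1 => q.1), q.2))
      ((contDiff_pi.2 fun _ => contDiff_fst).prodMk contDiff_snd)
  · rw [hconst s x hx, hconst s R' (le_abs_self R')]
  · rw [hconst s R' (le_abs_self R'), hconst 0 R' (le_abs_self R')]

namespace IsFieldFamily

variable {R : ℝ} {w : ℝ → ℝ → Fin N → ℝ}

theorem comp (hw : IsFieldFamily U R w) {τ : ℝ → ℝ} (hτ : ContDiff ℝ ∞ τ) {R' : ℝ} (hR : R ≤ R') :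
    IsFieldFamily U R' fun s => w (τ s) := by
  have hconst (s x : ℝ) (hx : R' ≤ |x|) : w s x = w 0 R :=
    (hw.const_at_infinity s x (hR.trans hx)).trans (hw.const_in_param s)
  refine ⟨⟨hw.smooth.comp ((hτ.comp contDiff_fst).prodMk contDiff_snd), fun s x hx => ?_⟩,
    fun s => hw.mem (τ s), fun s => ?_⟩
  · rw [hconst _ x hx, hconst _ R' (le_abs_self R')]
  · rw [hconst _ R' (le_abs_self R'), hconst _ R' (le_abs_self R')]

theorem isHydroFieldFamily (hw : IsFieldFamily U R w) :
    IsHydroFieldFamily U Set.univ fun s : Fin 1 → ℝ => w (s 0) where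
  smooth := (hw.smooth.comp
    (((contDiff_apply ℝ ℝ 0).comp contDiff_fst).prodMk contDiff_snd)).contDiffOn
  mem s _ := hw.mem (s 0)
  const_at_infinity := ⟨w 0 R, R, fun s _ x hx =>
    (hw.const_at_infinity (s 0) x hx).trans (hw.const_in_param (s 0))⟩

theorem contDiff_varDeriv (I : SmoothFunctional U) (hw : IsFieldFamily U R w) :
    ContDiff ℝ ∞ fun q : ℝ × ℝ => I.varDeriv (w q.1) q.2 := by
  have hsmooth := I.smooth 1 Set.univ _ isOpen_univ hw.isHydroFieldFamily
  rw [Set.univ_prod_univ, contDiffOn_univ] at hsmooth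
  exact hsmooth.comp
    (f := fun q : ℝ × ℝ => ((fun _ : Fin 1 => q.1), q.2))
    ((contDiff_pi.2 fun _ => contDiff_fst).prodMk contDiff_snd)

theorem eventually_varDeriv_const (I : SmoothFunctional U) (hw : IsFieldFamily U R w) :
    ∃ R', ∀ᶠ s in 𝓝 (0 : ℝ), ∃ c, ∀ x, R' ≤ |x| → I.varDeriv (w s) x = c := by
  obtain ⟨R', hR'⟩ := I.const_at_infinity 1 Set.univ _ isOpen_univ hw.isHydroFieldFamily 0
    (Set.mem_univ _)
  have hdiag : Continuous fun (s : ℝ) (_ : Fin 1) => s := by fun_prop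
  exact ⟨R', (hdiag.tendsto 0).eventually hR'⟩

theorem isSmoothFamily_varDeriv_comp (I : SmoothFunctional U) (hw : IsFieldFamily U R w)
    {τ : ℝ → ℝ} (hτ : ContDiff ℝ ∞ τ) {R' R'' : ℝ}
    (hconst : ∀ s, ∃ c, ∀ x, R' ≤ |x| → I.varDeriv (w (τ s)) x = c) (hR : R' ≤ R'') :
    IsSmoothFamily R'' fun s => I.varDeriv (w (τ s)) where
  smooth := (hw.contDiff_varDeriv I).comp ((hτ.comp contDiff_fst).prodMk contDiff_snd)
  const_at_infinity s x hx := by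
    obtain ⟨c, hc⟩ := hconst s
    rw [hc x (hR.trans hx), hc R'' (hR.trans (le_abs_self R''))]

end IsFieldFamily

namespace SmoothFunctional

variable (I J : SmoothFunctional U)

theorem isHydroField_varDeriv (hu : IsHydroField U u) : IsHydroField Set.univ (I.varDeriv u) := by
  obtain ⟨R, hfam⟩ := IsFieldFamily.of_isHydroField hu
  obtain ⟨R', hev⟩ := hfam.eventually_varDeriv_const I
  obtain ⟨c, hc⟩ := hev.self_of_nhds
  exact ⟨contDiff_section (w := fun _ => I.varDeriv u) (hfam.contDiff_varDeriv I) 0,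
    fun _ => Set.mem_univ _, c, R', hc⟩

theorem exists_line (hU : IsOpen U) (hu : IsHydroField U u) (hh : ContDiff ℝ ∞ h) {R₀ : ℝ}
    (hR₀ : ∀ x, R₀ ≤ |x| → h x = 0) :
    ∃ τ R, IsTangentToId τ ∧ IsFieldFamily U R (fun s => u + τ s • h) ∧
      IsSmoothFamily R (fun s => I.varDeriv (u + τ s • h)) ∧
      IsSmoothFamily R (fun s => J.varDeriv (u + τ s • h)) := by
  obtain ⟨τ, R, hτ, hw⟩ := hu.exists_isFieldFamily hU hh hR₀
  obtain ⟨R₁, hI⟩ := hw.eventually_varDeriv_const I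
  obtain ⟨R₂, hJ⟩ := hw.eventually_varDeriv_const J
  obtain ⟨ρ, hρ, hball⟩ := Metric.eventually_nhds_iff.1 (hI.and hJ)
  have hσ := isTangentToId_sinScale (half_pos hρ)
  have hmem (s : ℝ) : dist (sinScale (ρ / 2) s) 0 < ρ := by
    rw [Real.dist_0_eq_abs]
    exact (abs_sinScale_le (half_pos hρ) s).trans_lt (half_lt_self hρ)
  exact ⟨τ ∘ sinScale (ρ / 2), max R (max R₁ R₂), hτ.comp hσ,
    hw.comp hσ.contDiff (le_max_left _ _),
    hw.isSmoothFamily_varDeriv_comp I hσ.contDiff (fun s => (hball (hmem s)).1)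
      ((le_max_left _ _).trans (le_max_right _ _)),
    hw.isSmoothFamily_varDeriv_comp J hσ.contDiff (fun s => (hball (hmem s)).2)
      ((le_max_right _ _).trans (le_max_right _ _))⟩

/-- The second variation `∫ (δ²I/δu^i(x)δu^j(y)) h^j(y) dy`: the derivative of the variational
derivative in the direction `h`. -/
noncomputable def secondVar (u h : ℝ → Fin N → ℝ) (x : ℝ) : Fin N → ℝ :=
  deriv (fun ε : ℝ => I.varDeriv (u + ε • h) x) 0

theorem deriv_varDeriv_line {τ : ℝ → ℝ} (hτ : IsTangentToId τ)
    (hsmooth : ContDiff ℝ ∞ fun q : ℝ × ℝ => I.varDeriv (u + τ q.1 • h) q.2) (x : ℝ) :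
    deriv (fun s => I.varDeriv (u + τ s • h) x) 0 = I.secondVar u h x :=
  (hτ.hasDerivAt_of_comp (F := fun ε => I.varDeriv (u + ε • h) x)
    (hasDerivAt_param (w := fun s => I.varDeriv (u + τ s • h)) hsmooth 0 x)).deriv.symm

theorem isHydroField_secondVar (hU : IsOpen U) (hu : IsHydroField U u) (hh : ContDiff ℝ ∞ h)
    {R₀ : ℝ} (hR₀ : ∀ x, R₀ ≤ |x| → h x = 0) : IsHydroField Set.univ (I.secondVar u h) := by
  obtain ⟨τ, R, hτ, -, hI, -⟩ := exists_line I I hU hu hh hR₀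
  simpa only [I.deriv_varDeriv_line hτ hI.smooth] using hI.deriv_param.isHydroField 0

end SmoothFunctional

theorem HydroBracket.hasDerivAt_bracket {P : HydroBracket N} (hU : IsOpen U) (hP : P.SmoothOn U)
    (hPm : P.IsMetric U) (I J : SmoothFunctional U) (hu : IsHydroField U u)
    (hh : ContDiff ℝ ∞ h) {R₀ : ℝ} (hR₀ : ∀ x, R₀ ≤ |x| → h x = 0) :
    HasDerivAt (fun ε : ℝ => P.bracket I J (u + ε • h))
      (P.pairing u (I.secondVar u h) (J.varDeriv u) + P.pairing u (I.varDeriv u) (J.secondVar u h)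
        + P.fieldVariation u (I.varDeriv u) (J.varDeriv u) h) 0 := by
  obtain ⟨τ, R, hτ, hw, hI, hJ⟩ := I.exists_line J hU hu hh hR₀
  refine hτ.hasDerivAt_of_comp ((hasDerivAt_pairing hU hP hPm hw hI.smooth hJ 0).congr_deriv ?_)
  have hbase : u + τ 0 • h = u := by rw [hτ.map_zero, zero_smul, add_zero]
  have hvelocity (x : ℝ) : deriv (fun s => (u + τ s • h) x) 0 = h x := by
    simpa only [Pi.add_apply, Pi.smul_apply, one_smul] using
      ((hτ.hasDerivAt_zero.smul_const (h x)).const_add (u x)).deriv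
  simp only [hbase, hvelocity, I.deriv_varDeriv_line hτ hI.smooth,
    J.deriv_varDeriv_line hτ hJ.smooth]

end Functionals

section SecondVariation

open scoped Convolution in
theorem contDiff_integral_of_vanish {W E : Type*} [NormedAddCommGroup W] [NormedSpace ℝ W]
    [NormedAddCommGroup E] [NormedSpace ℝ E] {f : W → ℝ → E} {R : ℝ}
    (hf : ContDiff ℝ ∞ fun q : W × ℝ => f q.1 q.2) (hR : ∀ s x, R ≤ |x| → f s x = 0) :
    ContDiff ℝ ∞ fun s => ∫ x, f s x := by
  have hconv := MeasureTheory.contDiffOn_convolution_right_with_param (n := ⊤)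
    (f := fun _ : ℝ => (1 : ℝ)) (ContinuousLinearMap.lsmul ℝ ℝ) (μ := MeasureTheory.volume)
    isOpen_univ (isCompact_Icc (a := -R) (b := R))
    (fun s x _ hx => hR s x (not_lt.1 fun h => hx (abs_le.1 h.le)))
    (MeasureTheory.locallyIntegrable_const 1) hf.contDiffOn
  rw [Set.univ_prod_univ, contDiffOn_univ] at hconv
  have hzero := hconv.comp (contDiff_id.prodMk (contDiff_const (c := (0 : ℝ))))
  simpa only [Function.comp_def, MeasureTheory.convolution_lsmul_swap, one_smul, id_eq] using hzero

theorem deriv_comm_of_hasDerivAt_partials {F a b : ℝ → ℝ → ℝ}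
    (ha : ∀ s t, HasDerivAt (fun s => F s t) (a s t) s)
    (hb : ∀ s t, HasDerivAt (fun t => F s t) (b s t) t)
    (ha' : ContDiff ℝ ∞ fun q : ℝ × ℝ => a q.1 q.2)
    (hb' : ContDiff ℝ ∞ fun q : ℝ × ℝ => b q.1 q.2) (s t : ℝ) :
    deriv (fun t => a s t) t = deriv (fun s => b s t) s := by
  have hF (q : ℝ × ℝ) : HasFDerivAt (fun q : ℝ × ℝ => F q.1 q.2)
      (a q.1 q.2 • ContinuousLinearMap.fst ℝ ℝ ℝ +
        b q.1 q.2 • ContinuousLinearMap.snd ℝ ℝ ℝ) q := by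
    refine (hasStrictFDerivAt_uncurry_coprod (𝕜 := ℝ) (u := q) (f := F)
      (f₁ := fun s t => a s t • ContinuousLinearMap.id ℝ ℝ)
      (f₂ := fun s t => b s t • ContinuousLinearMap.id ℝ ℝ)
      (Filter.Eventually.of_forall fun v => (ha v.1 v.2).hasFDerivAt.congr_fderiv ?_)
      (Filter.Eventually.of_forall fun v => (hb v.1 v.2).hasFDerivAt.congr_fderiv ?_)
      (ha'.continuous.smul continuous_const).continuousAt
      (hb'.continuous.smul continuous_const).continuousAt).hasFDerivAt.congr_fderiv ?_
    all_goals ext <;> simp [Function.HasUncurry.uncurry]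
  have da := (ha'.differentiable (by simp) (s, t)).hasFDerivAt
  have db := (hb'.differentiable (by simp) (s, t)).hasFDerivAt
  have hsymm := second_derivative_symmetric hF
    ((da.smul_const (ContinuousLinearMap.fst ℝ ℝ ℝ)).add
      (db.smul_const (ContinuousLinearMap.snd ℝ ℝ ℝ))) (0, 1) (1, 0)
  rw [(hasDerivAt_section_of_contDiff ha' s t).deriv, (hasDerivAt_param_of_contDiff hb' s t).deriv]
  simpa using hsymm

theorem IsHydroFieldFamily.isHydroField {N k : ℕ} {U : Set (Fin N → ℝ)} {S : Set (Fin k → ℝ)}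
    {w : (Fin k → ℝ) → ℝ → Fin N → ℝ} (hw : IsHydroFieldFamily U S w) {s : Fin k → ℝ}
    (hs : s ∈ S) : IsHydroField U (w s) where
  smooth := contDiffOn_univ.1 (hw.smooth.comp (f := fun x : ℝ => (s, x))
    (contDiff_prodMk_right s).contDiffOn fun _ _ => ⟨hs, Set.mem_univ _⟩)
  mem := hw.mem s hs
  const_at_infinity := hw.const_at_infinity.imp fun _ => Exists.imp fun _ hc => hc s hs

namespace SmoothFunctional

variable {N : ℕ} {U : Set (Fin N → ℝ)} {u h : ℝ → Fin N → ℝ} (I : SmoothFunctional U)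

theorem hasDerivAt_toFun_line (hh : ContDiff ℝ ∞ h) {R : ℝ} (hR : ∀ x, R ≤ |x| → h x = 0)
    {τ : ℝ → ℝ} {τ' s : ℝ} (hτ : HasDerivAt τ τ' s) (hu : IsHydroField U (u + τ s • h)) :
    HasDerivAt (fun s => I.toFun (u + τ s • h))
      (τ' * ∫ x, ⟪I.varDeriv (u + τ s • h) x, h x⟫) s := by
  have hvar := I.hasVarDeriv _ hu h hh (hasCompactSupport_of_vanish hR)
  have hcomp := hvar.comp_of_eq (h := fun r => τ r - τ s) s (hτ.sub_const (τ s)) (by simp)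
  simp only [← coordPairing_apply, Function.comp_def] at hcomp
  rw [mul_comm]
  refine hcomp.congr_of_eventuallyEq (Filter.Eventually.of_forall fun r => ?_)
  simp only [add_assoc, ← add_smul, add_sub_cancel]

variable {h₁ h₂ : ℝ → Fin N → ℝ} {φ : ℝ → ℝ}

theorem contDiff_varDeriv_plane
    (hfam : IsHydroFieldFamily U Set.univ fun s : Fin 2 → ℝ => u + ∑ i, φ (s i) • ![h₁, h₂] i) :
    ContDiff ℝ ∞ fun p : (ℝ × ℝ) × ℝ => I.varDeriv (u + φ p.1.1 • h₁ + φ p.1.2 • h₂) p.2 := by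
  have hsmooth := I.smooth 2 Set.univ _ isOpen_univ hfam
  rw [Set.univ_prod_univ, contDiffOn_univ] at hsmooth
  have hcoord : ContDiff ℝ ∞ fun p : (ℝ × ℝ) × ℝ => (![p.1.1, p.1.2], p.2) :=
    (contDiff_pi.2 (Fin.forall_fin_two.2
      ⟨contDiff_fst.comp contDiff_fst, contDiff_snd.comp contDiff_fst⟩)).prodMk contDiff_snd
  simpa [Function.comp_def, Fin.sum_univ_two, add_assoc] using hsmooth.comp hcoord

theorem contDiff_integral_varDeriv_plane
    (hfam : IsHydroFieldFamily U Set.univ fun s : Fin 2 → ℝ => u + ∑ i, φ (s i) • ![h₁, h₂] i)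
    (hh : ContDiff ℝ ∞ h) {R : ℝ} (hR : ∀ x, R ≤ |x| → h x = 0) :
    ContDiff ℝ ∞ fun q : ℝ × ℝ => ∫ x, ⟪I.varDeriv (u + φ q.1 • h₁ + φ q.2 • h₂) x, h x⟫ :=
  contDiff_integral_of_vanish
    (f := fun (q : ℝ × ℝ) x => ⟪I.varDeriv (u + φ q.1 • h₁ + φ q.2 • h₂) x, h x⟫)
    (contDiff_coordPairing (I.contDiff_varDeriv_plane hfam) (hh.comp contDiff_snd))
    (fun q x hx => by rw [hR x hx, map_zero])

theorem deriv_integral_varDeriv_comm (hφ : IsTangentToId φ)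
    (hfam : IsHydroFieldFamily U Set.univ fun s : Fin 2 → ℝ => u + ∑ i, φ (s i) • ![h₁, h₂] i)
    (hh₁ : ContDiff ℝ ∞ h₁) (hh₂ : ContDiff ℝ ∞ h₂) {R : ℝ}
    (hR₁ : ∀ x, R ≤ |x| → h₁ x = 0) (hR₂ : ∀ x, R ≤ |x| → h₂ x = 0) :
    deriv (fun t => ∫ x, ⟪I.varDeriv (u + φ t • h₂) x, h₁ x⟫) 0 =
      deriv (fun s => ∫ x, ⟪I.varDeriv (u + φ s • h₁) x, h₂ x⟫) 0 := by
  have hfield (s t : ℝ) : IsHydroField U (u + φ s • h₁ + φ t • h₂) := by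
    simpa [Fin.sum_univ_two, add_assoc] using hfam.isHydroField (s := ![s, t]) (Set.mem_univ _)
  have hφ' : ContDiff ℝ ∞ (deriv φ) := (contDiff_infty_iff_deriv.1 hφ.contDiff).2
  have hφd (s : ℝ) := (hφ.contDiff.differentiable (by simp) s).hasDerivAt
  have hcomm := deriv_comm_of_hasDerivAt_partials
    (F := fun s t => I.toFun (u + φ s • h₁ + φ t • h₂))
    (a := fun s t => deriv φ s * ∫ x, ⟪I.varDeriv (u + φ s • h₁ + φ t • h₂) x, h₁ x⟫)
    (b := fun s t => deriv φ t * ∫ x, ⟪I.varDeriv (u + φ s • h₁ + φ t • h₂) x, h₂ x⟫)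
    (fun s t => by
      have hst := hfield s t
      rw [add_right_comm] at hst
      simpa only [add_right_comm u] using I.hasDerivAt_toFun_line hh₁ hR₁ (hφd s) hst)
    (fun s t => I.hasDerivAt_toFun_line hh₂ hR₂ (hφd t) (hfield s t))
    ((hφ'.comp contDiff_fst).mul (I.contDiff_integral_varDeriv_plane hfam hh₁ hR₁))
    ((hφ'.comp contDiff_snd).mul (I.contDiff_integral_varDeriv_plane hfam hh₂ hR₂)) 0 0
  simpa only [hφ.hasDerivAt_zero.deriv, one_mul, hφ.map_zero, zero_smul, add_zero] using hcomm

theorem deriv_integral_varDeriv_line (hφ : IsTangentToId φ)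
    (hsmooth : ContDiff ℝ ∞ fun q : ℝ × ℝ => I.varDeriv (u + φ q.1 • h₁) q.2)
    (hh₂ : ContDiff ℝ ∞ h₂) {R : ℝ} (hR₂ : ∀ x, R ≤ |x| → h₂ x = 0) :
    deriv (fun s => ∫ x, ⟪I.varDeriv (u + φ s • h₁) x, h₂ x⟫) 0 =
      ∫ x, ⟪I.secondVar u h₁ x, h₂ x⟫ := by
  rw [(hasDerivAt_integral_of_vanish (f := fun s x => ⟪I.varDeriv (u + φ s • h₁) x, h₂ x⟫)
    (contDiff_coordPairing hsmooth (hh₂.comp contDiff_snd))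
    (fun s x hx => by rw [hR₂ x hx, map_zero]) MeasureTheory.volume 0).deriv]
  refine congrArg (MeasureTheory.integral _) (funext fun x => ?_)
  rw [← I.deriv_varDeriv_line hφ hsmooth]
  exact ((coordPairing.flip (h₂ x)).hasFDerivAt.comp_hasDerivAt 0
    (hasDerivAt_param (w := fun s => I.varDeriv (u + φ s • h₁)) hsmooth 0 x)).deriv

theorem integral_secondVar_comm (hU : IsOpen U) (hu : IsHydroField U u)
    (hh₁ : ContDiff ℝ ∞ h₁) (hh₂ : ContDiff ℝ ∞ h₂) {R : ℝ}
    (hR₁ : ∀ x, R ≤ |x| → h₁ x = 0) (hR₂ : ∀ x, R ≤ |x| → h₂ x = 0) :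
    ∫ x, ⟪I.secondVar u h₁ x, h₂ x⟫ = ∫ x, ⟪I.secondVar u h₂ x, h₁ x⟫ := by
  obtain ⟨δ, hδ, hfam⟩ := hu.exists_isHydroFieldFamily hU (h := ![h₁, h₂])
    (Fin.forall_fin_two.2 ⟨hh₁, hh₂⟩) (Fin.forall_fin_two.2 ⟨hR₁, hR₂⟩)
  have hφ : IsTangentToId (sinScale δ) := isTangentToId_sinScale hδ
  have hsmooth := I.contDiff_varDeriv_plane hfam
  have hline₁ := hsmooth.comp (f := fun q : ℝ × ℝ => ((q.1, (0 : ℝ)), q.2)) (by fun_prop)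
  have hline₂ := hsmooth.comp (f := fun q : ℝ × ℝ => (((0 : ℝ), q.1), q.2)) (by fun_prop)
  simp only [Function.comp_def, hφ.map_zero, zero_smul, add_zero] at hline₁ hline₂
  rw [← I.deriv_integral_varDeriv_line hφ hline₁ hh₂ hR₂,
    ← I.deriv_integral_varDeriv_line hφ hline₂ hh₁ hR₁]
  exact (I.deriv_integral_varDeriv_comm hφ hfam hh₁ hh₂ hR₁ hR₂).symm

end SmoothFunctional

end SecondVariation

/-! ### The pointwise conditions imply the Poisson property -/

section PoissonOfJet

open MeasureTheory

namespace HydroBracket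

variable {N : ℕ} {P : HydroBracket N} {U : Set (Fin N → ℝ)} {u ξ η ζ : ℝ → Fin N → ℝ}

/-- The quantity `b^{ij}_k + b^{ji}_k - ∂_k g^{ij}` at `p`, contracted with `ξ_i`, `η_j` and `v^k`.
It vanishes exactly when `P` satisfies `IsMetric`. -/
noncomputable def metricDefect (P : HydroBracket N) (p v ξ η : Fin N → ℝ) : ℝ :=
  ⟪ξ, P.bL p v η⟫ + ⟪η, P.bL p v ξ⟫ - ⟪ξ, fderiv ℝ P.gL p v η⟫

theorem hasDerivAt_coordPairing_gL (hU : IsOpen U) (hP : P.SmoothOn U) (hu : IsHydroField U u)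
    (hξ : ContDiff ℝ ∞ ξ) (hη : ContDiff ℝ ∞ η) (x : ℝ) :
    HasDerivAt (fun x => ⟪ξ x, P.gL (u x) (η x)⟫)
      (⟪deriv ξ x, P.gL (u x) (η x)⟫ + (⟪ξ x, fderiv ℝ P.gL (u x) (deriv u x) (η x)⟫
        + ⟪ξ x, P.gL (u x) (deriv η x)⟫)) x := by
  have dG := (hP.hasFDerivAt_gL hU (hu.mem x)).comp_hasDerivAt x
    (hu.smooth.differentiable (by simp) x).hasDerivAt
  refine ((coordPairing.hasFDerivAt.comp_hasDerivAt x
    (hξ.differentiable (by simp) x).hasDerivAt).clm_apply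
      (dG.clm_apply (hη.differentiable (by simp) x).hasDerivAt)).congr_deriv ?_
  simp only [Function.comp, map_add]

theorem integral_deriv_coordPairing_gL (hP : P.SmoothOn U) (hu : IsHydroField U u)
    (hξ : IsHydroField Set.univ ξ) (hη : IsHydroField Set.univ η) :
    Integrable (deriv fun x => ⟪ξ x, P.gL (u x) (η x)⟫) ∧
      ∫ x, deriv (fun x => ⟪ξ x, P.gL (u x) (η x)⟫) x = 0 := by
  obtain ⟨c, R, hR⟩ := hu.const_at_infinity
  obtain ⟨c₁, R₁, hR₁⟩ := hξ.const_at_infinity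
  obtain ⟨c₂, R₂, hR₂⟩ := hη.const_at_infinity
  refine integral_deriv_eq_zero_of_const (c := ⟪c₁, P.gL c c₂⟫) (R := max R (max R₁ R₂))
    (contDiff_coordPairing hξ.smooth
      ((hP.contDiffOn_gL.comp_contDiff hu.smooth hu.mem).clm_apply hη.smooth)) fun x hx => ?_
  simp only [max_le_iff] at hx
  rw [hR x hx.1, hR₁ x hx.2.1, hR₂ x hx.2.2]

theorem continuous_metricDefect (hU : IsOpen U) (hP : P.SmoothOn U) (hu : IsHydroField U u)
    (hξ : Continuous ξ) (hη : Continuous η) :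
    Continuous fun x => P.metricDefect (u x) (deriv u x) (ξ x) (η x) := by
  have hu' := hu.contDiff_deriv.continuous
  have hb := (hP.contDiffOn_bL.comp_contDiff hu.smooth hu.mem).continuous
  have hg' := ((hP.contDiffOn_fderiv_gL hU).comp_contDiff hu.smooth hu.mem).continuous
  simp only [Function.comp_def] at hb hg'
  unfold metricDefect
  fun_prop

theorem coordPairing_op_add_coordPairing_op (hU : IsOpen U) (hP : P.SmoothOn U)
    (hG : ∀ p ∈ U, (P.jet p).IsSymm) (hu : IsHydroField U u) (hξ : ContDiff ℝ ∞ ξ)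
    (hη : ContDiff ℝ ∞ η) (x : ℝ) :
    ⟪ξ x, P.op u η x⟫ + ⟪η x, P.op u ξ x⟫ =
      P.metricDefect (u x) (deriv u x) (ξ x) (η x) + deriv (fun x => ⟪ξ x, P.gL (u x) (η x)⟫) x
      + P.K * (⟪ξ x, deriv u x⟫ * invD (fun x => ⟪η x, deriv u x⟫) x
        + ⟪η x, deriv u x⟫ * invD (fun x => ⟪ξ x, deriv u x⟫) x) := by
  have hsymm : ⟪η x, P.gL (u x) (deriv ξ x)⟫ = ⟪deriv ξ x, P.gL (u x) (η x)⟫ :=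
    hG (u x) (hu.mem x) _ _
  rw [op_eq hu hη.continuous, op_eq hu hξ.continuous,
    (hasDerivAt_coordPairing_gL hU hP hu hξ hη x).deriv]
  simp only [HydroJet.opAt, jet, metricDefect, map_add, map_smul, smul_eq_mul, hsymm]
  ring

theorem pairing_add_pairing (hU : IsOpen U) (hP : P.SmoothOn U) (hG : ∀ p ∈ U, (P.jet p).IsSymm)
    (hu : IsHydroField U u) (hξ : IsHydroField Set.univ ξ) (hη : IsHydroField Set.univ η) :
    P.pairing u ξ η + P.pairing u η ξ =
      ∫ x, P.metricDefect (u x) (deriv u x) (ξ x) (η x) := by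
  obtain ⟨c, R, -, hR⟩ := hu.exists_radius
  have hcξ := hξ.smooth.continuous
  have hcη := hη.smooth.continuous
  have hiξ := hu.integrable_coordPairing_deriv hcξ
  have hiη := hu.integrable_coordPairing_deriv hcη
  have hpξ := (contDiff_coordPairing hξ.smooth hu.contDiff_deriv).continuous
  have hpη := (contDiff_coordPairing hη.smooth hu.contDiff_deriv).continuous
  obtain ⟨hderiv, hderiv_zero⟩ := integral_deriv_coordPairing_gL hP hu hξ hη
  have hdefect : Integrable fun x => P.metricDefect (u x) (deriv u x) (ξ x) (η x) :=
    integrable_of_vanish (R := R) (continuous_metricDefect hU hP hu hcξ hcη)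
      fun x hx => by simp [metricDefect, (hR x hx).2]
  have hskew := ((integrable_mul_invD hiξ hiη hpη).fun_add
    (integrable_mul_invD hiη hiξ hpξ)).const_mul P.K
  rw [pairing_eq_integral, pairing_eq_integral, ← integral_add
    (integrable_pairing hP hu hcξ hη) (integrable_pairing hP hu hcη hξ)]
  simp only [coordPairing_op_add_coordPairing_op hU hP hG hu hξ.smooth hη.smooth]
  rw [integral_add (hdefect.fun_add hderiv) hskew, integral_add hdefect hderiv, hderiv_zero,
    integral_const_mul, integral_mul_invD_add_eq_zero hiξ hpξ hiη hpη, mul_zero, add_zero, add_zero]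

theorem pairing_eq_neg_pairing (hU : IsOpen U) (hP : P.SmoothOn U)
    (hG : ∀ p ∈ U, (P.jet p).IsSymm) (hPm : P.IsMetric U) (hu : IsHydroField U u)
    (hξ : IsHydroField Set.univ ξ) (hη : IsHydroField Set.univ η) :
    P.pairing u ξ η = -P.pairing u η ξ := by
  rw [← add_eq_zero_iff_eq_neg, pairing_add_pairing hU hP hG hu hξ hη]
  simp only [metricDefect, hPm _ (hu.mem _), sub_self, integral_zero]

theorem sum_fieldVariation (hU : IsOpen U) (hP : P.SmoothOn U) (hG : ∀ p ∈ U, (P.jet p).IsSymm)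
    (hu : IsHydroField U u) (hξ : IsHydroField Set.univ ξ) (hη : IsHydroField Set.univ η)
    (hζ : IsHydroField Set.univ ζ) :
    P.fieldVariation u ξ η (P.op u ζ) + P.fieldVariation u η ζ (P.op u ξ)
      + P.fieldVariation u ζ ξ (P.op u η)
    = ∫ x, (P.jet (u x)).jacobiDensity (deriv u x) (ξ x) (deriv ξ x) (η x) (deriv η x)
        (ζ x) (deriv ζ x) := by
  have hint {ξ η ζ : ℝ → Fin N → ℝ} (hξ : IsHydroField Set.univ ξ) (hη : IsHydroField Set.univ η)
      (hζ : IsHydroField Set.univ ζ) :=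
    let ⟨_, hR⟩ := op_vanish (P := P) hu hζ
    integrable_variationDensity hU hP hu hξ.smooth hη.smooth
      (contDiff_op hP hu hζ.smooth).continuous hR
  rw [fieldVariation, fieldVariation, fieldVariation,
    ← integral_add (hint hξ hη hζ) (hint hη hζ hξ),
    ← integral_add ((hint hξ hη hζ).fun_add (hint hη hζ hξ)) (hint hζ hξ hη)]
  refine congrArg (integral _) (funext fun x => ?_)
  rw [op_eq hu hξ.smooth.continuous, op_eq hu hη.smooth.continuous,
    op_eq hu hζ.smooth.continuous]
  exact HydroJet.sum_variationDensity (hG (u x) (hu.mem x)) _ _ _ _ _ _ _ _ _ _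

theorem sum_fieldVariation_eq_zero (hU : IsOpen U) (hP : P.SmoothOn U)
    (hj : ∀ p ∈ U, (P.jet p).IsPoisson) (hu : IsHydroField U u) (hξ : IsHydroField Set.univ ξ)
    (hη : IsHydroField Set.univ η) (hζ : IsHydroField Set.univ ζ) :
    P.fieldVariation u ξ η (P.op u ζ) + P.fieldVariation u η ζ (P.op u ξ)
      + P.fieldVariation u ζ ξ (P.op u η) = 0 := by
  rw [sum_fieldVariation hU hP (fun p hp => (hj p hp).symm) hu hξ hη hζ]
  simp only [(hj _ (hu.mem _)).jacobiDensity_eq_zero, integral_zero]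

theorem exists_hamVec_vanish (I J L : SmoothFunctional U) (hu : IsHydroField U u) :
    ∃ R, ∀ x, R ≤ |x| → P.hamVec I u x = 0 ∧ P.hamVec J u x = 0 ∧ P.hamVec L u x = 0 := by
  obtain ⟨R₁, hR₁⟩ := op_vanish (P := P) hu (I.isHydroField_varDeriv hu)
  obtain ⟨R₂, hR₂⟩ := op_vanish (P := P) hu (J.isHydroField_varDeriv hu)
  obtain ⟨R₃, hR₃⟩ := op_vanish (P := P) hu (L.isHydroField_varDeriv hu)
  refine ⟨max R₁ (max R₂ R₃), fun x hx => ?_⟩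
  simp only [max_le_iff] at hx
  exact ⟨hR₁ x hx.1, hR₂ x hx.2.1, hR₃ x hx.2.2⟩

theorem isPoisson_of_jet (hU : IsOpen U) (hP : P.SmoothOn U) (hPm : P.IsMetric U)
    (hj : ∀ p ∈ U, (P.jet p).IsPoisson) : P.IsPoisson U := by
  have hskew {u ξ η : ℝ → Fin N → ℝ} (hu : IsHydroField U u) :=
    pairing_eq_neg_pairing (ξ := ξ) (η := η) hU hP (fun p hp => (hj p hp).symm) hPm hu
  have hvarDeriv (I : SmoothFunctional U) {u : ℝ → Fin N → ℝ} (hu : IsHydroField U u) :=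
    I.isHydroField_varDeriv hu
  refine ⟨fun I J u hu => hskew hu (hvarDeriv I hu) (hvarDeriv J hu), fun I J L u hu => ?_⟩
  obtain ⟨R, hR⟩ := exists_hamVec_vanish (P := P) I J L hu
  have hham (I : SmoothFunctional U) : ContDiff ℝ ∞ (P.hamVec I u) :=
    contDiff_op hP hu (hvarDeriv I hu).smooth
  have hRI x (hx : R ≤ |x|) := (hR x hx).1
  have hRJ x (hx : R ≤ |x|) := (hR x hx).2.1
  have hRL x (hx : R ≤ |x|) := (hR x hx).2.2
  refine ⟨_, _, _, hasDerivAt_bracket hU hP hPm I J hu (hham L) hRL,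
    hasDerivAt_bracket hU hP hPm J L hu (hham I) hRI,
    hasDerivAt_bracket hU hP hPm L I hu (hham J) hRJ, ?_⟩
  -- By skew-symmetry the second variations of each functional enter with opposite signs.
  have hcycle := sum_fieldVariation_eq_zero hU hP hj hu (hvarDeriv I hu) (hvarDeriv J hu)
    (hvarDeriv L hu)
  have hI := I.integral_secondVar_comm hU hu (hham J) (hham L) hRJ hRL
  have hJ := J.integral_secondVar_comm hU hu (hham L) (hham I) hRL hRI
  have hL := L.integral_secondVar_comm hU hu (hham I) (hham J) hRI hRJ
  unfold hamVec at *
  rw [hskew hu (hvarDeriv I hu) (J.isHydroField_secondVar hU hu (hham L) hRL),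
    hskew hu (hvarDeriv J hu) (L.isHydroField_secondVar hU hu (hham I) hRI),
    hskew hu (hvarDeriv L hu) (I.isHydroField_secondVar hU hu (hham J) hRJ)]
  simp only [pairing_eq_integral]
  linarith

end HydroBracket

end PoissonOfJet

/-! ### Necessity of the pointwise conditions -/

section JetOfPoisson

open MeasureTheory

variable {N : ℕ} {U : Set (Fin N → ℝ)}

theorem IsHydroField.hasDerivAt_integral_coordPairing {u v ξ : ℝ → Fin N → ℝ}
    (hu : IsHydroField U u) (hξ : Continuous ξ) (hv : Continuous v) (hvc : HasCompactSupport v) :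
    HasDerivAt (fun ε : ℝ => ∫ x, ⟪ξ x, (u + ε • v) x - Filter.limUnder Filter.atTop (u + ε • v)⟫)
      (∫ x, ⟪ξ x, v x⟫) 0 := by
  obtain ⟨c, R, hR⟩ := hu.const_at_infinity
  have hcu := hu.smooth.continuous
  have hlim (ε : ℝ) : Filter.limUnder Filter.atTop (u + ε • v) = c := by
    refine Filter.Tendsto.limUnder_eq (tendsto_const_nhds.congr' ?_)
    filter_upwards [Filter.eventually_ge_atTop R, atTop_le_cocompact
      (Filter.coclosedCompact_eq_cocompact (X := ℝ) ▸ hasCompactSupport_iff_eventuallyEq.1 hvc)]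
      with x hx hvx
    simp [hR x (hx.trans (le_abs_self x)), hvx]
  have hiu : Integrable fun x => ⟪ξ x, u x - c⟫ :=
    integrable_of_vanish (R := R) (by fun_prop) fun x hx => by rw [hR x hx, sub_self, map_zero]
  have hiv : Integrable fun x => ⟪ξ x, v x⟫ :=
    Continuous.integrable_of_hasCompactSupport (by fun_prop)
      (hvc.mono fun x hx hvx => hx (by simp only [hvx, map_zero]))
  have hlin (ε : ℝ) : ∫ x, ⟪ξ x, (u + ε • v) x - Filter.limUnder Filter.atTop (u + ε • v)⟫ =
      (∫ x, ⟪ξ x, u x - c⟫) + ε * ∫ x, ⟪ξ x, v x⟫ := by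
    rw [hlim, ← integral_const_mul, ← integral_add hiu (hiv.const_mul ε)]
    refine congrArg (integral _) (funext fun x => ?_)
    simp only [Pi.add_apply, Pi.smul_apply, map_add, map_sub, map_smul, smul_eq_mul]
    ring
  simp only [hlin]
  exact (((hasDerivAt_id (0 : ℝ)).mul_const _).const_add _).congr_deriv (one_mul _)

/-- The functional `u ↦ ∫ ξ_i(x) (u^i(x) - u^i(∞)) dx`, whose variational derivative is the given
`ξ` at every field. -/
noncomputable def linFunctional (U : Set (Fin N → ℝ)) (ξ : ℝ → Fin N → ℝ)
    (hξ : IsHydroField Set.univ ξ) : SmoothFunctional U where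
  toFun u := ∫ x, ⟪ξ x, u x - Filter.limUnder Filter.atTop u⟫
  varDeriv _ := ξ
  hasVarDeriv u hu v hv hvc := by
    simpa only [coordPairing_apply] using
      hu.hasDerivAt_integral_coordPairing hξ.smooth.continuous hv.continuous hvc
  smooth k S w _ _ := (hξ.smooth.comp contDiff_snd).contDiffOn
  const_at_infinity k S w _ _ s₀ _ :=
    let ⟨c, R, hR⟩ := hξ.const_at_infinity
    ⟨R, Filter.Eventually.of_forall fun _ => ⟨c, hR⟩⟩

/-- A nonzero test function on the line, supported in `[-2, 2]`. -/
structure IsBump (φ : ℝ → ℝ) : Prop where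
  smooth : ContDiff ℝ ∞ φ
  eq_zero : ∀ x, 2 ≤ |x| → φ x = 0
  integral_pos : 0 < ∫ x, deriv φ x ^ 2

theorem exists_isBump : ∃ φ, IsBump φ := by
  let f : ContDiffBump (0 : ℝ) := ⟨1, 2, one_pos, one_lt_two⟩
  have hf : ContDiff ℝ ∞ f := f.contDiff
  have hzero (x : ℝ) (hx : 2 ≤ |x|) : f x = 0 := f.zero_of_le_dist (by simpa using hx)
  refine ⟨f, hf, hzero, ?_⟩
  obtain ⟨c, -, hc⟩ := exists_deriv_eq_slope (f : ℝ → ℝ) (show (0 : ℝ) < 2 by norm_num)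
    hf.continuous.continuousOn (hf.differentiable (by simp)).differentiableOn
  have hne : deriv f c ≠ 0 := by
    rw [hc, hzero 2 (by norm_num), f.one_of_mem_closedBall (by simp [f])]
    norm_num
  exact ((contDiff_infty_iff_deriv.1 hf).2.continuous.pow 2
    ).integral_pos_of_hasCompactSupport_nonneg_nonzero
    (hasCompactSupport_of_vanish (R := 2 + 1) fun x hx => by
      rw [Pi.pow_apply, deriv_eq_zero_of_const hzero x hx, sq, zero_mul])
    (fun x => sq_nonneg _) (pow_ne_zero 2 hne)

namespace IsBump

variable {φ : ℝ → ℝ}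

theorem contDiff_deriv (hφ : IsBump φ) : ContDiff ℝ ∞ (deriv φ) :=
  (contDiff_infty_iff_deriv.1 hφ.smooth).2

theorem deriv_eq_zero (hφ : IsBump φ) (x : ℝ) (hx : 2 + 1 ≤ |x|) : deriv φ x = 0 :=
  deriv_eq_zero_of_const hφ.eq_zero x hx

theorem hasDerivAt (hφ : IsBump φ) (x : ℝ) : HasDerivAt φ (deriv φ x) x :=
  (hφ.smooth.differentiable (by simp) x).hasDerivAt

theorem integral_mul_deriv_deriv (hφ : IsBump φ) :
    ∫ x, φ x * deriv (deriv φ) x = -∫ x, deriv φ x ^ 2 := by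
  have hcφ := hφ.smooth.continuous
  have hcφ' := hφ.contDiff_deriv.continuous
  have hcφ'' := (contDiff_infty_iff_deriv.1 hφ.contDiff_deriv).2.continuous
  simp only [sq]
  exact integral_mul_deriv_eq_deriv_mul_of_integrable (fun x _ => hφ.hasDerivAt x)
    (fun x _ => (hφ.contDiff_deriv.differentiable (by simp) x).hasDerivAt)
    (integrable_of_vanish (R := 2) (hcφ.mul hcφ'') fun x hx => by
      rw [Pi.mul_apply, hφ.eq_zero x hx, zero_mul])
    (integrable_of_vanish (R := 2 + 1) (hcφ'.mul hcφ') fun x hx => by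
      rw [Pi.mul_apply, hφ.deriv_eq_zero x hx, zero_mul])
    (integrable_of_vanish (R := 2) (hcφ.mul hcφ') fun x hx => by
      rw [Pi.mul_apply, hφ.eq_zero x hx, zero_mul])

theorem isHydroField_smul (hφ : IsBump φ) (a : Fin N → ℝ) :
    IsHydroField Set.univ fun x => φ x • a :=
  IsHydroField.of_vanish (hφ.smooth.smul contDiff_const) fun x hx => by
    rw [hφ.eq_zero x hx, zero_smul]

theorem isHydroField_deriv_smul (hφ : IsBump φ) (a : Fin N → ℝ) :
    IsHydroField Set.univ fun x => deriv φ x • a :=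
  IsHydroField.of_vanish (hφ.contDiff_deriv.smul contDiff_const) fun x hx => by
    rw [hφ.deriv_eq_zero x hx, zero_smul]

theorem deriv_smul (hφ : IsBump φ) (a : Fin N → ℝ) (x : ℝ) :
    deriv (fun x => φ x • a) x = deriv φ x • a :=
  ((hφ.hasDerivAt x).smul_const a).deriv

theorem deriv_testField (hφ : IsBump φ) (p v : Fin N → ℝ) (e x : ℝ) :
    deriv (fun x => p + (e * φ x) • v) x = (e * deriv φ x) • v :=
  ((((hφ.hasDerivAt x).const_mul e).smul_const v).const_add p).deriv

theorem eq_zero_of_testField (hφ : IsBump φ) (hU : IsOpen U) {p : Fin N → ℝ} (hp : p ∈ U)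
    (v : Fin N → ℝ) {Q : (Fin N → ℝ) → ℝ} (hQ : ContinuousOn Q U)
    (h : ∀ e ≠ 0, IsHydroField U (fun x => p + (e * φ x) • v) →
      ∫ x, Q (p + (e * φ x) • v) * deriv φ x ^ 2 = 0) : Q p = 0 := by
  obtain ⟨τ, R, hτ, hw⟩ := (IsHydroField.const hp).exists_isFieldFamily hU
    (hφ.isHydroField_smul v).smooth (R := 2) fun x hx => by rw [hφ.eq_zero x hx, zero_smul]
  have hfield (s : ℝ) : ((fun _ => p) + τ s • fun x => φ x • v) = fun x => p + (τ s * φ x) • v :=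
    funext fun x => by simp [smul_smul]
  simp only [hfield] at hw
  -- The integral is continuous in the amplitude, which may therefore be sent to zero.
  set F : ℝ → ℝ := fun s => ∫ x, Q (p + (τ s * φ x) • v) * deriv φ x ^ 2 with hF_def
  have hF : Continuous F := by
    rw [← continuousOn_univ]
    refine continuousOn_integral_of_compact_support (isCompact_Icc (a := -(2 + 1)) (b := 2 + 1))
      (Continuous.continuousOn ?_) fun s x _ hx => ?_
    · exact (hQ.comp_continuous hw.smooth.continuous fun q => hw.mem q.1 q.2).mul
        ((hφ.contDiff_deriv.continuous.comp continuous_snd).pow 2)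
    · rw [hφ.deriv_eq_zero x (not_lt.1 fun h => hx (abs_le.1 h.le)), sq, mul_zero, mul_zero]
  have hFzero : ∀ᶠ s in 𝓝[≠] (0 : ℝ), F s = 0 :=
    (hτ.hasDerivAt_zero.eventually_ne (c := 0) one_ne_zero).mono
      fun s hs => h (τ s) hs (hw.isHydroField s)
  have hF0 : F 0 = 0 := tendsto_nhds_unique hF.continuousWithinAt.tendsto
    (tendsto_const_nhds.congr' (hFzero.mono fun _ => Eq.symm))
  simp only [hF_def, hτ.map_zero, zero_mul, zero_smul, add_zero, integral_const_mul] at hF0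
  exact (mul_eq_zero.1 hF0).resolve_right hφ.integral_pos.ne'

end IsBump

namespace HydroBracket

variable {P : HydroBracket N} {u ξ η ζ : ℝ → Fin N → ℝ}

theorem SmoothOn.continuousOn_curvature (hP : P.SmoothOn U) (hU : IsOpen U)
    (v ξ η ζ : Fin N → ℝ) :
    ContinuousOn (fun p => (P.jet p).curvature (P.jet p) v ξ η ζ) U := by
  have hg := hP.contDiffOn_gL.continuousOn
  have hb := hP.contDiffOn_bL.continuousOn
  have hb' := (hP.contDiffOn_fderiv_bL hU).continuousOn
  simp only [HydroJet.curvature, HydroJet.curl, jet]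
  fun_prop

theorem SmoothOn.continuousOn_cyclicCurl (hP : P.SmoothOn U) (hU : IsOpen U)
    (v ξ η ζ : Fin N → ℝ) :
    ContinuousOn (fun p => (P.jet p).cyclicCurl (P.jet p) v ξ η ζ) U := by
  have hb := hP.contDiffOn_bL.continuousOn
  have hb' := (hP.contDiffOn_fderiv_bL hU).continuousOn
  simp only [HydroJet.cyclicCurl, HydroJet.curl, jet]
  fun_prop

theorem pairing_const {p : Fin N → ℝ} (hp : p ∈ U) (hη : Continuous η) :
    P.pairing (fun _ => p) ξ η = ∫ x, ⟪ξ x, P.gL p (deriv η x)⟫ := by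
  simp only [pairing_eq_integral, op_eq (IsHydroField.const hp) hη, HydroJet.opAt, jet, deriv_const,
    map_zero, zero_apply, smul_zero, add_zero]

namespace IsPoisson

theorem pairing_eq_neg_pairing (h : P.IsPoisson U) (hu : IsHydroField U u)
    (hξ : IsHydroField Set.univ ξ) (hη : IsHydroField Set.univ η) :
    P.pairing u ξ η = -P.pairing u η ξ :=
  h.1 (linFunctional U ξ hξ) (linFunctional U η hη) u hu

theorem isSymm (h : P.IsPoisson U) {p : Fin N → ℝ} (hp : p ∈ U) : (P.jet p).IsSymm := by
  intro a b
  obtain ⟨φ, hφ⟩ := exists_isBump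
  have hskew := h.pairing_eq_neg_pairing (IsHydroField.const hp) (hφ.isHydroField_deriv_smul a)
    (hφ.isHydroField_smul b)
  have hderiv (x : ℝ) : deriv (fun x => deriv φ x • a) x = deriv (deriv φ) x • a :=
    ((hφ.contDiff_deriv.differentiable (by simp) x).hasDerivAt.smul_const a).deriv
  rw [pairing_const hp (hφ.isHydroField_smul b).smooth.continuous,
    pairing_const hp (hφ.isHydroField_deriv_smul a).smooth.continuous] at hskew
  simp only [hφ.deriv_smul, hderiv, map_smul, smul_apply, smul_eq_mul] at hskew
  simp only [← mul_assoc, mul_comm (deriv (deriv φ) _) (φ _), integral_mul_const,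
    hφ.integral_mul_deriv_deriv, ← sq] at hskew
  rw [neg_mul, neg_neg] at hskew
  exact mul_left_cancel₀ hφ.integral_pos.ne' hskew

theorem isMetric (h : P.IsPoisson U) (hU : IsOpen U) (hP : P.SmoothOn U) : P.IsMetric U := by
  intro p hp v a b
  obtain ⟨φ, hφ⟩ := exists_isBump
  have hb := hP.contDiffOn_bL.continuousOn
  have hg' := (hP.contDiffOn_fderiv_gL hU).continuousOn
  have hdefect : P.metricDefect p v a b = 0 := by
    refine hφ.eq_zero_of_testField hU hp v (Q := fun p => P.metricDefect p v a b)
      (by unfold metricDefect; fun_prop) fun e he hu => ?_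
    have hξ := hφ.isHydroField_deriv_smul a
    have hη : IsHydroField Set.univ fun _ : ℝ => b := IsHydroField.const (Set.mem_univ b)
    have hzero := pairing_add_pairing hU hP (fun p hp => h.isSymm hp) hu hξ hη
    rw [h.pairing_eq_neg_pairing hu hξ hη, neg_add_cancel] at hzero
    refine (mul_eq_zero.1 ?_).resolve_left he
    rw [← integral_const_mul, hzero]
    refine congrArg (integral _) (funext fun x => ?_)
    simp only [metricDefect, hφ.deriv_testField, map_smul, smul_apply, smul_eq_mul]
    ring
  rw [metricDefect] at hdefect
  linarith

theorem fieldVariation_eq (h : P.IsPoisson U) (hU : IsOpen U) (hP : P.SmoothOn U)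
    (hu : IsHydroField U u) (hξ : IsHydroField Set.univ ξ) (hη : IsHydroField Set.univ η)
    (hζ : IsHydroField Set.univ ζ) {a : ℝ}
    (ha : HasDerivAt (fun ε : ℝ => P.bracket (linFunctional U ξ hξ) (linFunctional U η hη)
      (u + ε • P.hamVec (linFunctional U ζ hζ) u)) a 0) :
    P.fieldVariation u ξ η (P.op u ζ) = a := by
  obtain ⟨R, hR⟩ := op_vanish (P := P) hu hζ
  have hderiv := hasDerivAt_bracket hU hP (h.isMetric hU hP) (linFunctional U ξ hξ)
    (linFunctional U η hη) hu (contDiff_op hP hu hζ.smooth) hR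
  have hsecond {θ : ℝ → Fin N → ℝ} (hθ : IsHydroField Set.univ θ) :
      (linFunctional U θ hθ).secondVar u (P.op u ζ) = fun _ => 0 :=
    funext fun x => deriv_const _ _
  have hleft (θ : ℝ → Fin N → ℝ) : P.pairing u (fun _ => 0) θ = 0 := by
    simp only [pairing_eq_integral, map_zero, zero_apply, integral_zero]
  have hright : P.pairing u ξ (fun _ => 0) = 0 := by
    rw [h.pairing_eq_neg_pairing hu hξ (IsHydroField.const (Set.mem_univ 0)), hleft, neg_zero]
  have hvarDeriv : (linFunctional U ξ hξ).varDeriv u = ξ := rfl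
  have hvarDeriv' : (linFunctional U η hη).varDeriv u = η := rfl
  rw [hsecond, hsecond, hleft, hvarDeriv, hvarDeriv', hright, zero_add, zero_add] at hderiv
  exact hderiv.unique ha

theorem integral_jacobiDensity_eq_zero (h : P.IsPoisson U) (hU : IsOpen U) (hP : P.SmoothOn U)
    (hu : IsHydroField U u) (hξ : IsHydroField Set.univ ξ) (hη : IsHydroField Set.univ η)
    (hζ : IsHydroField Set.univ ζ) :
    ∫ x, (P.jet (u x)).jacobiDensity (deriv u x) (ξ x) (deriv ξ x) (η x) (deriv η x)
      (ζ x) (deriv ζ x) = 0 := by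
  obtain ⟨a₁, a₂, a₃, ha₁, ha₂, ha₃, hsum⟩ :=
    h.2 (linFunctional U ξ hξ) (linFunctional U η hη) (linFunctional U ζ hζ) u hu
  rw [← sum_fieldVariation hU hP (fun p hp => h.isSymm hp) hu hξ hη hζ,
    h.fieldVariation_eq hU hP hu hξ hη hζ ha₁, h.fieldVariation_eq hU hP hu hη hζ hξ ha₂,
    h.fieldVariation_eq hU hP hu hζ hξ hη ha₃, hsum]

variable {p : Fin N → ℝ}

theorem torsion_eq_zero (h : P.IsPoisson U) (hU : IsOpen U) (hP : P.SmoothOn U) (hp : p ∈ U)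
    (a b c : Fin N → ℝ) : (P.jet p).torsion (P.jet p) a b c = 0 := by
  obtain ⟨φ, hφ⟩ := exists_isBump
  have hzero := h.integral_jacobiDensity_eq_zero hU hP (IsHydroField.const hp)
    (IsHydroField.const (Set.mem_univ a)) (hφ.isHydroField_smul b) (hφ.isHydroField_smul c)
  simp only [deriv_const, hφ.deriv_smul, HydroJet.jacobiDensity_zero, HydroJet.torsion_smul,
    integral_mul_const, ← sq] at hzero
  exact (mul_eq_zero.1 hzero).resolve_left hφ.integral_pos.ne'

theorem cyclicCurl_eq_zero (h : P.IsPoisson U) (hU : IsOpen U) (hP : P.SmoothOn U) (hp : p ∈ U)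
    (v a b c : Fin N → ℝ) : (P.jet p).cyclicCurl (P.jet p) v a b c = 0 := by
  obtain ⟨φ, hφ⟩ := exists_isBump
  refine hφ.eq_zero_of_testField hU hp v (hP.continuousOn_cyclicCurl hU v a b c) fun e he hu => ?_
  have hzero := h.integral_jacobiDensity_eq_zero hU hP hu (IsHydroField.const (Set.mem_univ a))
    (IsHydroField.const (Set.mem_univ b)) (IsHydroField.const (Set.mem_univ c))
  have hcurv (X : HydroJet N) (w : Fin N → ℝ) : X.curvature X w a b 0 = 0 := by
    simpa using X.curvature_smul X 1 0 w a b 0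
  simp only [deriv_const, HydroJet.jacobiDensity_of_deriv_eq_zero, hcurv, zero_add,
    hφ.deriv_testField, HydroJet.cyclicCurl_smul, mul_pow, mul_assoc, integral_const_mul] at hzero
  simpa only [mul_comm] using (mul_eq_zero.1 hzero).resolve_left (pow_ne_zero 2 he)

theorem curvature_eq_zero (h : P.IsPoisson U) (hU : IsOpen U) (hP : P.SmoothOn U) (hp : p ∈ U)
    (v a b c : Fin N → ℝ) : (P.jet p).curvature (P.jet p) v a b c = 0 := by
  obtain ⟨φ, hφ⟩ := exists_isBump
  refine hφ.eq_zero_of_testField hU hp v (hP.continuousOn_curvature hU v a b c) fun e he hu => ?_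
  have hzero := h.integral_jacobiDensity_eq_zero hU hP hu (IsHydroField.const (Set.mem_univ a))
    (IsHydroField.const (Set.mem_univ b)) (hφ.isHydroField_smul c)
  simp only [deriv_const, HydroJet.jacobiDensity_of_deriv_eq_zero,
    h.cyclicCurl_eq_zero hU hP (hu.mem _), add_zero, hφ.deriv_testField, hφ.deriv_smul,
    HydroJet.curvature_smul, mul_assoc, integral_const_mul] at hzero
  simpa only [mul_comm, sq, mul_assoc] using (mul_eq_zero.1 hzero).resolve_left he

theorem jet (h : P.IsPoisson U) (hU : IsOpen U) (hP : P.SmoothOn U) (hp : p ∈ U) :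
    (P.jet p).IsPoisson where
  symm := h.isSymm hp
  torsion := h.torsion_eq_zero hU hP hp
  curvature := h.curvature_eq_zero hU hP hp
  cyclicCurl := h.cyclicCurl_eq_zero hU hP hp

end IsPoisson

end HydroBracket

end JetOfPoisson

/-! ### Functionals of hydrodynamic type -/

section Densities

open MeasureTheory

variable {N : ℕ} {V : Set (Fin N → ℝ)}

/-- The components `L (∂/∂u^i)` of a linear form on `ℝ^N`. -/
noncomputable def components {N : ℕ} : ((Fin N → ℝ) →L[ℝ] ℝ) →L[ℝ] (Fin N → ℝ) :=
  ContinuousLinearMap.pi fun i => ContinuousLinearMap.apply ℝ ℝ (Pi.single i 1)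

theorem coordPairing_components (L : (Fin N → ℝ) →L[ℝ] ℝ) (v : Fin N → ℝ) :
    ⟪components L, v⟫ = L v := by
  conv_rhs => rw [pi_eq_sum_univ' v, map_sum]
  rw [coordPairing_apply]
  exact Finset.sum_congr rfl fun i _ => by rw [map_smul, smul_eq_mul, mul_comm]; rfl

theorem components_coordPairing (ξ : Fin N → ℝ) : components (coordPairing ξ) = ξ := by
  funext i
  change ⟪ξ, Pi.single i 1⟫ = ξ i
  simp [coordPairing_apply, Pi.single_apply]

/-- The covector field `∂f/∂u^i`. -/
noncomputable def gradCovector (f : (Fin N → ℝ) → ℝ) (p : Fin N → ℝ) : Fin N → ℝ :=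
  components (fderiv ℝ f p)

theorem densityDeriv_eq (f : (Fin N → ℝ) → ℝ) (u : ℝ → Fin N → ℝ) :
    densityDeriv f u = fun x => gradCovector f (u x) := rfl

/-- A closed smooth 1-form on `V`, given by its covector of components. -/
structure IsClosedForm (V : Set (Fin N → ℝ)) (θ : (Fin N → ℝ) → Fin N → ℝ) : Prop where
  smooth : ContDiffOn ℝ ∞ θ V
  symm : ∀ p ∈ V, ∀ v w, ⟪fderiv ℝ θ p v, w⟫ = ⟪fderiv ℝ θ p w, v⟫

theorem isClosedForm_gradCovector (hV : IsOpen V) {f : (Fin N → ℝ) → ℝ} (hf : ContDiffOn ℝ ∞ f V) :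
    IsClosedForm V (gradCovector f) := by
  have hf' : ContDiffOn ℝ ∞ (fderiv ℝ f) V := hf.fderiv_of_isOpen hV (by simp)
  refine ⟨components.contDiff.comp_contDiffOn hf', fun p hp v w => ?_⟩
  have hpV := hV.mem_nhds hp
  have hgrad : HasFDerivAt (gradCovector f) (components.comp (fderiv ℝ (fderiv ℝ f) p)) p :=
    components.hasFDerivAt.comp p
      ((hf'.contDiffAt hpV).differentiableAt (by simp)).hasFDerivAt
  simp only [hgrad.fderiv, ContinuousLinearMap.comp_apply, coordPairing_components]
  exact ((hf.contDiffAt hpV).isSymmSndFDerivAt (by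
    simpa using WithTop.coe_le_coe.2 (le_top (a := (2 : ℕ∞))))).eq v w

namespace IsClosedForm

variable {θ κ : (Fin N → ℝ) → Fin N → ℝ} {u : ℝ → Fin N → ℝ}

theorem continuousOn_fderiv (hθ : IsClosedForm V θ) (hV : IsOpen V) :
    ContinuousOn (fderiv ℝ θ) V :=
  (hθ.smooth.fderiv_of_isOpen hV (m := ∞) (by simp)).continuousOn

theorem deriv_comp (hθ : IsClosedForm V θ) (hV : IsOpen V) {c : ℝ → Fin N → ℝ} {x : ℝ}
    (hc : DifferentiableAt ℝ c x) (hx : c x ∈ V) :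
    deriv (fun x => θ (c x)) x = fderiv ℝ θ (c x) (deriv c x) :=
  (((hθ.smooth.contDiffAt (hV.mem_nhds hx)).differentiableAt (by simp)).hasFDerivAt.comp_hasDerivAt
    x hc.hasDerivAt).deriv

theorem isHydroField_comp (hθ : IsClosedForm V θ) (hu : IsHydroField V u) :
    IsHydroField Set.univ fun x => θ (u x) := by
  obtain ⟨c, R, hR⟩ := hu.const_at_infinity
  exact ⟨hθ.smooth.comp_contDiff hu.smooth hu.mem, fun _ => Set.mem_univ _, θ c, R,
    fun x hx => by rw [hR x hx]⟩

theorem isSmoothFamily_comp (hθ : IsClosedForm V θ) {R : ℝ} {w : ℝ → ℝ → Fin N → ℝ}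
    (hw : IsFieldFamily V R w) : IsSmoothFamily R fun s x => θ (w s x) where
  smooth := hθ.smooth.comp_contDiff hw.smooth fun q => hw.mem q.1 q.2
  const_at_infinity s x hx := by rw [hw.const_at_infinity s x hx]

end IsClosedForm

theorem HydroJet.coordPairing_opAt_sub_add_variationDensity {X : HydroJet N} (hX : X.IsSymm)
    {S T : (Fin N → ℝ) →L[ℝ] (Fin N → ℝ)} (hS : ∀ v w, ⟪S v, w⟫ = ⟪S w, v⟫)
    (hT : ∀ v w, ⟪T v, w⟫ = ⟪T w, v⟫) (ξ η w v : Fin N → ℝ) (x y : ℝ) :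
    ⟪S w, X.opAt v η (T v) y⟫ - ⟪T w, X.opAt v ξ (S v) x⟫
      + X.variationDensity v ξ (S v) x η (T v) y w = X.involutionCurl ξ S η T w v := by
  simp only [opAt, variationDensity, involutionCurl, map_add, map_smul, smul_eq_mul, hS w v,
    hT w v, hX (T w) (S v)]
  ring

namespace HydroBracket

variable {P : HydroBracket N} {θ κ : (Fin N → ℝ) → Fin N → ℝ} {u : ℝ → Fin N → ℝ}

/-- The 2-form whose vanishing expresses that the functionals of hydrodynamic type whose densities
have the differentials `θ` and `κ` are in involution. -/
noncomputable def involutionForm (P : HydroBracket N) (θ κ : (Fin N → ℝ) → Fin N → ℝ)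
    (p w v : Fin N → ℝ) : ℝ :=
  (P.jet p).involutionCurl (θ p) (fderiv ℝ θ p) (κ p) (fderiv ℝ κ p) w v

theorem continuousOn_involutionForm (hV : IsOpen V) (hP : P.SmoothOn V) (hθ : IsClosedForm V θ)
    (hκ : IsClosedForm V κ) (w v : Fin N → ℝ) :
    ContinuousOn (fun p => P.involutionForm θ κ p w v) V := by
  have hg := hP.contDiffOn_gL.continuousOn
  have hb := hP.contDiffOn_bL.continuousOn
  have hb' := (hP.contDiffOn_fderiv_bL hV).continuousOn
  have hθ₀ := hθ.smooth.continuousOn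
  have hκ₀ := hκ.smooth.continuousOn
  have hθ' := hθ.continuousOn_fderiv hV
  have hκ' := hκ.continuousOn_fderiv hV
  simp only [involutionForm, HydroJet.involutionCurl, HydroJet.curl, jet]
  fun_prop

theorem hasDerivAt_pairing_comp (hV : IsOpen V) (hP : P.SmoothOn V)
    (hG : ∀ p ∈ V, (P.jet p).IsSymm) (hPm : P.IsMetric V)
    (hθ : IsClosedForm V θ) (hκ : IsClosedForm V κ) {w : ℝ → ℝ → Fin N → ℝ} {R : ℝ}
    (hw : IsFieldFamily V R w) (s₀ : ℝ) :
    HasDerivAt (fun s => P.pairing (w s) (fun x => θ (w s x)) (fun x => κ (w s x)))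
      (∫ x, P.involutionForm θ κ (w s₀ x) (deriv (fun s => w s x) s₀) (deriv (w s₀) x)) s₀ := by
  have hu := hw.isHydroField s₀
  have hθw := hθ.isSmoothFamily_comp hw
  have hκw := hκ.isSmoothFamily_comp hw
  have hθu := hθ.isHydroField_comp hu
  have hκu := hκ.isHydroField_comp hu
  have hθdot := hθw.deriv_param.isHydroField s₀
  have hκdot := hκw.deriv_param.isHydroField s₀
  have hleft := integrable_pairing hP hu hθdot.smooth.continuous hκu
  have hright := integrable_pairing hP hu hκdot.smooth.continuous hθu
  refine (hasDerivAt_pairing hV hP hPm hw hθw.smooth hκw s₀).congr_deriv ?_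
  rw [pairing_eq_neg_pairing hV hP hG hPm hu hθu hκdot, ← sub_eq_add_neg, pairing_eq_integral,
    pairing_eq_integral, fieldVariation, ← integral_sub' hleft hright,
    ← integral_add (hleft.sub hright) (integrable_variationDensity hV hP hu hθu.smooth hκu.smooth
      (hw.deriv_param.isHydroField s₀).smooth.continuous
      fun x hx => hw.deriv_param_eq_zero s₀ hx)]
  refine congrArg (integral _) (funext fun x => ?_)
  have hx := hw.mem s₀ x
  rw [Pi.sub_apply]
  have hdiff := (hasDerivAt_param hw.smooth s₀ x).differentiableAt
  have hdiff' : DifferentiableAt ℝ (w s₀) x := hu.smooth.differentiable (by simp) x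
  rw [op_eq hu hθu.smooth.continuous, op_eq hu hκu.smooth.continuous,
    hθ.deriv_comp hV hdiff hx, hκ.deriv_comp hV hdiff hx,
    hθ.deriv_comp hV hdiff' hx, hκ.deriv_comp hV hdiff' hx]
  exact HydroJet.coordPairing_opAt_sub_add_variationDensity (hG _ hx) (hθ.symm _ hx)
    (hκ.symm _ hx) _ _ _ _ _ _

theorem pairing_comp_eq_zero (hV : IsOpen V) (hVc : Convex ℝ V) (hP : P.SmoothOn V)
    (hG : ∀ p ∈ V, (P.jet p).IsSymm) (hPm : P.IsMetric V)
    (hθ : IsClosedForm V θ) (hκ : IsClosedForm V κ)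
    (h : ∀ p ∈ V, ∀ w v, P.involutionForm θ κ p w v = 0) (hu : IsHydroField V u) :
    P.pairing u (fun x => θ (u x)) (fun x => κ (u x)) = 0 := by
  obtain ⟨c, R, -, hR⟩ := hu.exists_radius
  have hc : c ∈ V := (hR R (le_abs_self R)).1 ▸ hu.mem R
  -- The field is contracted to a constant one within `V`.
  set w : ℝ → ℝ → Fin N → ℝ := fun s x => c + (Real.sin s ^ 2) • (u x - c) with hw_def
  have hconst (s x : ℝ) (hx : R ≤ |x|) : w s x = c := by simp [hw_def, (hR x hx).1]
  have hw : IsFieldFamily V R w :=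
    ⟨⟨contDiff_const.add (((Real.contDiff_sin.comp contDiff_fst).pow 2).smul
        ((hu.smooth.comp contDiff_snd).sub contDiff_const)),
      fun s x hx => (hconst s x hx).trans (hconst s R (le_abs_self R)).symm⟩,
      fun s x => hVc.add_smul_sub_mem hc (hu.mem x) ⟨sq_nonneg _, Real.sin_sq_le_one s⟩,
      fun s => (hconst s R (le_abs_self R)).trans (hconst 0 R (le_abs_self R)).symm⟩
  have hderiv (s : ℝ) := hasDerivAt_pairing_comp hV hP hG hPm hθ hκ hw s
  simp only [h _ (hw.mem _ _), integral_zero] at hderiv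
  have hend : w (Real.pi / 2) = u := funext fun x => by simp [hw_def]
  have hstart : w 0 = fun _ => c := funext fun x => by simp [hw_def]
  have heq := is_const_of_deriv_eq_zero (fun s => (hderiv s).differentiableAt)
    (fun s => (hderiv s).deriv) (Real.pi / 2) 0
  simp only [hend, hstart] at heq
  simp only [heq, pairing_const hc continuous_const, deriv_const, map_zero, integral_zero]

theorem integral_involutionForm_eq_zero (hV : IsOpen V) (hP : P.SmoothOn V)
    (hG : ∀ p ∈ V, (P.jet p).IsSymm) (hPm : P.IsMetric V)
    (hθ : IsClosedForm V θ) (hκ : IsClosedForm V κ)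
    (h : ∀ u, IsHydroField V u → P.pairing u (fun x => θ (u x)) (fun x => κ (u x)) = 0)
    (hu : IsHydroField V u) {w : ℝ → Fin N → ℝ} (hw : ContDiff ℝ ∞ w) {R : ℝ}
    (hR : ∀ x, R ≤ |x| → w x = 0) :
    ∫ x, P.involutionForm θ κ (u x) (w x) (deriv u x) = 0 := by
  obtain ⟨τ, R', hτ, hfam⟩ := hu.exists_isFieldFamily hV hw hR
  have hderiv := hasDerivAt_pairing_comp hV hP hG hPm hθ hκ hfam 0
  simp only [fun s => h _ (hfam.isHydroField s)] at hderiv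
  have hvariation (x : ℝ) : deriv (fun s => (u + τ s • w) x) 0 = w x := by
    simpa using ((hτ.hasDerivAt_zero.smul_const (w x)).const_add (u x)).deriv
  have hzero := hderiv.unique (hasDerivAt_const (0 : ℝ) (0 : ℝ))
  simp only [hvariation] at hzero
  simpa only [hτ.map_zero, zero_smul, add_zero] using hzero

theorem involutionForm_eq_zero (hV : IsOpen V) (hP : P.SmoothOn V)
    (hG : ∀ p ∈ V, (P.jet p).IsSymm) (hPm : P.IsMetric V)
    (hθ : IsClosedForm V θ) (hκ : IsClosedForm V κ)
    (h : ∀ u, IsHydroField V u → P.pairing u (fun x => θ (u x)) (fun x => κ (u x)) = 0)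
    {p : Fin N → ℝ} (hp : p ∈ V) (w v : Fin N → ℝ) : P.involutionForm θ κ p w v = 0 := by
  obtain ⟨φ, hφ⟩ := exists_isBump
  refine hφ.eq_zero_of_testField hV hp v (continuousOn_involutionForm hV hP hθ hκ w v)
    fun e he hu => (mul_eq_zero.1 ?_).resolve_left he
  rw [← integral_const_mul, ← integral_involutionForm_eq_zero hV hP hG hPm hθ hκ h hu
    (hφ.isHydroField_deriv_smul w).smooth (R := 2 + 1) fun x hx => by
      rw [hφ.deriv_eq_zero x hx, zero_smul]]
  refine congrArg (integral _) (funext fun x => ?_)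
  simp only [hφ.deriv_testField, involutionForm, HydroJet.involutionCurl, HydroJet.curl, map_smul,
    smul_apply, smul_eq_mul]
  ring

theorem op_comp (hV : IsOpen V) (hK : P.K = 0) (hθ : IsClosedForm V θ)
    (hu : IsHydroField V u) (x : ℝ) :
    P.op u (fun x => θ (u x)) x
      = P.gL (u x) (fderiv ℝ θ (u x) (deriv u x)) + P.bL (u x) (deriv u x) (θ (u x)) := by
  rw [op_eq hu (hθ.isHydroField_comp hu).smooth.continuous,
    hθ.deriv_comp hV (hu.smooth.differentiable (by simp) x) (hu.mem x)]
  simp only [HydroJet.opAt, jet, hK, zero_mul, zero_smul, add_zero]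

theorem gL_fderiv_add_bL_eq_smul (hV : IsOpen V) (hP : P.SmoothOn V) (hK : P.K = 0)
    (hθ : IsClosedForm V θ) (k : ℝ)
    (h : ∀ u, IsHydroField V u → ∀ ξ, IsHydroField Set.univ ξ →
      ∫ x, ⟪ξ x, P.op u (fun x => θ (u x)) x - k • deriv u x⟫ = 0)
    {p : Fin N → ℝ} (hp : p ∈ V) (v : Fin N → ℝ) :
    P.gL p (fderiv ℝ θ p v) + P.bL p v (θ p) = k • v := by
  obtain ⟨φ, hφ⟩ := exists_isBump
  have hg := hP.contDiffOn_gL.continuousOn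
  have hb := hP.contDiffOn_bL.continuousOn
  have hθ₀ := hθ.smooth.continuousOn
  have hθ' := hθ.continuousOn_fderiv hV
  refine sub_eq_zero.1 (eq_of_forall_coordPairing fun a => ?_)
  rw [map_zero]
  refine hφ.eq_zero_of_testField hV hp v
    (Q := fun p => ⟪a, P.gL p (fderiv ℝ θ p v) + P.bL p v (θ p) - k • v⟫) (by fun_prop)
    fun e he hu => (mul_eq_zero.1 ?_).resolve_left he
  rw [← integral_const_mul, ← h _ hu _ (hφ.isHydroField_deriv_smul a)]
  refine congrArg (integral _) (funext fun x => ?_)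
  simp only [op_comp hV hK hθ hu, hφ.deriv_testField, map_add, map_sub, map_smul, smul_apply,
    smul_eq_mul]
  ring

end HydroBracket

end Densities

/-! ### Involution and compatibility -/

namespace HydroJet

variable {N : ℕ} {X Y : HydroJet N} {H : (Fin N → ℝ) →L[ℝ] (Fin N → ℝ)} {ι : Type*}
  {θ : ι → Fin N → ℝ}

theorem involutionCurl_add_right (X : HydroJet N) (ξ η₁ η₂ : Fin N → ℝ)
    (S T₁ T₂ : (Fin N → ℝ) →L[ℝ] (Fin N → ℝ)) (w v : Fin N → ℝ) :
    X.involutionCurl ξ S (η₁ + η₂) (T₁ + T₂) w v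
      = X.involutionCurl ξ S η₁ T₁ w v + X.involutionCurl ξ S η₂ T₂ w v := by
  simp only [involutionCurl, curl, map_add, add_apply]
  ring

theorem involutionCurl_parallel_left_eq_zero (hθ : Submodule.span ℝ (Set.range θ) = ⊤)
    {η : Fin N → ℝ} {T : (Fin N → ℝ) →L[ℝ] (Fin N → ℝ)} {w v : Fin N → ℝ}
    (h : ∀ a, X.involutionCurl (θ a) (Y.parallel H (θ a)) η T w v = 0) (ξ : Fin N → ℝ) :
    X.involutionCurl ξ (Y.parallel H ξ) η T w v = 0 := by
  let L : (Fin N → ℝ) →ₗ[ℝ] ℝ :=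
    { toFun := fun ξ => X.involutionCurl ξ (Y.parallel H ξ) η T w v
      map_add' := fun ξ ξ' => by simp only [involutionCurl, curl, map_add, add_apply]; ring
      map_smul' := fun c ξ => by
        simp only [involutionCurl, curl, map_smul, smul_apply, smul_eq_mul, RingHom.id_apply]
        ring }
  exact LinearMap.congr_fun (LinearMap.ext_on_range hθ h : L = 0) ξ

theorem involutionCurl_parallel_right_eq_zero (hθ : Submodule.span ℝ (Set.range θ) = ⊤)
    {ξ : Fin N → ℝ} {S : (Fin N → ℝ) →L[ℝ] (Fin N → ℝ)} {w v : Fin N → ℝ}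
    (h : ∀ a, X.involutionCurl ξ S (θ a) (Y.parallel H (θ a)) w v = 0) (η : Fin N → ℝ) :
    X.involutionCurl ξ S η (Y.parallel H η) w v = 0 := by
  let L : (Fin N → ℝ) →ₗ[ℝ] ℝ :=
    { toFun := fun η => X.involutionCurl ξ S η (Y.parallel H η) w v
      map_add' := fun η η' => by rw [map_add, involutionCurl_add_right]
      map_smul' := fun c η => by
        simp only [involutionCurl, curl, map_smul, smul_apply, smul_eq_mul, RingHom.id_apply]
        ring }
  exact LinearMap.congr_fun (LinearMap.ext_on_range hθ h : L = 0) η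

theorem compatible_iff (hGH : ∀ v, Y.G (H v) = v) (hHG : ∀ v, H (Y.G v) = v) (hY : Y.IsPoisson)
    (hX : X.IsSymm) :
    Compatible X Y ↔
      (∀ ξ η w v, X.involutionCurl ξ (Y.parallel H ξ) η (Y.parallel H η) w v = 0) ∧
        ∀ ξ w v, X.involutionCurl ξ (Y.parallel H ξ) 0 H w v = 0 := by
  refine ⟨fun h => ⟨fun ξ η w v => ?_, fun ξ w v => ?_⟩, fun ⟨hparallel, hinverse⟩ => ?_⟩
  · have hcurv := h.curvature v ξ η (H w)
    rwa [curvature_add_curvature_eq hGH hY hX h.torsion, hGH] at hcurv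
  · have htor := h.torsion ξ (H w) (H v)
    rwa [torsion_add_torsion_eq hGH hHG hY, hGH, hGH, neg_eq_zero] at htor
  · have htor (ξ η ζ : Fin N → ℝ) : X.torsion Y ξ η ζ + Y.torsion X ξ η ζ = 0 := by
      rw [torsion_add_torsion_eq hGH hHG hY, hinverse, neg_zero]
    have hcurv (v ξ η ζ : Fin N → ℝ) : X.curvature Y v ξ η ζ + Y.curvature X v ξ η ζ = 0 := by
      rw [curvature_add_curvature_eq hGH hY hX htor, hparallel]
    exact ⟨htor, hcurv, cyclicCurl_add_cyclicCurl_eq_zero hGH hY hX htor hcurv⟩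

/-- The differentials `θ a` and `μ` of annihilators and a momentum at a point, with their
derivatives `S a` and `M`. -/
structure IsFrame (Y : HydroJet N) (θ : ι → Fin N → ℝ)
    (S : ι → (Fin N → ℝ) →L[ℝ] (Fin N → ℝ)) (μ : Fin N → ℝ)
    (M : (Fin N → ℝ) →L[ℝ] (Fin N → ℝ)) : Prop where
  span : Submodule.span ℝ (Set.range θ) = ⊤
  annihilator : ∀ a v, Y.G (S a v) + Y.B v (θ a) = 0
  momentum : ∀ v, Y.G (M v) + Y.B v μ = v

namespace IsFrame

variable {S : ι → (Fin N → ℝ) →L[ℝ] (Fin N → ℝ)} {μ : Fin N → ℝ}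
  {M : (Fin N → ℝ) →L[ℝ] (Fin N → ℝ)}

theorem exists_inverse (h : Y.IsFrame θ S μ M) :
    ∃ H : (Fin N → ℝ) →L[ℝ] (Fin N → ℝ), (∀ v, Y.G (H v) = v) ∧ ∀ v, H (Y.G v) = v := by
  -- By the annihilators, `G` divides `B · ξ` for every `ξ`; for `ξ = μ` it therefore divides `1`.
  let W : Submodule ℝ (Fin N → ℝ) :=
    (LinearMap.range (ContinuousLinearMap.compL ℝ (Fin N → ℝ) (Fin N → ℝ) (Fin N → ℝ)
      Y.G).toLinearMap).comap Y.B.flip.toLinearMap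
  have hW : ⊤ ≤ W := h.span ▸ Submodule.span_le.2 (Set.range_subset_iff.2 fun a =>
    ⟨-S a, by ext1 v; simpa using neg_eq_of_add_eq_zero_right (h.annihilator a v)⟩)
  obtain ⟨T, hT⟩ := hW (Submodule.mem_top : μ ∈ ⊤)
  have hright (v : Fin N → ℝ) : Y.G ((M + T) v) = v := by
    have hTv : Y.G (T v) = Y.B v μ := DFunLike.congr_fun hT v
    rw [add_apply, map_add, hTv, h.momentum]
  have hmul : Y.G.toLinearMap * (M + T).toLinearMap = 1 := LinearMap.ext hright
  exact ⟨M + T, hright, LinearMap.congr_fun (mul_eq_one_comm.1 hmul)⟩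

theorem eq_parallel (h : Y.IsFrame θ S μ M) (hHG : ∀ v, H (Y.G v) = v) (a : ι) :
    S a = Y.parallel H (θ a) := by
  ext1 v
  rw [parallel_apply, ← hHG (S a v), eq_neg_of_add_eq_zero_left (h.annihilator a v), map_neg]

theorem eq_parallel_add (h : Y.IsFrame θ S μ M) (hHG : ∀ v, H (Y.G v) = v) :
    M = Y.parallel H μ + H := by
  ext1 v
  rw [add_apply, parallel_apply, ← hHG (M v), eq_sub_of_add_eq (h.momentum v), map_sub]
  abel

theorem compatible_iff (h : Y.IsFrame θ S μ M) (hY : Y.IsPoisson) (hX : X.IsSymm) :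
    Compatible X Y ↔ (∀ a b w v, X.involutionCurl (θ a) (S a) (θ b) (S b) w v = 0) ∧
      ∀ a w v, X.involutionCurl (θ a) (S a) μ M w v = 0 := by
  obtain ⟨H, hGH, hHG⟩ := h.exists_inverse
  have hsplit (ξ : Fin N → ℝ) (S : (Fin N → ℝ) →L[ℝ] (Fin N → ℝ)) (w v : Fin N → ℝ) :
      X.involutionCurl ξ S μ M w v
        = X.involutionCurl ξ S μ (Y.parallel H μ) w v + X.involutionCurl ξ S 0 H w v := by
    rw [← involutionCurl_add_right, add_zero, h.eq_parallel_add hHG]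
  rw [HydroJet.compatible_iff hGH hHG hY hX]
  simp only [h.eq_parallel hHG, hsplit]
  refine ⟨fun ⟨hparallel, hinverse⟩ => ⟨fun a b => hparallel _ _, fun a w v => by
    rw [hparallel, hinverse, add_zero]⟩, fun ⟨hann, hmom⟩ => ?_⟩
  have hparallel (ξ η w v : Fin N → ℝ) :
      X.involutionCurl ξ (Y.parallel H ξ) η (Y.parallel H η) w v = 0 :=
    involutionCurl_parallel_left_eq_zero h.span
      (fun a => involutionCurl_parallel_right_eq_zero h.span (fun b => hann a b w v) η) ξ
  refine ⟨hparallel, fun ξ w v => involutionCurl_parallel_left_eq_zero h.span (fun a => ?_) ξ⟩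
  simpa only [hparallel, zero_add] using hmom a w v

end IsFrame

end HydroJet

namespace HydroBracket

variable {N : ℕ} {V U : Set (Fin N → ℝ)} {P Q : HydroBracket N} {f : (Fin N → ℝ) → ℝ}

theorem isAnnihilator_iff (hV : IsOpen V) (hQ : Q.SmoothOn V) (hG : ∀ p ∈ V, (Q.jet p).IsSymm)
    (hQm : Q.IsMetric V) (hK : Q.K = 0) (hf : ContDiffOn ℝ ∞ f V) :
    Q.IsAnnihilator V f ↔ ∀ p ∈ V, ∀ v,
      Q.gL p (fderiv ℝ (gradCovector f) p v) + Q.bL p v (gradCovector f p) = 0 := by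
  have hθ := isClosedForm_gradCovector hV hf
  refine ⟨fun h p hp v => ?_, fun h J u hu => ?_⟩
  · rw [gL_fderiv_add_bL_eq_smul hV hQ hK hθ 0 (fun u hu ξ hξ => ?_) hp v, zero_smul]
    simp only [zero_smul, sub_zero]
    rw [← pairing_eq_integral, pairing_eq_neg_pairing hV hQ hG hQm hu hξ (hθ.isHydroField_comp hu),
      neg_eq_zero]
    exact h (linFunctional V ξ hξ) u hu
  · rw [densityDeriv_eq, pairing_eq_neg_pairing hV hQ hG hQm hu (hθ.isHydroField_comp hu)
      (J.isHydroField_varDeriv hu), pairing_eq_integral]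
    simp [op_comp hV hK hθ hu, h _ (hu.mem _)]

theorem isMomentum_iff (hV : IsOpen V) (hQ : Q.SmoothOn V) (hK : Q.K = 0)
    (hf : ContDiffOn ℝ ∞ f V) :
    Q.IsMomentum V f ↔ ∀ p ∈ V, ∀ v,
      Q.gL p (fderiv ℝ (gradCovector f) p v) + Q.bL p v (gradCovector f p) = v := by
  have hθ := isClosedForm_gradCovector hV hf
  refine ⟨fun h p hp v => ?_, fun h u hu => funext fun x => ?_⟩
  · rw [gL_fderiv_add_bL_eq_smul hV hQ hK hθ 1 (fun u hu ξ _ => ?_) hp v, one_smul]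
    simp [← densityDeriv_eq, h u hu]
  · rw [densityDeriv_eq, op_comp hV hK hθ hu, h _ (hu.mem x)]

theorem IsAnnihilatorsAndMomentum.isFrame (hV : IsOpen V) (hQ : Q.SmoothOn V)
    (hG : ∀ p ∈ V, (Q.jet p).IsSymm) (hQm : Q.IsMetric V) (hK : Q.K = 0)
    {n : Fin N → (Fin N → ℝ) → ℝ} {m : (Fin N → ℝ) → ℝ} (h : Q.IsAnnihilatorsAndMomentum V n m)
    {p : Fin N → ℝ} (hp : p ∈ V) :
    (Q.jet p).IsFrame (fun i => gradCovector (n i) p) (fun i => fderiv ℝ (gradCovector (n i)) p)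
      (gradCovector m p) (fderiv ℝ (gradCovector m) p) where
  span := by
    have hinj : Function.Injective (components (N := N)) := fun L L' hL => by
      ext1 v
      rw [← coordPairing_components, hL, coordPairing_components]
    have hindep : LinearIndependent ℝ fun i => gradCovector (n i) p :=
      (h.independent p hp).map' components.toLinearMap (LinearMap.ker_eq_bot_of_injective hinj)
    exact hindep.span_eq_top_of_card_eq_finrank' (by simp)
  annihilator i := (isAnnihilator_iff hV hQ hG hQm hK (h.smooth_annihilator i)).1
    (h.annihilator i) p hp
  momentum := (isMomentum_iff hV hQ hK h.smooth_momentum).1 h.momentum p hp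

theorem pairing_gradCovector_eq_zero_iff (hV : IsOpen V) (hVc : Convex ℝ V) (hP : P.SmoothOn V)
    (hG : ∀ p ∈ V, (P.jet p).IsSymm) (hPm : P.IsMetric V) {f h : (Fin N → ℝ) → ℝ}
    (hf : ContDiffOn ℝ ∞ f V) (hh : ContDiffOn ℝ ∞ h V) :
    (∀ u, IsHydroField V u → P.pairing u (densityDeriv f u) (densityDeriv h u) = 0) ↔
      ∀ p ∈ V, ∀ w v, P.involutionForm (gradCovector f) (gradCovector h) p w v = 0 := by
  have hθ := isClosedForm_gradCovector hV hf
  have hκ := isClosedForm_gradCovector hV hh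
  simp only [densityDeriv_eq]
  exact ⟨fun h0 p hp w v => involutionForm_eq_zero hV hP hG hPm hθ hκ h0 hp w v,
    fun h0 u hu => pairing_comp_eq_zero hV hVc hP hG hPm hθ hκ h0 hu⟩

theorem annihilatorsAndMomentumInInvolution_iff (hV : IsOpen V) (hP : P.SmoothOn V)
    (hG : ∀ p ∈ V, (P.jet p).IsSymm) (hPm : P.IsMetric V)
    {n : Fin N → (Fin N → ℝ) → ℝ} {m : (Fin N → ℝ) → ℝ}
    (hn : ∀ i, ContDiffOn ℝ ∞ (n i) V) (hm : ContDiffOn ℝ ∞ m V) :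
    P.AnnihilatorsAndMomentumInInvolution V n m ↔
      (∀ i j u, IsHydroField V u →
        P.pairing u (densityDeriv (n i) u) (densityDeriv (n j) u) = 0) ∧
      ∀ i u, IsHydroField V u → P.pairing u (densityDeriv (n i) u) (densityDeriv m u) = 0 := by
  have hskew {f h : (Fin N → ℝ) → ℝ} (hf : ContDiffOn ℝ ∞ f V) (hh : ContDiffOn ℝ ∞ h V)
      {u : ℝ → Fin N → ℝ} (hu : IsHydroField V u) :
      P.pairing u (densityDeriv f u) (densityDeriv h u)
        = -P.pairing u (densityDeriv h u) (densityDeriv f u) :=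
    pairing_eq_neg_pairing hV hP hG hPm hu ((isClosedForm_gradCovector hV hf).isHydroField_comp hu)
      ((isClosedForm_gradCovector hV hh).isHydroField_comp hu)
  refine ⟨fun h => ⟨fun i j => h (some i) (some j), fun i => h (some i) none⟩, ?_⟩
  rintro ⟨hnn, hnm⟩ (_ | i) (_ | j) u hu
  · exact self_eq_neg.1 (hskew hm hm hu)
  · exact (hskew hm (hn j) hu).trans (by rw [hnm j u hu, neg_zero])
  · exact hnm i u hu
  · exact hnn i j u hu

theorem IsAnnihilatorsAndMomentum.inInvolution_iff (hV : IsOpen V) (hVc : Convex ℝ V)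
    (hP : P.SmoothOn V) (hG : ∀ p ∈ V, (P.jet p).IsSymm) (hPm : P.IsMetric V)
    (hQ : Q.SmoothOn V) (hQm : Q.IsMetric V) (hQj : ∀ p ∈ V, (Q.jet p).IsPoisson) (hK : Q.K = 0)
    {n : Fin N → (Fin N → ℝ) → ℝ} {m : (Fin N → ℝ) → ℝ} (h : Q.IsAnnihilatorsAndMomentum V n m) :
    P.AnnihilatorsAndMomentumInInvolution V n m ↔
      ∀ p ∈ V, HydroJet.Compatible (P.jet p) (Q.jet p) := by
  have hn := h.smooth_annihilator
  have hcompatible (p : Fin N → ℝ) (hp : p ∈ V) :=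
    (h.isFrame hV hQ (fun p hp => (hQj p hp).symm) hQm hK hp).compatible_iff (hQj p hp) (hG p hp)
  rw [annihilatorsAndMomentumInInvolution_iff hV hP hG hPm hn h.smooth_momentum,
    forall₂_congr fun i j => pairing_gradCovector_eq_zero_iff hV hVc hP hG hPm (hn i) (hn j),
    forall_congr' fun i =>
      pairing_gradCovector_eq_zero_iff hV hVc hP hG hPm (hn i) h.smooth_momentum,
    forall₂_congr hcompatible]
  exact ⟨fun ⟨hnn, hnm⟩ p hp => ⟨fun i j => hnn i j p hp, fun i => hnm i p hp⟩,
    fun hc => ⟨fun i j p hp => (hc p hp).1 i j, fun i p hp => (hc p hp).2 i⟩⟩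

/-! ### Linear combinations of brackets -/

theorem gL_linComb (α β : ℝ) : (linComb α P β Q).gL = fun p => α • P.gL p + β • Q.gL p := by
  funext p
  refine ContinuousLinearMap.ext fun ξ => funext fun i => ?_
  simp only [gL_apply, linComb, add_apply, smul_apply, Pi.add_apply, Pi.smul_apply, smul_eq_mul,
    Finset.mul_sum, ← Finset.sum_add_distrib]
  exact Finset.sum_congr rfl fun j _ => by ring

theorem bL_linComb (α β : ℝ) : (linComb α P β Q).bL = fun p => α • P.bL p + β • Q.bL p := by
  funext p
  refine ContinuousLinearMap.ext fun v => ContinuousLinearMap.ext fun ξ => funext fun i => ?_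
  simp only [bL_apply, linComb, add_apply, smul_apply, Pi.add_apply, Pi.smul_apply, smul_eq_mul,
    Finset.mul_sum, ← Finset.sum_add_distrib]
  exact Finset.sum_congr rfl fun j _ => Finset.sum_congr rfl fun k _ => by ring

theorem SmoothOn.linComb (hP : P.SmoothOn U) (hQ : Q.SmoothOn U) (α β : ℝ) :
    (linComb α P β Q).SmoothOn U :=
  ⟨fun i j => (contDiffOn_const.mul (hP.1 i j)).add (contDiffOn_const.mul (hQ.1 i j)),
    fun i j k => (contDiffOn_const.mul (hP.2 i j k)).add (contDiffOn_const.mul (hQ.2 i j k))⟩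

theorem jet_linComb (hU : IsOpen U) (hP : P.SmoothOn U) (hQ : Q.SmoothOn U) (α β : ℝ)
    {p : Fin N → ℝ} (hp : p ∈ U) :
    (linComb α P β Q).jet p = HydroJet.linComb α (P.jet p) β (Q.jet p) := by
  have hderiv :=
    ((hP.hasFDerivAt_bL hU hp).const_smul α).add ((hQ.hasFDerivAt_bL hU hp).const_smul β)
  rw [jet, HydroJet.linComb, HydroJet.mk.injEq]
  refine ⟨congrFun (gL_linComb α β) p, congrFun (bL_linComb α β) p, ?_, rfl⟩
  rw [bL_linComb]
  exact hderiv.fderiv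

theorem IsMetric.linComb (hU : IsOpen U) (hP : P.SmoothOn U) (hQ : Q.SmoothOn U)
    (hPm : P.IsMetric U) (hQm : Q.IsMetric U) (α β : ℝ) : (linComb α P β Q).IsMetric U := by
  intro p hp h ξ η
  have hderiv :=
    ((hP.hasFDerivAt_gL hU hp).const_smul α).add ((hQ.hasFDerivAt_gL hU hp).const_smul β)
  have hfderiv : fderiv ℝ (HydroBracket.linComb α P β Q).gL p
      = α • fderiv ℝ P.gL p + β • fderiv ℝ Q.gL p := by
    rw [gL_linComb]
    exact hderiv.fderiv
  rw [hfderiv, bL_linComb]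
  simp only [add_apply, smul_apply, map_add, map_smul, smul_eq_mul, hPm p hp, hQm p hp]
  ring

theorem Compatible.jet (h : P.Compatible Q U) (hU : IsOpen U) (hP : P.SmoothOn U)
    (hQ : Q.SmoothOn U) (hPp : P.IsPoisson U) (hQp : Q.IsPoisson U) {p : Fin N → ℝ} (hp : p ∈ U) :
    HydroJet.Compatible (P.jet p) (Q.jet p) := by
  refine (hPp.jet hU hP hp).compatible (hQp.jet hU hQ hp) ?_
  rw [← jet_linComb hU hP hQ 1 1 hp]
  exact (h 1 1).jet hU (hP.linComb hQ 1 1) hp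

theorem isPoisson_jet_of_subset_closure (hU : IsOpen U) (hP : P.SmoothOn U)
    {S : Set (Fin N → ℝ)} (hS : S ⊆ U) (hUS : U ⊆ closure S)
    (h : ∀ p ∈ S, (P.jet p).IsPoisson) : ∀ p ∈ U, (P.jet p).IsPoisson := by
  have hg := hP.contDiffOn_gL.continuousOn
  have hb := hP.contDiffOn_bL.continuousOn
  have hext {k l : (Fin N → ℝ) → ℝ} (hk : ContinuousOn k U) (hl : ContinuousOn l U)
      (heq : ∀ p ∈ S, k p = l p) : ∀ p ∈ U, k p = l p :=
    Set.EqOn.of_subset_closure heq hk hl hS hUS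
  refine fun p hp => ⟨fun ξ η => ?_, fun ξ η ζ => ?_, fun v ξ η ζ => ?_, fun v ξ η ζ => ?_⟩
  · exact hext (k := fun p => ⟪ξ, P.gL p η⟫) (l := fun p => ⟪η, P.gL p ξ⟫) (by fun_prop)
      (by fun_prop) (fun p hp => (h p hp).symm ξ η) p hp
  · refine hext ?_ continuousOn_const (fun p hp => (h p hp).torsion ξ η ζ) p hp
    simp only [HydroJet.torsion, HydroBracket.jet]
    fun_prop
  · exact hext (hP.continuousOn_curvature hU v ξ η ζ) continuousOn_const
      (fun p hp => (h p hp).curvature v ξ η ζ) p hp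
  · exact hext (hP.continuousOn_cyclicCurl hU v ξ η ζ) continuousOn_const
      (fun p hp => (h p hp).cyclicCurl v ξ η ζ) p hp

theorem compatible_of_compatible_jet (hU : IsOpen U) (hP : P.SmoothOn U) (hQ : Q.SmoothOn U)
    (hPp : P.IsPoisson U) (hQp : Q.IsPoisson U) {S : Set (Fin N → ℝ)} (hS : S ⊆ U)
    (hUS : U ⊆ closure S) (h : ∀ p ∈ S, HydroJet.Compatible (P.jet p) (Q.jet p)) :
    P.Compatible Q U := by
  intro α β
  have hs := hP.linComb hQ α β
  refine isPoisson_of_jet hU hs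
    ((hPp.isMetric hU hP).linComb hU hP hQ (hQp.isMetric hU hQ) α β)
    (isPoisson_jet_of_subset_closure hU hs hS hUS fun p hp => ?_)
  rw [jet_linComb hU hP hQ α β (hS hp)]
  exact (h p hp).isPoisson_linComb (hPp.jet hU hP (hS hp)) (hQp.jet hU hQ (hS hp)) α β

end HydroBracket

/-! ### Flat linear systems -/

section FlatSystem

variable {E F : Type*} [NormedAddCommGroup E] [NormedSpace ℝ E] [NormedAddCommGroup F]
  [NormedSpace ℝ F]

theorem exists_linear_ODE_solution [CompleteSpace F] {L : ℝ → F →L[ℝ] F}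
    (hL : ContinuousOn L (Set.Icc 0 1)) (hnorm : ∀ t ∈ Set.Icc (0 : ℝ) 1, ‖L t‖ ≤ 1 / 2) (f₀ : F) :
    ∃ φ : ℝ → F, φ 0 = f₀ ∧
      ∀ t ∈ Set.Icc (0 : ℝ) 1, HasDerivWithinAt φ (L t (φ t)) (Set.Icc 0 1) t := by
  -- The solution stays in the ball of radius `‖f₀‖ + 1`, where `‖L t φ‖ ≤ (2‖f₀‖ + 1) / 2`.
  have h : IsPicardLindelof (fun t φ => L t φ) (⟨0, by simp⟩ : Set.Icc (0 : ℝ) 1) f₀ (‖f₀‖₊ + 1) 0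
      (‖f₀‖₊ + 1) 1 := by
    refine ⟨fun t ht => ?_, fun x _ => hL.clm_apply continuousOn_const, fun t ht x hx => ?_, ?_⟩
    · refine ((L t).lipschitz.weaken ?_).lipschitzOnWith
      exact_mod_cast (hnorm t ht).trans (by norm_num)
    · have hx' : ‖x‖ ≤ ‖f₀‖ + (‖f₀‖ + 1) := norm_le_of_mem_closedBall hx
      have hLx := (L t).le_of_opNorm_le (hnorm t ht) x
      push_cast
      linarith
    · simp
  exact h.exists_eq_forall_mem_Icc_hasDerivWithinAt₀

theorem norm_sub_le_of_approx_linear_ODE {L : ℝ → F →L[ℝ] F}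
    (hL : ∀ t ∈ Set.Icc (0 : ℝ) 1, ‖L t‖ ≤ 1 / 2) {φ ψ ψ' : ℝ → F} {ε : ℝ} (hε : 0 ≤ ε)
    (hφ : ∀ t ∈ Set.Icc (0 : ℝ) 1, HasDerivWithinAt φ (L t (φ t)) (Set.Icc 0 1) t)
    (hψ : ∀ t ∈ Set.Icc (0 : ℝ) 1, HasDerivWithinAt ψ (ψ' t) (Set.Icc 0 1) t)
    (hbound : ∀ t ∈ Set.Icc (0 : ℝ) 1, ‖ψ' t - L t (ψ t)‖ ≤ ε) (h0 : φ 0 = ψ 0) :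
    ‖φ 1 - ψ 1‖ ≤ 2 * ε := by
  have hIco {t : ℝ} (ht : t ∈ Set.Ico (0 : ℝ) 1) : t ∈ Set.Icc (0 : ℝ) 1 :=
    Set.Ico_subset_Icc_self ht
  have hlip (t : ℝ) (ht : t ∈ Set.Ico (0 : ℝ) 1) : LipschitzOnWith 1 (L t) Set.univ :=
    ((L t).lipschitz.weaken (by
      exact_mod_cast (hL t (hIco ht)).trans (by norm_num))).lipschitzOnWith
  have h := dist_le_of_approx_trajectories_ODE_of_mem (v := fun t x => L t x)
    (f' := fun t => L t (φ t)) (εf := 0) (δ := 0) hlip (fun t ht => (hφ t ht).continuousWithinAt)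
    (fun t ht => (hφ t (hIco ht)).mono_of_mem_nhdsWithin (Icc_mem_nhdsGE_of_mem ht))
    (fun t _ => by simp) (fun _ _ => Set.mem_univ _)
    (fun t ht => (hψ t ht).continuousWithinAt)
    (fun t ht => (hψ t (hIco ht)).mono_of_mem_nhdsWithin (Icc_mem_nhdsGE_of_mem ht))
    (fun t ht => by simpa only [dist_eq_norm] using hbound t (hIco ht))
    (fun _ _ => Set.mem_univ _) (by simp [h0]) 1 (by simp)
  rw [dist_eq_norm, NNReal.coe_one, gronwallBound_of_K_ne_0 one_ne_zero] at h
  have hexp : Real.exp 1 - 1 ≤ 2 := by linarith [Real.exp_one_lt_d9]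
  simp only [zero_mul, zero_add, div_one, sub_zero, mul_one] at h
  linarith [mul_le_mul_of_nonneg_left hexp hε]

theorem norm_image_sub_sub_le_of_lipschitzOnWith_fderiv {f : E → F} {f' : E → E →L[ℝ] F} {s : Set E}
    {K : NNReal} (hs : Convex ℝ s) (hf : ∀ x ∈ s, HasFDerivAt f (f' x) x)
    (hf' : LipschitzOnWith K f' s) {x y : E} (hx : x ∈ s) (hy : y ∈ s) :
    ‖f y - f x - f' x (y - x)‖ ≤ K * ‖y - x‖ ^ 2 := by
  have hseg : segment ℝ x y ⊆ s := hs.segment_subset hx hy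
  have h := (convex_segment (𝕜 := ℝ) x y).norm_image_sub_le_of_norm_hasFDerivWithin_le'
    (φ := f' x) (C := K * ‖y - x‖) (fun z hz => (hf z (hseg hz)).hasFDerivWithinAt)
    (fun z hz => (hf'.norm_sub_le (hseg hz) hx).trans <| by
      gcongr
      exact norm_sub_le_of_mem_segment hz)
    (left_mem_segment ℝ x y) (right_mem_segment ℝ x y)
  rwa [mul_assoc, ← sq] at h

/-- The Frobenius integrability condition on `U` of the linear system `df(v) = A(v) f`. -/
def IsFlatSystem (A : E → E →L[ℝ] F →L[ℝ] F) (U : Set E) : Prop :=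
  ∀ x ∈ U, ∀ v w f, fderiv ℝ A x v w f + A x w (A x v f) = fderiv ℝ A x w v f + A x v (A x w f)

/-- A ball on which the coefficients `A` are controlled up to second order by `C`, small enough for
the system `df(v) = A(v) f` to be solvable along every radius. -/
structure IsRadialBall (A : E → E →L[ℝ] F →L[ℝ] F) (a : E) (r C : ℝ) : Prop where
  pos : 0 < r
  le_one : r ≤ 1
  mul_le : C * r ≤ 1 / 2
  differentiableAt : ∀ x ∈ Metric.ball a r, DifferentiableAt ℝ A x
  norm_le : ∀ x ∈ Metric.ball a r, ‖A x‖ ≤ C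
  norm_sub_le : ∀ x ∈ Metric.ball a r, ∀ y ∈ Metric.ball a r, ‖A y - A x‖ ≤ C * ‖y - x‖
  norm_sub_sub_le : ∀ x ∈ Metric.ball a r, ∀ y ∈ Metric.ball a r,
    ‖A y - A x - fderiv ℝ A x (y - x)‖ ≤ C * ‖y - x‖ ^ 2

/-- `φ` solves the system `df(v) = A(v) f` along the segment from `a` to `x`, parametrized by the
unit interval. -/
def IsTransport (A : E → E →L[ℝ] F →L[ℝ] F) (a x : E) (φ : ℝ → F) : Prop :=
  ∀ t ∈ Set.Icc (0 : ℝ) 1,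
    HasDerivWithinAt φ (A (a + t • (x - a)) (x - a) (φ t)) (Set.Icc 0 1) t

variable {A : E → E →L[ℝ] F →L[ℝ] F} {a x y : E} {U : Set E} {r C : ℝ} {φ ψ : ℝ → F}

theorem exists_isRadialBall (hU : IsOpen U) (ha : a ∈ U) (hA : ContDiffOn ℝ 2 A U) :
    ∃ r C, IsRadialBall A a r C ∧ Metric.ball a r ⊆ U := by
  have hA' : ContDiffAt ℝ 1 (fderiv ℝ A) a :=
    (hA.fderiv_of_isOpen hU (by norm_num)).contDiffAt (hU.mem_nhds ha)
  obtain ⟨K, T, hT, hK⟩ := hA'.exists_lipschitzOnWith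
  have hnormA : ∀ᶠ x in 𝓝 a, ‖A x‖ < ‖A a‖ + 1 :=
    (hA.contDiffAt (hU.mem_nhds ha)).continuousAt.norm.eventually_lt_const (by linarith)
  have hnormA' : ∀ᶠ x in 𝓝 a, ‖fderiv ℝ A x‖ < ‖fderiv ℝ A a‖ + 1 :=
    hA'.continuousAt.norm.eventually_lt_const (by linarith)
  obtain ⟨ρ, hρ, hball⟩ := Metric.eventually_nhds_iff_ball.1
    (hnormA.and (hnormA'.and ((hU.eventually_mem ha).and hT)))
  obtain ⟨C, hAC, hA'C, hKC⟩ : ∃ C, ‖A a‖ + 1 ≤ C ∧ ‖fderiv ℝ A a‖ + 1 ≤ C ∧ K ≤ C :=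
    ⟨max (max (‖A a‖ + 1) (‖fderiv ℝ A a‖ + 1)) K, by simp, by simp, by simp⟩
  have hC : 1 ≤ C := by linarith [norm_nonneg (A a)]
  have hr : 0 < min ρ (1 / (2 * C)) := lt_min hρ (by positivity)
  have hmul : C * min ρ (1 / (2 * C)) ≤ 1 / 2 :=
    calc C * min ρ (1 / (2 * C)) ≤ C * (1 / (2 * C)) := by gcongr; exact min_le_right _ _
      _ = 1 / 2 := by field_simp
  have hsub : Metric.ball a (min ρ (1 / (2 * C))) ⊆ Metric.ball a ρ :=
    Metric.ball_subset_ball (min_le_left _ _)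
  have hderiv (x : E) (hx : x ∈ Metric.ball a ρ) : HasFDerivAt A (fderiv ℝ A x) x :=
    ((hA.contDiffAt (hU.mem_nhds (hball x hx).2.2.1)).differentiableAt (by simp)).hasFDerivAt
  refine ⟨_, C, ⟨hr, by nlinarith, hmul, fun x hx => (hderiv x (hsub hx)).differentiableAt,
    fun x hx => (hball x (hsub hx)).1.le.trans hAC, fun x hx y hy => ?_, fun x hx y hy => ?_⟩,
    fun x hx => (hball x (hsub hx)).2.2.1⟩
  · exact (convex_ball a ρ).norm_image_sub_le_of_norm_hasFDerivWithin_le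
      (fun x hx => (hderiv x hx).hasFDerivWithinAt)
      (fun x hx => (hball x hx).2.1.le.trans hA'C) (hsub hx) (hsub hy)
  · refine (norm_image_sub_sub_le_of_lipschitzOnWith_fderiv (convex_ball a ρ) hderiv
      (hK.mono fun x hx => (hball x hx).2.2.2) (hsub hx) (hsub hy)).trans ?_
    gcongr

namespace IsRadialBall

theorem nonneg (h : IsRadialBall A a r C) : 0 ≤ C :=
  (norm_nonneg _).trans (h.norm_le a (Metric.mem_ball_self h.pos))

theorem mem_ball (h : IsRadialBall A a r C) (hx : x ∈ Metric.ball a r) {t : ℝ}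
    (ht : t ∈ Set.Icc (0 : ℝ) 1) : a + t • (x - a) ∈ Metric.ball a r :=
  (convex_ball a r).add_smul_sub_mem (Metric.mem_ball_self h.pos) hx ht

theorem norm_apply_le (h : IsRadialBall A a r C) (hx : x ∈ Metric.ball a r) (t : ℝ)
    (ht : t ∈ Set.Icc (0 : ℝ) 1) : ‖A (a + t • (x - a)) (x - a)‖ ≤ 1 / 2 := by
  refine ((A _).le_opNorm _).trans (le_trans ?_ h.mul_le)
  gcongr
  · exact h.nonneg
  · exact h.norm_le _ (h.mem_ball hx ht)
  · exact (mem_ball_iff_norm.1 hx).le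

theorem exists_isTransport [CompleteSpace F] (h : IsRadialBall A a r C) (hx : x ∈ Metric.ball a r)
    (f₀ : F) : ∃ φ, φ 0 = f₀ ∧ IsTransport A a x φ := by
  refine exists_linear_ODE_solution (L := fun t => A (a + t • (x - a)) (x - a)) (fun t ht => ?_)
    (h.norm_apply_le hx) f₀
  have hA := (h.differentiableAt _ (h.mem_ball hx ht)).continuousAt
  exact ((hA.comp (f := fun t : ℝ => a + t • (x - a)) (by fun_prop)).clm_apply
    continuousAt_const).continuousWithinAt

theorem hasDerivWithinAt_variation (h : IsRadialBall A a r C) (hx : x ∈ Metric.ball a r)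
    (hφ : IsTransport A a x φ) (v : E) {t : ℝ} (ht : t ∈ Set.Icc (0 : ℝ) 1) :
    HasDerivWithinAt (fun t => φ t + t • A (a + t • (x - a)) v (φ t))
      (A (a + t • (x - a)) (x - a) (φ t) + (t • (fderiv ℝ A (a + t • (x - a)) (x - a) v (φ t)
        + A (a + t • (x - a)) v (A (a + t • (x - a)) (x - a) (φ t)))
        + (1 : ℝ) • A (a + t • (x - a)) v (φ t))) (Set.Icc 0 1) t := by
  have hpath : HasDerivAt (fun t : ℝ => a + t • (x - a)) (x - a) t := by
    simpa using ((hasDerivAt_id t).smul_const (x - a)).const_add a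
  have hA := (h.differentiableAt _ (h.mem_ball hx ht)).hasFDerivAt.comp_hasDerivAt t hpath
  have hAv : HasDerivAt (fun t : ℝ => A (a + t • (x - a)) v)
      (fderiv ℝ A (a + t • (x - a)) (x - a) v) t := by
    simpa using hA.clm_apply (hasDerivAt_const t v)
  exact (hφ t ht).add ((hasDerivAt_id t).hasDerivWithinAt.smul
    (hAv.hasDerivWithinAt.clm_apply (hφ t ht)))

end IsRadialBall

theorem norm_apply₂_le (M : E →L[ℝ] F →L[ℝ] F) (p : E) (q : F) {m n k : ℝ} (hM : ‖M‖ ≤ m)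
    (hp : ‖p‖ ≤ n) (hq : ‖q‖ ≤ k) : ‖M p q‖ ≤ m * n * k := by
  have hm : 0 ≤ m := (norm_nonneg M).trans hM
  have hn : 0 ≤ n := (norm_nonneg p).trans hp
  calc ‖M p q‖ ≤ ‖M‖ * ‖p‖ * ‖q‖ := M.le_opNorm₂ p q
    _ ≤ m * n * k := by gcongr

theorem norm_smul_le_of_mem_Icc {t : ℝ} (ht : t ∈ Set.Icc (0 : ℝ) 1) (v : E) : ‖t • v‖ ≤ ‖v‖ := by
  rw [norm_smul, Real.norm_of_nonneg ht.1]
  exact mul_le_of_le_one_left (norm_nonneg _) ht.2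

/-- Flatness has been used to interchange `v` and `z` in the derivative of the first variation:
what remains of its defect as a solution is of second order in `v`. -/
theorem norm_variation_defect_le {A₀ A₁ : E →L[ℝ] F →L[ℝ] F} {D : E →L[ℝ] E →L[ℝ] F →L[ℝ] F}
    {z v : E} {f : F} {t Φ : ℝ} (ht : t ∈ Set.Icc (0 : ℝ) 1) (hA₀ : ‖A₀‖ ≤ C) (hA₁ : ‖A₁‖ ≤ C)
    (hsub : ‖A₁ - A₀‖ ≤ C * ‖v‖) (htaylor : ‖A₁ - A₀ - D (t • v)‖ ≤ C * ‖v‖ ^ 2) (hz : ‖z‖ ≤ 1)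
    (hf : ‖f‖ ≤ Φ) :
    ‖A₀ z f + (t • (D v z f + A₀ z (A₀ v f)) + (1 : ℝ) • A₀ v f) - A₁ (z + v) (f + t • A₀ v f)‖
      ≤ 2 * (C + C ^ 2) * Φ * ‖v‖ ^ 2 := by
  have hdecomp : A₀ z f + (t • (D v z f + A₀ z (A₀ v f)) + (1 : ℝ) • A₀ v f)
      - A₁ (z + v) (f + t • A₀ v f)
      = -((A₁ - A₀ - D (t • v)) z f + (A₁ - A₀) v f + t • (A₁ - A₀) z (A₀ v f)
        + t • A₁ v (A₀ v f)) := by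
    simp only [map_add, map_smul, add_apply, sub_apply, smul_apply, smul_add, smul_sub, one_smul]
    abel
  have hA₀v := norm_apply₂_le A₀ v f hA₀ le_rfl hf
  rw [hdecomp, norm_neg]
  calc _ ≤ _ := norm_add₄_le
    _ ≤ C * ‖v‖ ^ 2 * 1 * Φ + C * ‖v‖ * ‖v‖ * Φ + C * ‖v‖ * 1 * (C * ‖v‖ * Φ)
          + C * ‖v‖ * (C * ‖v‖ * Φ) := by
      gcongr
      · exact norm_apply₂_le _ z f htaylor hz hf
      · exact norm_apply₂_le _ v f hsub le_rfl hf
      · exact (norm_smul_le_of_mem_Icc ht _).trans (norm_apply₂_le _ z (A₀ v f) hsub hz hA₀v)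
      · exact (norm_smul_le_of_mem_Icc ht _).trans (norm_apply₂_le _ v (A₀ v f) hA₁ le_rfl hA₀v)
    _ = 2 * (C + C ^ 2) * Φ * ‖v‖ ^ 2 := by ring

namespace IsTransport

theorem norm_sub_le (h : IsRadialBall A a r C) (hflat : IsFlatSystem A (Metric.ball a r))
    (hx : x ∈ Metric.ball a r) (hy : y ∈ Metric.ball a r) (hφ : IsTransport A a x φ)
    (hψ : IsTransport A a y ψ) (h0 : ψ 0 = φ 0) {Φ : ℝ}
    (hΦ : ∀ t ∈ Set.Icc (0 : ℝ) 1, ‖φ t‖ ≤ Φ) :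
    ‖ψ 1 - (φ 1 + A x (y - x) (φ 1))‖ ≤ 2 * (2 * (C + C ^ 2) * Φ * ‖y - x‖ ^ 2) := by
  have hC := h.nonneg
  have hΦ₀ : 0 ≤ Φ := (norm_nonneg _).trans (hΦ 0 (by simp))
  obtain ⟨v, rfl⟩ : ∃ v, y = x + v := ⟨y - x, by abel⟩
  rw [add_sub_cancel_left]
  have hmain := norm_sub_le_of_approx_linear_ODE (h.norm_apply_le hy)
    (ε := 2 * (C + C ^ 2) * Φ * ‖v‖ ^ 2) (by positivity) hψ
    (fun t ht => h.hasDerivWithinAt_variation hx hφ v ht) (fun t ht => ?_) (by simp [h0])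
  · simpa using hmain
  have hxt := h.mem_ball hx ht
  have hyt := h.mem_ball hy ht
  have hsub : (a + t • (x + v - a)) - (a + t • (x - a)) = t • v := by
    rw [add_sub_add_left_eq_sub, ← smul_sub, add_sub_right_comm, add_sub_cancel_left]
  have hlip := h.norm_sub_le _ hxt _ hyt
  have htaylor := h.norm_sub_sub_le _ hxt _ hyt
  have htv := norm_smul_le_of_mem_Icc ht v
  rw [hsub] at hlip htaylor
  have hz : ‖x - a‖ ≤ 1 := (mem_ball_iff_norm.1 hx).le.trans h.le_one
  rw [hflat _ hxt]
  rw [add_sub_right_comm x v a] at hyt hlip htaylor ⊢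
  exact norm_variation_defect_le ht (h.norm_le _ hxt) (h.norm_le _ hyt) (hlip.trans (by gcongr))
    (htaylor.trans (by gcongr)) hz (hΦ t ht)

theorem hasFDerivAt (h : IsRadialBall A a r C) (hflat : IsFlatSystem A (Metric.ball a r))
    {f₀ : F} {φ : E → ℝ → F} (h0 : ∀ x ∈ Metric.ball a r, φ x 0 = f₀)
    (hφ : ∀ x ∈ Metric.ball a r, IsTransport A a x (φ x)) (hx : x ∈ Metric.ball a r) :
    HasFDerivAt (fun x => φ x 1) ((A x).flip (φ x 1)) x := by
  obtain ⟨Φ, hΦ⟩ := isCompact_Icc.exists_bound_of_continuousOn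
    fun t ht => (hφ x hx t ht).continuousWithinAt
  have hO : (fun y => φ y 1 - (φ x 1 + A x (y - x) (φ x 1))) =O[𝓝 x] fun y => ‖y - x‖ ^ 2 := by
    refine Asymptotics.IsBigO.of_bound (2 * (2 * (C + C ^ 2) * Φ)) ?_
    filter_upwards [Metric.isOpen_ball.mem_nhds hx] with y hy
    rw [norm_pow, norm_norm, mul_assoc]
    exact norm_sub_le h hflat hx hy (hφ x hx) (hφ y hy) ((h0 y hy).trans (h0 x hx).symm) hΦ
  have hremainder := hO.hasFDerivAt (𝕜 := ℝ) one_lt_two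
  have hlinear : HasFDerivAt (fun y => φ x 1 + A x (y - x) (φ x 1)) ((A x).flip (φ x 1)) x :=
    ((((A x).flip (φ x 1)).hasFDerivAt.comp x ((hasFDerivAt_id x).sub_const x)).const_add
      (φ x 1)).congr_fderiv (by ext; simp)
  simpa only [Pi.add_def, sub_add_cancel, zero_add] using hremainder.add hlinear

theorem eq_self (h : IsRadialBall A a r C) (hφ : IsTransport A a a φ) : φ 1 = φ 0 := by
  have hbound := norm_sub_le_of_approx_linear_ODE
    (h.norm_apply_le (Metric.mem_ball_self h.pos)) le_rfl hφ
    (fun t _ => hasDerivWithinAt_const t _ (φ 0)) (fun t _ => by simp) rfl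
  rwa [mul_zero, norm_le_zero_iff, sub_eq_zero] at hbound

end IsTransport

theorem IsFlatSystem.exists_solution [CompleteSpace F] (hflat : IsFlatSystem A U) (hU : IsOpen U)
    (ha : a ∈ U) (hA : ContDiffOn ℝ 2 A U) :
    ∃ r > 0, Metric.ball a r ⊆ U ∧ ∀ f₀ : F, ∃ f : E → F, f a = f₀ ∧
      ∀ x ∈ Metric.ball a r, HasFDerivAt f ((A x).flip (f x)) x := by
  obtain ⟨r, C, h, hsub⟩ := exists_isRadialBall hU ha hA
  refine ⟨r, h.pos, hsub, fun f₀ => ?_⟩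
  have hsol (x : E) : ∃ φ : ℝ → F, x ∈ Metric.ball a r → φ 0 = f₀ ∧ IsTransport A a x φ := by
    by_cases hx : x ∈ Metric.ball a r
    · exact (h.exists_isTransport hx f₀).imp fun φ hφ _ => hφ
    · exact ⟨0, fun hx' => absurd hx' hx⟩
  choose φ hφ using hsol
  have ha' := hφ a (Metric.mem_ball_self h.pos)
  exact ⟨fun x => φ x 1, (ha'.2.eq_self h).trans ha'.1, fun x hx =>
    IsTransport.hasFDerivAt h (fun x hx => hflat x (hsub hx)) (fun x hx => (hφ x hx).1)
      (fun x hx => (hφ x hx).2) hx⟩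

theorem contDiffOn_of_hasFDerivAt_linear (hU : IsOpen U) (hA : ContDiffOn ℝ ∞ A U) {f : E → F}
    (hf : ∀ x ∈ U, HasFDerivAt f ((A x).flip (f x)) x) : ContDiffOn ℝ ∞ f U := by
  rw [contDiffOn_infty]
  intro n
  induction n with
  | zero => exact contDiffOn_zero.2 fun x hx => (hf x hx).continuousAt.continuousWithinAt
  | succ n ih =>
    rw [Nat.cast_succ, contDiffOn_succ_iff_fderiv_of_isOpen hU]
    refine ⟨fun x hx => (hf x hx).differentiableAt.differentiableWithinAt, by simp, ?_⟩
    have hflip : ContDiffOn ℝ n (fun x => (A x).flip) U :=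
      (ContinuousLinearMap.flipₗᵢ ℝ E F F).toContinuousLinearEquiv.contDiff.comp_contDiffOn
        (hA.of_le (by exact_mod_cast le_top))
    exact (hflip.clm_apply ih).congr fun x hx => (hf x hx).fderiv

end FlatSystem

/-! ### Existence of annihilators and of a momentum -/

namespace HydroJet

variable {N : ℕ} {Y : HydroJet N} {H : (Fin N → ℝ) →L[ℝ] (Fin N → ℝ)}

theorem coordPairing_D_add_coordPairing_B_comm (hGH : ∀ v, Y.G (H v) = v) (hY : Y.IsPoisson)
    (hK : Y.K = 0) (τ : ℝ) (θ ξ v w : Fin N → ℝ) :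
    ⟪ξ, Y.D v w θ⟫ + ⟪τ • H w + Y.parallel H θ w, Y.B v ξ⟫
      = ⟪ξ, Y.D w v θ⟫ + ⟪τ • H v + Y.parallel H θ v, Y.B w ξ⟫ := by
  have hB (v w : Fin N → ℝ) : ⟪τ • H w + Y.parallel H θ w, Y.B v ξ⟫
      = -(τ * ⟪Y.parallel H ξ w, v⟫ + ⟪Y.parallel H ξ v, Y.G (Y.parallel H θ w)⟫) := by
    rw [coordPairing_B hGH hY, map_add, map_smul, hGH, coordPairing_parallel_comm hGH hY,
      map_add, map_smul, smul_eq_mul, coordPairing_parallel_comm hGH hY ξ v w]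
  have hcurl := curl_eq_parallel hGH hY v w ξ θ
  have hsymm := hY.symm (Y.parallel H θ v) (Y.parallel H ξ w)
  rw [curl, hK, zero_mul, sub_zero] at hcurl
  rw [hB, hB, coordPairing_parallel_comm hGH hY ξ v w]
  linarith

end HydroJet

namespace HydroBracket

variable {N : ℕ} {U B : Set (Fin N → ℝ)} {Q : HydroBracket N} {p : Fin N → ℝ}

/-- The points of `U` at which the bracket is nondegenerate. -/
def regularSet (Q : HydroBracket N) (U : Set (Fin N → ℝ)) : Set (Fin N → ℝ) :=
  {a | a ∈ U ∧ Matrix.det (Matrix.of (Q.g a)) ≠ 0}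

theorem SmoothOn.isOpen_regularSet (hU : IsOpen U) (hQ : Q.SmoothOn U) :
    IsOpen (Q.regularSet U) := by
  have hdet : ContinuousOn (fun a => Matrix.det (Matrix.of (Q.g a))) U := by
    simp only [Matrix.det_apply]
    exact continuousOn_finsetSum _ fun σ _ => ContinuousOn.const_smul
      (continuousOn_finsetProd _ fun i _ => (hQ.1 _ _).continuousOn) _
  exact hdet.isOpen_inter_preimage hU isOpen_compl_singleton

theorem exists_equiv_eq_gL (hp : p ∈ Q.regularSet U) :
    ∃ e : (Fin N → ℝ) ≃L[ℝ] (Fin N → ℝ), (e : (Fin N → ℝ) →L[ℝ] (Fin N → ℝ)) = Q.gL p := by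
  have hinv := Matrix.invertibleOfIsUnitDet _ (isUnit_iff_ne_zero.2 hp.2)
  exact ⟨(Matrix.toLinearEquiv' _ hinv).toContinuousLinearEquiv, by
    ext1 ξ
    exact (gL_eq_mulVec Q p ξ).symm⟩

theorem gL_inverse (hp : p ∈ Q.regularSet U) (v : Fin N → ℝ) :
    Q.gL p ((Q.gL p).inverse v) = v := by
  obtain ⟨e, he⟩ := exists_equiv_eq_gL hp
  simp [← he]

theorem gL_injective (hp : p ∈ Q.regularSet U) : Function.Injective (Q.gL p) := by
  obtain ⟨e, he⟩ := exists_equiv_eq_gL hp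
  exact he ▸ e.injective

/-- The derivative along `v` of the differential `θ` of a density of a local bracket, as determined
by the equation `g (∂_v θ) + b(v) θ = τ v`; here `τ = 0` for annihilators and `τ = 1` for
momenta. -/
noncomputable def hessian (Q : HydroBracket N) (τ : ℝ) (θ v p : Fin N → ℝ) : Fin N → ℝ :=
  (Q.gL p).inverse (τ • v - Q.bL p v θ)

theorem gL_hessian (hp : p ∈ Q.regularSet U) (τ : ℝ) (θ v : Fin N → ℝ) :
    Q.gL p (Q.hessian τ θ v p) = τ • v - Q.bL p v θ :=
  gL_inverse hp _

theorem hessian_eq (τ : ℝ) (θ v p : Fin N → ℝ) :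
    Q.hessian τ θ v p
      = τ • (Q.gL p).inverse v + (Q.jet p).parallel (Q.gL p).inverse θ v := by
  rw [hessian, map_sub, map_smul, HydroJet.parallel_apply, sub_eq_add_neg]
  rfl

theorem SmoothOn.contDiffOn_hessian (hU : IsOpen U) (hQ : Q.SmoothOn U) (τ : ℝ)
    (θ v : Fin N → ℝ) : ContDiffOn ℝ ∞ (Q.hessian τ θ v) (Q.regularSet U) := by
  have hinv : ContDiffOn ℝ ∞ (fun p => (Q.gL p).inverse) (Q.regularSet U) := fun p hp => by
    obtain ⟨e, he⟩ := exists_equiv_eq_gL hp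
    have hmap : ContDiffAt ℝ ∞ ContinuousLinearMap.inverse (Q.gL p) := he ▸ contDiffAt_map_inverse e
    exact (hmap.comp p (hQ.contDiffOn_gL.contDiffAt (hU.mem_nhds hp.1))).contDiffWithinAt
  exact hinv.clm_apply (contDiffOn_const.sub
    (((hQ.contDiffOn_bL.mono fun _ hp => hp.1).clm_apply contDiffOn_const).clm_apply
      contDiffOn_const))

theorem SmoothOn.differentiableAt_hessian (hU : IsOpen U) (hQ : Q.SmoothOn U)
    (hp : p ∈ Q.regularSet U) (τ : ℝ) (θ v : Fin N → ℝ) :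
    DifferentiableAt ℝ (Q.hessian τ θ v) p :=
  ((hQ.contDiffOn_hessian hU τ θ v).contDiffAt
    ((hQ.isOpen_regularSet hU).mem_nhds hp)).differentiableAt (by simp)

theorem gL_fderiv_hessian (hU : IsOpen U) (hQ : Q.SmoothOn U) (hp : p ∈ Q.regularSet U) (τ : ℝ)
    (θ v w : Fin N → ℝ) :
    Q.gL p (fderiv ℝ (Q.hessian τ θ w) p v)
      = -fderiv ℝ Q.bL p v w θ - fderiv ℝ Q.gL p v (Q.hessian τ θ w p) := by
  have hleft := (hQ.hasFDerivAt_gL hU hp.1).clm_apply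
    (hQ.differentiableAt_hessian hU hp τ θ w).hasFDerivAt
  have hright := (hasFDerivAt_const (τ • w) p).sub
    (((hQ.hasFDerivAt_bL hU hp.1).clm_apply (hasFDerivAt_const w p)).clm_apply
      (hasFDerivAt_const θ p))
  have heq : (fun x => Q.gL x (Q.hessian τ θ w x)) =ᶠ[𝓝 p] fun x => τ • w - Q.bL x w θ :=
    Filter.eventually_of_mem ((hQ.isOpen_regularSet hU).mem_nhds hp) fun x hx => gL_hessian hx τ θ w
  have hv := DFunLike.congr_fun (hleft.unique (hright.congr_of_eventuallyEq heq)) v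
  refine eq_sub_of_add_eq ?_
  simpa using hv

theorem IsPoisson.coordPairing_hessian_comm (hU : IsOpen U) (hQ : Q.SmoothOn U)
    (hQp : Q.IsPoisson U) (hp : p ∈ Q.regularSet U) (τ : ℝ) (θ v w : Fin N → ℝ) :
    ⟪Q.hessian τ θ v p, w⟫ = ⟪Q.hessian τ θ w p, v⟫ := by
  have hY := hQp.jet hU hQ hp.1
  have hGH : ∀ v, (Q.jet p).G ((Q.gL p).inverse v) = v := gL_inverse hp
  simp only [hessian_eq, map_add, map_smul, add_apply, smul_apply]
  rw [HydroJet.coordPairing_inverse_comm hGH hY.symm v w,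
    HydroJet.coordPairing_parallel_comm hGH hY θ v w]

theorem IsPoisson.fderiv_hessian_comm (hU : IsOpen U) (hQ : Q.SmoothOn U) (hQp : Q.IsPoisson U)
    (hK : Q.K = 0) (hp : p ∈ Q.regularSet U) (τ : ℝ) (θ v w : Fin N → ℝ) :
    fderiv ℝ (Q.hessian τ θ w) p v + Q.hessian 0 (Q.hessian τ θ v p) w p
      = fderiv ℝ (Q.hessian τ θ v) p w + Q.hessian 0 (Q.hessian τ θ w p) v p := by
  have hY := hQp.jet hU hQ hp.1
  have hGH : ∀ v, (Q.jet p).G ((Q.gL p).inverse v) = v := gL_inverse hp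
  refine gL_injective hp (eq_of_forall_coordPairing fun ξ => ?_)
  simp only [map_add, gL_fderiv_hessian hU hQ hp, gL_hessian hp, map_sub, map_neg, zero_smul,
    map_zero, hQp.isMetric hU hQ p hp.1]
  have hjet := HydroJet.coordPairing_D_add_coordPairing_B_comm hGH hY hK τ θ ξ v w
  simp only [← hessian_eq] at hjet
  change ⟪ξ, fderiv ℝ Q.bL p v w θ⟫ + ⟪_, Q.bL p v ξ⟫
    = ⟪ξ, fderiv ℝ Q.bL p w v θ⟫ + ⟪_, Q.bL p w ξ⟫ at hjet
  linarith

/-- The linear system for a density, its differential `θ` and the constant `τ` of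
`HydroBracket.hessian`. -/
noncomputable def densitySystem (Q : HydroBracket N) (p : Fin N → ℝ) :
    (Fin N → ℝ) →L[ℝ] (ℝ × (Fin N → ℝ) × ℝ) →L[ℝ] (ℝ × (Fin N → ℝ) × ℝ) :=
  (LinearMap.mk₂ ℝ (fun (v : Fin N → ℝ) (f : ℝ × (Fin N → ℝ) × ℝ) =>
    ((⟪f.2.1, v⟫, Q.hessian f.2.2 f.2.1 v p, 0) : ℝ × (Fin N → ℝ) × ℝ))
    (fun v w f => by ext <;> simp [hessian]; ring)
    (fun c v f => by ext <;> simp [hessian]; ring)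
    (fun v f k => by ext <;> simp [hessian, add_smul]; ring)
    (fun c v f => by ext <;> simp [hessian, mul_assoc]; ring)).toContinuousBilinearMap

theorem densitySystem_apply (p v : Fin N → ℝ) (f : ℝ × (Fin N → ℝ) × ℝ) :
    Q.densitySystem p v f = (⟪f.2.1, v⟫, Q.hessian f.2.2 f.2.1 v p, 0) := rfl

theorem SmoothOn.contDiffOn_densitySystem (hU : IsOpen U) (hQ : Q.SmoothOn U) :
    ContDiffOn ℝ ∞ Q.densitySystem (Q.regularSet U) := by
  refine contDiffOn_clm_apply.2 fun v => contDiffOn_clm_apply.2 fun f => ?_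
  simp only [densitySystem_apply]
  exact contDiffOn_const.prodMk ((hQ.contDiffOn_hessian hU _ _ v).prodMk contDiffOn_const)

theorem fderiv_densitySystem (hU : IsOpen U) (hQ : Q.SmoothOn U) (hp : p ∈ Q.regularSet U)
    (v w : Fin N → ℝ) (f : ℝ × (Fin N → ℝ) × ℝ) :
    fderiv ℝ Q.densitySystem p v w f = (0, fderiv ℝ (Q.hessian f.2.2 f.2.1 w) p v, 0) := by
  have hsystem := (((hQ.contDiffOn_densitySystem hU).contDiffAt
    ((hQ.isOpen_regularSet hU).mem_nhds hp)).differentiableAt (by simp)).hasFDerivAt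
  have hcomponents : HasFDerivAt (fun x => Q.densitySystem x w f)
      ((0 : (Fin N → ℝ) →L[ℝ] ℝ).prod ((fderiv ℝ (Q.hessian f.2.2 f.2.1 w) p).prod 0)) p :=
    (hasFDerivAt_const _ _).prodMk
      ((hQ.differentiableAt_hessian hU hp _ _ w).hasFDerivAt.prodMk (hasFDerivAt_const _ _))
  have heq := ((hsystem.clm_apply (hasFDerivAt_const w p)).clm_apply
    (hasFDerivAt_const f p)).unique hcomponents
  simpa using DFunLike.congr_fun heq v

theorem IsPoisson.isFlatSystem_densitySystem (hU : IsOpen U) (hQ : Q.SmoothOn U)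
    (hQp : Q.IsPoisson U) (hK : Q.K = 0) : IsFlatSystem Q.densitySystem (Q.regularSet U) := by
  intro p hp v w f
  simp only [fderiv_densitySystem hU hQ hp, densitySystem_apply, Prod.mk_add_mk, zero_add, add_zero]
  rw [hQp.coordPairing_hessian_comm hU hQ hp, hQp.fderiv_hessian_comm hU hQ hK hp]

theorem gradCovector_fst_eq {F : (Fin N → ℝ) → ℝ × (Fin N → ℝ) × ℝ}
    (hF : HasFDerivAt F ((Q.densitySystem p).flip (F p)) p) :
    gradCovector (fun p => (F p).1) p = (F p).2.1 := by
  have hfst : HasFDerivAt (fun p => (F p).1) (coordPairing (F p).2.1) p :=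
    hF.fst.congr_fderiv (by ext; rfl)
  rw [gradCovector, hfst.fderiv, components_coordPairing]

theorem gL_fderiv_gradCovector_fst_add (hB : IsOpen B) (hBU : B ⊆ Q.regularSet U)
    {F : (Fin N → ℝ) → ℝ × (Fin N → ℝ) × ℝ}
    (hF : ∀ p ∈ B, HasFDerivAt F ((Q.densitySystem p).flip (F p)) p) (hp : p ∈ B)
    (v : Fin N → ℝ) :
    Q.gL p (fderiv ℝ (gradCovector fun p => (F p).1) p v)
      + Q.bL p v (gradCovector (fun p => (F p).1) p) = (F p).2.2 • v := by
  have hgrad : gradCovector (fun p => (F p).1) =ᶠ[𝓝 p] fun p => (F p).2.1 :=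
    Filter.eventually_of_mem (hB.mem_nhds hp) fun p hp => gradCovector_fst_eq (hF p hp)
  have hderiv : fderiv ℝ (fun p => (F p).2.1) p v = Q.hessian (F p).2.2 (F p).2.1 v p := by
    rw [(hF p hp).snd.fst.fderiv]
    rfl
  rw [hgrad.fderiv_eq, hderiv, gradCovector_fst_eq (hF p hp), gL_hessian (hBU hp), sub_add_cancel]

theorem snd_snd_eq (hB : IsOpen B) (hBc : IsPreconnected B)
    {F : (Fin N → ℝ) → ℝ × (Fin N → ℝ) × ℝ}
    (hF : ∀ p ∈ B, HasFDerivAt F ((Q.densitySystem p).flip (F p)) p) {a : Fin N → ℝ} (ha : a ∈ B)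
    (hp : p ∈ B) : (F p).2.2 = (F a).2.2 := by
  have hderiv (p : Fin N → ℝ) (hp : p ∈ B) :
      HasFDerivAt (fun p => (F p).2.2) (0 : (Fin N → ℝ) →L[ℝ] ℝ) p :=
    (hF p hp).snd.snd.congr_fderiv (by ext; rfl)
  exact hB.is_const_of_fderiv_eq_zero (f := fun p => (F p).2.2) hBc
    (fun p hp => (hderiv p hp).differentiableAt.differentiableWithinAt)
    (fun p hp => (hderiv p hp).fderiv) hp ha

theorem IsPoisson.exists_density (hU : IsOpen U) (hQ : Q.SmoothOn U) (hQp : Q.IsPoisson U)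
    (hK : Q.K = 0) {a : Fin N → ℝ} (ha : a ∈ Q.regularSet U) :
    ∃ r > 0, Metric.ball a r ⊆ Q.regularSet U ∧ ∀ (ξ : Fin N → ℝ) (τ : ℝ), ∃ f : (Fin N → ℝ) → ℝ,
      ContDiffOn ℝ ∞ f (Metric.ball a r) ∧ gradCovector f a = ξ ∧
      ∀ p ∈ Metric.ball a r, ∀ v, Q.gL p (fderiv ℝ (gradCovector f) p v)
        + Q.bL p v (gradCovector f p) = τ • v := by
  have hsmooth := hQ.contDiffOn_densitySystem hU
  obtain ⟨r, hr, hball, hsol⟩ := (hQp.isFlatSystem_densitySystem hU hQ hK).exists_solution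
    (hQ.isOpen_regularSet hU) ha (hsmooth.of_le (by norm_cast))
  have ha' : a ∈ Metric.ball a r := Metric.mem_ball_self hr
  refine ⟨r, hr, hball, fun ξ τ => ?_⟩
  obtain ⟨F, hFa, hF⟩ := hsol (0, ξ, τ)
  have hFs := contDiffOn_of_hasFDerivAt_linear Metric.isOpen_ball (hsmooth.mono hball) hF
  refine ⟨fun p => (F p).1, hFs.fst, by rw [gradCovector_fst_eq (hF a ha'), hFa], fun p hp v => ?_⟩
  rw [gL_fderiv_gradCovector_fst_add Metric.isOpen_ball hball hF hp,
    snd_snd_eq Metric.isOpen_ball (convex_ball a r).isPreconnected hF ha' hp, hFa]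

theorem isOpen_setOf_linearIndependent_fderiv {n : Fin N → (Fin N → ℝ) → ℝ} (hB : IsOpen B)
    (hn : ∀ i, ContDiffOn ℝ ∞ (n i) B) :
    IsOpen {p | p ∈ B ∧ LinearIndependent ℝ fun i => fderiv ℝ (n i) p} := by
  have hcont : ContinuousOn (fun p i => fderiv ℝ (n i) p) B := continuousOn_pi.2 fun i =>
    (hn i).continuousOn_fderiv_of_isOpen hB (by simp)
  exact hcont.isOpen_inter_preimage hB isOpen_setOfPred_linearIndependent

theorem IsPoisson.exists_annihilatorsAndMomentum (hU : IsOpen U) (hQ : Q.SmoothOn U)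
    (hQp : Q.IsPoisson U) (hK : Q.K = 0) {a : Fin N → ℝ} (ha : a ∈ Q.regularSet U) :
    ∃ V ⊆ U, IsOpen V ∧ Convex ℝ V ∧ a ∈ V ∧ ∃ n m, Q.IsAnnihilatorsAndMomentum V n m := by
  obtain ⟨r, hr, hball, hsol⟩ := hQp.exists_density hU hQ hK ha
  choose n hn hna hneq using fun i : Fin N => hsol (Pi.single i 1) 0
  obtain ⟨m, hm, -, hmeq⟩ := hsol 0 1
  have hindep : LinearIndependent ℝ fun i => fderiv ℝ (n i) a := by
    refine LinearIndependent.of_comp components.toLinearMap ?_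
    convert (Pi.basisFun ℝ (Fin N)).linearIndependent using 1
    ext1 i
    rw [Pi.basisFun_apply]
    exact hna i
  obtain ⟨ρ, hρ, hsub⟩ := Metric.isOpen_iff.1
    (isOpen_setOf_linearIndependent_fderiv Metric.isOpen_ball hn) a
    ⟨Metric.mem_ball_self hr, hindep⟩
  have hρr : Metric.ball a ρ ⊆ Metric.ball a r := fun p hp => (hsub hp).1
  have hρU : Metric.ball a ρ ⊆ U := fun p hp => (hball (hρr hp)).1
  refine ⟨Metric.ball a ρ, hρU, Metric.isOpen_ball, convex_ball _ _, Metric.mem_ball_self hρ, n, m,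
    fun i => (hn i).mono hρr, hm.mono hρr, fun p hp => (hsub hp).2, fun i => ?_, ?_⟩
  · refine (isAnnihilator_iff Metric.isOpen_ball (hQ.mono hρU)
      (fun p hp => (hQp.jet hU hQ (hρU hp)).symm) ((hQp.isMetric hU hQ).mono hρU) hK
      ((hn i).mono hρr)).2 fun p hp v => ?_
    rw [hneq i p (hρr hp), zero_smul]
  · refine (isMomentum_iff Metric.isOpen_ball (hQ.mono hρU) hK (hm.mono hρr)).2 fun p hp v => ?_
    rw [hmeq p (hρr hp), one_smul]

end HydroBracket

theorem mainTheorem4 {N : ℕ} (U : Set (Fin N → ℝ)) (hU : IsOpen U)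
    (P₁ P₂ : HydroBracket N) (hs₁ : P₁.SmoothOn U) (hs₂ : P₂.SmoothOn U)
    (hP₁ : P₁.IsPoisson U) (hP₂ : P₂.IsPoisson U)
    (hloc : P₂.K = 0) (hnd : P₂.Nondegenerate U) :
    -- near every point of nondegeneracy there are `N` annihilators and a momentum
    (∀ a ∈ U, Matrix.det (Matrix.of (P₂.g a)) ≠ 0 →
      ∃ V ⊆ U, IsOpen V ∧ Convex ℝ V ∧ a ∈ V ∧ ∃ n m, P₂.IsAnnihilatorsAndMomentum V n m) ∧
    -- compatibility is equivalent to involution of all such annihilators and momenta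
    (P₁.Compatible P₂ U ↔
      ∀ V ⊆ U, IsOpen V → Convex ℝ V → ∀ n m, P₂.IsAnnihilatorsAndMomentum V n m →
        P₁.AnnihilatorsAndMomentumInInvolution V n m) ∧
    -- and to involution of some of them near every point of nondegeneracy
    (P₁.Compatible P₂ U ↔
      ∀ a ∈ U, Matrix.det (Matrix.of (P₂.g a)) ≠ 0 →
        ∃ V ⊆ U, IsOpen V ∧ Convex ℝ V ∧ a ∈ V ∧ ∃ n m, P₂.IsAnnihilatorsAndMomentum V n m ∧
          P₁.AnnihilatorsAndMomentumInInvolution V n m) := by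
  have hex := fun a (ha : a ∈ U) (hd : Matrix.det (Matrix.of (P₂.g a)) ≠ 0) =>
    hP₂.exists_annihilatorsAndMomentum hU hs₂ hloc ⟨ha, hd⟩
  have hinv {V n m} (hVU : V ⊆ U) (hV : IsOpen V) (hVc : Convex ℝ V)
      (h : P₂.IsAnnihilatorsAndMomentum V n m) :
      P₁.AnnihilatorsAndMomentumInInvolution V n m ↔
        ∀ p ∈ V, HydroJet.Compatible (P₁.jet p) (P₂.jet p) :=
    h.inInvolution_iff hV hVc (hs₁.mono hVU) (fun p hp => hP₁.isSymm (hVU hp))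
      ((hP₁.isMetric hU hs₁).mono hVU) (hs₂.mono hVU) ((hP₂.isMetric hU hs₂).mono hVU)
      (fun p hp => hP₂.jet hU hs₂ (hVU hp)) hloc
  have hab (hc : P₁.Compatible P₂ U) V (hVU : V ⊆ U) (hV : IsOpen V) (hVc : Convex ℝ V) n m
      (h : P₂.IsAnnihilatorsAndMomentum V n m) : P₁.AnnihilatorsAndMomentumInInvolution V n m :=
    (hinv hVU hV hVc h).2 fun p hp => hc.jet hU hs₁ hs₂ hP₁ hP₂ (hVU hp)
  have hba (h : ∀ p ∈ P₂.regularSet U, HydroJet.Compatible (P₁.jet p) (P₂.jet p)) :=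
    HydroBracket.compatible_of_compatible_jet hU hs₁ hs₂ hP₁ hP₂ (fun _ hp => hp.1) hnd h
  refine ⟨hex, ⟨hab, fun hb => hba fun a ⟨ha, hd⟩ => ?_⟩, fun hc a ha hd => ?_,
    fun hc => hba fun a ⟨ha, hd⟩ => ?_⟩
  · obtain ⟨V, hVU, hV, hVc, haV, n, m, h⟩ := hex a ha hd
    exact (hinv hVU hV hVc h).1 (hb V hVU hV hVc n m h) a haV
  · obtain ⟨V, hVU, hV, hVc, haV, n, m, h⟩ := hex a ha hd
    exact ⟨V, hVU, hV, hVc, haV, n, m, h, hab hc V hVU hV hVc n m h⟩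
  · obtain ⟨V, hVU, hV, hVc, haV, n, m, h, hi⟩ := hc a ha hd
    exact (hinv hVU hV hVc h).1 hi a haV
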